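/- A conjunctive query $q$ is a conjunction of atoms $R(\bar x)$ over a finite relational schema in which some of the variables are existentially quantified; the other variables are its free variables, and $q$ is binary if it has exactly two of them. The same relation symbol may occur in several atoms. For a database $D$ (a finite domain together with a finite set of facts), $q(D)$ is the set of restrictions to the free variables of all assignments of the variables of $q$ to domain elements that map every atom of $q$ to a fact of $D$. An endomorphism of $q$ is a map from the variables of $q$ to themselves that maps every atom of $q$ to an atom of $q$; $q$ is minimal if every endomorphism that is the identity on the free variables is injective. $q$ is acyclic if it has a join tree, i.e. a tree whose nodes are the atoms of $q$ such that, for each variable $x$, the atoms containing $x$ form a connected part of the tree; an acyclic $q$ is free-connex if adding to $q$ a new atom (with a new relation symbol) that contains exactly the free variables of $q$ gives an acyclic query again. The computation model is the uniform-cost RAM with addition and multiplication (and truncated subtraction), in which all numbers that are computed are bounded by a polynomial in the input size. An enumeration algorithm for $q$ with linear preprocessing and constant delay is one that, on each database $D$, first runs a preprocessing phase, without output, in time $O(\|D\|)$, where $\|D\|$ is the number of domain elements plus the number of facts of $D$, and then outputs the elements of $q(D)$ one by one, without repetition, such that the time before the first output, between two consecutive outputs, and between the last output and the end is $O(1)$.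 The constants may depend on $q$ but not on $D$, and the memory used is not restricted further. - BMM is the conjecture that no algorithm multiplies two $n\times n$ Boolean matrices in time $O(n^2)$. - Hyperclique is the conjecture that, for every $k\ge 3$, no algorithm decides in time $O(n^{k-1})$ whether a $(k-1)$-uniform hypergraph with $n$ vertices has a $k$-hyperclique, i.e. a set of $k$ vertices all of whose subsets of size $k-1$ are hyperedges. **Theorem.** Assume BMM and Hyperclique. Let $q$ be a minimal binary conjunctive query (self-joins allowed) that is not both acyclic and free-connex. Then there is no enumeration algorithm for $q$ with linear preprocessing and constant delay. -/

import Mathlib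

/-! ## Conjunctive queries and databases -/

namespace CQ

/-- A finite relational schema: finitely many relation symbols, each with an arity. -/
structure Schema where
  numSymbols : ℕ
  arity : Fin numSymbols → ℕ

/-- `R(v₁, …, vᵣ)` with entries in `V`: an atom if `V` is a set of variables, a fact if `V` is the
domain of a database. -/
abbrev Atom (σ : Schema) (V : Type) : Type :=
  Σ R : Fin σ.numSymbols, (Fin (σ.arity R) → V)

/-- Apply `f` to every entry of an atom: `R(v₁, …, vᵣ) ↦ R(f v₁, …, f vᵣ)`. -/
def Atom.map {σ : Schema} {V W : Type} (f : V → W) (A : Atom σ V) : Atom σ W :=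
  ⟨A.1, fun i => f (A.2 i)⟩

/-- The set of entries of an atom. -/
def Atom.vars {σ : Schema} {V : Type} (A : Atom σ V) : Set V :=
  Set.range A.2

/-- A database over `σ`: a finite domain `{0, …, dom - 1}` and a finite set of facts over it. -/
structure Database (σ : Schema) where
  dom : ℕ
  facts : Finset (Atom σ (Fin dom))

/-- The size of a database: number of domain elements plus number of tuples. (If every domain
element occurs in a fact, this is linear in the number of tuples.) -/
def Database.size {σ : Schema} (D : Database σ) : ℕ :=
  D.dom + D.facts.card

/-- A conjunctive query of arity `r` over `σ`, with variables `{0, …, numVars - 1}`: a finite set of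
atoms (its conjunction), and the tuple of its `r` distinct free variables; all other variables are
existentially quantified. Every variable occurs in some atom. A relation symbol may occur in
several atoms (self-joins). -/
structure Query (σ : Schema) (r : ℕ) where
  numVars : ℕ
  atoms : Finset (Atom σ (Fin numVars))
  free : Fin r → Fin numVars
  free_injective : Function.Injective free
  occurs : ∀ x : Fin numVars, ∃ A ∈ atoms, x ∈ A.vars

namespace Query

variable {σ : Schema} {r : ℕ}

/-- The set `q(D)` of solutions of `q` over `D`. -/
def answers (q : Query σ r) (D : Database σ) : Set (Fin r → Fin D.dom) :=
  {a | ∃ μ : Fin q.numVars → Fin D.dom,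
    (∀ A ∈ q.atoms, A.map μ ∈ D.facts) ∧ ∀ i, a i = μ (q.free i)}

/-- An endomorphism of `q`: a map on the variables that preserves the atoms. -/
def IsEndomorphism (q : Query σ r) (ν : Fin q.numVars → Fin q.numVars) : Prop :=
  ∀ A ∈ q.atoms, A.map ν ∈ q.atoms

/-- `q` is minimal if every endomorphism that is the identity on the free variables is an
automorphism, i.e. injective. -/
def IsMinimal (q : Query σ r) : Prop :=
  ∀ ν : Fin q.numVars → Fin q.numVars,
    q.IsEndomorphism ν → (∀ i, ν (q.free i) = q.free i) → Function.Injective ν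

end Query

/-- The family `e` of hyperedges has a join tree: a tree on the index set in which, for each
vertex `x`, the indices of the edges containing `x` form a connected part. -/
def HasJoinTree {ι V : Type} (e : ι → Set V) : Prop :=
  ∃ T : SimpleGraph ι, T.IsTree ∧ ∀ x : V, (T.induce {i | x ∈ e i}).Preconnected

namespace Query

variable {σ : Schema} {r : ℕ}

/-- `q` is acyclic: there is a join tree whose nodes are the atoms of `q`. -/
def IsAcyclic (q : Query σ r) : Prop :=
  HasJoinTree (fun A : q.atoms => A.1.vars)

/-- The query obtained from `q` by adding one new atom that contains exactly the free variables of
`q` (the node `none`) has a join tree. -/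
def IsAcyclicWithHead (q : Query σ r) : Prop :=
  HasJoinTree (fun A : Option q.atoms => A.elim (Set.range q.free) (fun B => B.1.vars))

/-- `q` is acyclic and free-connex. -/
def IsAcyclicFreeConnex (q : Query σ r) : Prop :=
  q.IsAcyclic ∧ q.IsAcyclicWithHead

end Query

end CQ

/-! ## Random access machines

Uniform-cost random access machines on natural numbers, with addition, truncated subtraction and
multiplication, indirect memory access, and structured control flow (each goto program is simulated
by such a program with constant-factor overhead, and conversely). As usual for this model, all
numbers that are computed must stay below a bound `W`, which in the definitions below is polynomial
in the input size: registers hold `O(log n)` bits on inputs of size `n`. -/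

namespace RAM

/-- Arithmetic operations. Subtraction is truncated at `0`, so it also provides comparisons. -/
inductive Op where
  | add
  | sub
  | mul

def Op.eval : Op → ℕ → ℕ → ℕ
  | .add, a, b => a + b
  | .sub, a, b => a - b
  | .mul, a, b => a * b

/-- Programs. The numbers `d a b` are names of registers; a program mentions finitely many. -/
inductive Prog where
  /-- Do nothing. -/
  | skip
  /-- `reg d := v` -/
  | const (d v : ℕ)
  /-- `reg d := reg a o reg b` -/
  | arith (o : Op) (d a b : ℕ)
  /-- `reg d := mem (reg a)` -/
  | load (d a : ℕ)
  /-- `mem (reg a) := reg b` -/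
  | store (a b : ℕ)
  /-- Output the tuple of the contents of the listed registers. -/
  | output (rs : List ℕ)
  | seq (P Q : Prog)
  /-- If `reg a ≠ 0` then `P` else `Q`. -/
  | ite (a : ℕ) (P Q : Prog)
  /-- While `reg a ≠ 0` do `P`. -/
  | loop (a : ℕ) (P : Prog)

/-- Contents of the registers and of the memory. -/
structure State where
  reg : ℕ → ℕ
  mem : ℕ → ℕ

def State.setReg (s : State) (d v : ℕ) : State :=
  { s with reg := Function.update s.reg d v }

def State.setMem (s : State) (p v : ℕ) : State :=
  { s with mem := Function.update s.mem p v }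

/-- The initial state on input `w`: the input stands in the memory from address `0` on, everything
else is `0`. -/
def State.init (w : List ℕ) : State where
  reg := fun _ => 0
  mem := fun i => w.getD i 0

/-- The record of a run: one entry per executed step, `some v` if that step outputs the tuple `v`
and `none` otherwise. The running time is the length of the trace. -/
abbrev Trace : Type := List (Option (List ℕ))

/-- The sequence of tuples that are output. -/
def Trace.outputs (t : Trace) : List (List ℕ) :=
  t.filterMap id

/-- The delay is at most `c`: at most `c` consecutive steps pass without an output (between two
outputs, before the first one, and between the last one and the end). -/
def Trace.DelayLE (t : Trace) (c : ℕ) : Prop :=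
  ∀ u : Trace, u <:+: t → u.outputs = [] → u.length ≤ c

/-- `Exec W P s t f`: started in state `s`, the program `P` halts in state `f` with trace `t`,
and all numbers it computes are at most `W`. -/
inductive Exec (W : ℕ) : Prog → State → Trace → State → Prop where
  | skip (s : State) : Exec W .skip s [none] s
  | const (s : State) (d v : ℕ) (h : v ≤ W) : Exec W (.const d v) s [none] (s.setReg d v)
  | arith (s : State) (o : Op) (d a b : ℕ) (h : o.eval (s.reg a) (s.reg b) ≤ W) :
      Exec W (.arith o d a b) s [none] (s.setReg d (o.eval (s.reg a) (s.reg b)))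
  | load (s : State) (d a : ℕ) : Exec W (.load d a) s [none] (s.setReg d (s.mem (s.reg a)))
  | store (s : State) (a b : ℕ) : Exec W (.store a b) s [none] (s.setMem (s.reg a) (s.reg b))
  | output (s : State) (rs : List ℕ) : Exec W (.output rs) s [some (rs.map s.reg)] s
  | seq {P Q : Prog} {s₁ s₂ s₃ : State} {t₁ t₂ : Trace}
      (h₁ : Exec W P s₁ t₁ s₂) (h₂ : Exec W Q s₂ t₂ s₃) : Exec W (.seq P Q) s₁ (t₁ ++ t₂) s₃
  | iteTrue {a : ℕ} {P Q : Prog} {s f : State} {t : Trace}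
      (ha : s.reg a ≠ 0) (h : Exec W P s t f) : Exec W (.ite a P Q) s (none :: t) f
  | iteFalse {a : ℕ} {P Q : Prog} {s f : State} {t : Trace}
      (ha : s.reg a = 0) (h : Exec W Q s t f) : Exec W (.ite a P Q) s (none :: t) f
  | loopTrue {a : ℕ} {P : Prog} {s₁ s₂ s₃ : State} {t₁ t₂ : Trace}
      (ha : s₁.reg a ≠ 0) (h₁ : Exec W P s₁ t₁ s₂) (h₂ : Exec W (.loop a P) s₂ t₂ s₃) :
      Exec W (.loop a P) s₁ (none :: (t₁ ++ t₂)) s₃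
  | loopFalse {a : ℕ} {P : Prog} {s : State} (ha : s.reg a = 0) : Exec W (.loop a P) s [none] s

/-- With numbers bounded by `W`, the program `P` halts on input `w` within `T` steps and its
sequence of outputs is `out`. -/
def Computes (W : ℕ) (P : Prog) (w : List ℕ) (T : ℕ) (out : List (List ℕ)) : Prop :=
  ∃ (t : Trace) (f : State), Exec W P (State.init w) t f ∧ t.length ≤ T ∧ t.outputs = out

end RAM

/-! ## The conjectures -/

namespace Conjectures

/-- The entries of a Boolean matrix, row by row, as numbers `0` and `1`. -/
def entries {n : ℕ} (A : Matrix (Fin n) (Fin n) Bool) : List ℕ :=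
  (List.finRange n).flatMap fun i => (List.finRange n).map fun j => (A i j).toNat

/-- The product of Boolean matrices. -/
def boolMul {n : ℕ} (A B : Matrix (Fin n) (Fin n) Bool) : Matrix (Fin n) (Fin n) Bool :=
  fun i j => decide (∃ k, A i k = true ∧ B k j = true)

/-- No program multiplies two `n × n` Boolean matrices in time `O(n²)`. The input is `n` followed by
the entries of the two matrices; the output is the sequence of entries of the product. -/
def BMM : Prop :=
  ¬ ∃ (P : RAM.Prog) (c : ℕ), ∀ (n : ℕ) (A B : Matrix (Fin n) (Fin n) Bool),
    RAM.Computes ((n + 2) ^ c) P (n :: (entries A ++ entries B)) (c * (n ^ 2 + 1))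
      ((entries (boolMul A B)).map fun v => [v])

/-- The hypergraph on `{0, …, n - 1}` with edge set `E` has a `k`-hyperclique: `k` vertices all of
whose subsets of size `k - 1` are edges. -/
def HasHyperclique {n : ℕ} (k : ℕ) (E : Finset (Finset (Fin n))) : Prop :=
  ∃ S : Finset (Fin n), S.card = k ∧ ∀ T ⊆ S, T.card = k - 1 → T ∈ E

/-- All `m`-tuples of elements of `{0, …, n - 1}`, in lexicographic order. -/
def tuples (n : ℕ) : ℕ → List (List (Fin n))
  | 0 => [[]]
  | m + 1 => (List.finRange n).flatMap fun v => (tuples n m).map fun l => v :: l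

/-- The adjacency tensor of an `m`-uniform hypergraph: for each `m`-tuple of vertices, in
lexicographic order, `1` if its entries form an edge and `0` otherwise. -/
def adjacency {n : ℕ} (m : ℕ) (E : Finset (Finset (Fin n))) : List ℕ :=
  (tuples n m).map fun l => if l.toFinset ∈ E then 1 else 0

open Classical in
/-- For all `k ≥ 3`, no program decides in time `O(n ^ (k - 1))` whether a `(k - 1)`-uniform
hypergraph with `n` vertices has a `k`-hyperclique. The input is `n` followed by the adjacency
tensor; the output is `1` for yes and `0` for no. -/
def Hyperclique : Prop :=
  ∀ k : ℕ, 3 ≤ k →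
    ¬ ∃ (P : RAM.Prog) (c : ℕ), ∀ (n : ℕ) (E : Finset (Finset (Fin n))),
      (∀ e ∈ E, e.card = k - 1) →
        RAM.Computes ((n + 2) ^ c) P (n :: adjacency (k - 1) E) (c * (n ^ (k - 1) + 1))
          [[if HasHyperclique k E then 1 else 0]]

end Conjectures

/-! ## Enumeration algorithms -/

namespace CQ

/-- The word `w` encodes the database `D`: the domain size, the number of facts, and then the facts
in some order, without repetition, each as its relation symbol followed by its entries. -/
def Database.Encodes {σ : Schema} (D : Database σ) (w : List ℕ) : Prop :=
  ∃ L : List (Atom σ (Fin D.dom)), L.Nodup ∧ (∀ A, A ∈ L ↔ A ∈ D.facts) ∧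
    w = D.dom :: L.length ::
      L.flatMap fun A => (A.1 : ℕ) :: List.ofFn fun i => (A.2 i : ℕ)

/-- There is an algorithm that, on every database `D`, first performs a preprocessing phase `pre`
(without outputs) in time linear in the size of `D`, and then in an enumeration phase `enum`, which
starts from the registers and memory left by the preprocessing, outputs the solutions of `q` over
`D` one by one, without repetition and with constant delay. The constant `c` may depend on `q` but
not on `D`. There is no restriction on the memory beyond the polynomial bound on numbers, hence on
addresses. -/
def Query.HasLinearPreprocessingConstantDelay {σ : Schema} {r : ℕ} (q : Query σ r) : Prop :=
  ∃ (pre enum : RAM.Prog) (c : ℕ), ∀ (D : Database σ) (w : List ℕ), D.Encodes w →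
    ∃ (t₁ t₂ : RAM.Trace) (s f : RAM.State),
      RAM.Exec ((D.size + 2) ^ c) pre (RAM.State.init w) t₁ s ∧
      t₁.length ≤ c * (D.size + 1) ∧ t₁.outputs = [] ∧
      RAM.Exec ((D.size + 2) ^ c) enum s t₂ f ∧
      t₂.DelayLE c ∧ t₂.outputs.Nodup ∧
      ∀ v : List ℕ, v ∈ t₂.outputs ↔ ∃ a ∈ q.answers D, v = List.ofFn fun i => (a i : ℕ)

end CQ

/-! ## Hypergraphs without a join tree -/

namespace CQ

section JoinTree

variable {ι V : Type} {e : ι → Set V}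

/-! A hypergraph without a join tree contains a `CyclePattern` (`exists_cyclePattern`). Join trees
are grown one hyperedge at a time. Growth can only fail at a connected set `C` of uncovered vertices
whose neighbours all lie in one hyperedge, while no hyperedge meeting `C` contains them all. A
minimal set `M` of neighbours that is not covered by a hyperedge meeting `C` completes the pattern.
Contracting `C` to a point turns the pattern into a hyperclique on `M.card + 1` points in which each
set of `M.card` points lies in a hyperedge, but no hyperedge contains all points.

If the query itself has a pattern, hyperclique detection for `k = M.card + 1` reduces to it. If the
pattern needs the head edge, `C` can be chosen disjoint from the free variables. Either an atom
covers `M`, and the pattern is one of the query, or the head edge covers `M`. In the latter case `M`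
consists of exactly the two free variables, and the query encodes Boolean matrix multiplication with
`C` as summation index.

Both reductions are instances of a `Coloring`. A color stands for a point of the pattern and takes
values `1, …, n`. The database contains, for each atom and each choice of values for its colors that
passes the test of the atom, the fact in which each variable is replaced by the pair of the variable
and the value of its color. An atom never has more than `e` colors, so there are `O(n ^ e)` facts up
to additive lower-order terms. The tags deal with self-joins: the tag part of a homomorphism into
the database is an endomorphism of the query. If it fixes the free variables, it is a permutation by
minimality, and undoing it yields an assignment to the colors that passes all tests
(`Coloring.exists_valid`, `Coloring.answers_iff`).

On the machine side, one program writes this database (`Terminates.buildProg`), and the enumeration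
algorithm is simulated on it, recording each answer in a table instead of printing it
(`Exec.tabulate`). Since the query is binary, there are `O((n + 1) ^ 2)` answers, so with `2 ≤ e`
preprocessing and enumeration together take time `O((n + 1) ^ e)` (`Coloring.exists_table`). The
table is then printed as the product matrix, or searched for a nonzero entry. Here `e = 2`
contradicts `BMM`, and `e = M.card = k - 1` contradicts `Hyperclique`. -/

/-- A list of hyperedges with the running intersection property (the last entry comes first). -/
inductive RunningIntersection (e : ι → Set V) (r : ι) : List ι → Prop where
  | root : RunningIntersection e r [r]
  | cons {l : List ι} {i g : ι} (hl : RunningIntersection e r l) (hi : i ∉ l) (hg : g ∈ l)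
      (h : ∀ j ∈ l, e i ∩ e j ⊆ e g) : RunningIntersection e r (i :: l)

theorem RunningIntersection.nodup {r : ι} {l : List ι} (h : RunningIntersection e r l) :
    l.Nodup := by
  induction h with
  | root => simp
  | cons _ hi _ _ ih => exact List.nodup_cons.2 ⟨hi, ih⟩

theorem RunningIntersection.root_mem {r : ι} {l : List ι} (h : RunningIntersection e r l) :
    r ∈ l := by
  induction h with
  | root => simp
  | cons _ _ _ _ ih => exact List.mem_cons_of_mem _ ih

/-- Each new index becomes a leaf attached to its `g`: a vertex that the new hyperedge shares with
an earlier one also lies in `e g`, so the new tree edge keeps its occurrences connected. Confining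
adjacency to `l` is what makes the new index isolated beforehand. -/
theorem RunningIntersection.exists_graph {r : ι} {l : List ι} (h : RunningIntersection e r l) :
    ∃ T : SimpleGraph ι, (∀ a b, T.Adj a b → a ∈ l) ∧ T.IsAcyclic ∧
      (∀ a ∈ l, T.Reachable a r) ∧
      ∀ x : V, ∀ a b : {i | x ∈ e i}, a.1 ∈ l → b.1 ∈ l →
        (T.induce {i | x ∈ e i}).Reachable a b := by
  induction h with
  | root =>
    refine ⟨⊥, by simp, SimpleGraph.isAcyclic_bot, by simp, ?_⟩
    rintro x ⟨a, ha⟩ ⟨b, hb⟩ ha' hb'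
    simp only [List.mem_singleton] at ha' hb'
    subst ha' hb'
    rfl
  | @cons l i g hl hi hg h ih =>
    obtain ⟨T, hT, hac, hr, hx⟩ := ih
    have hig : i ≠ g := fun h => hi (h ▸ hg)
    have hadj : (T ⊔ SimpleGraph.edge i g).Adj i g := by
      simp [SimpleGraph.edge_adj, hig]
    -- The index `i` is isolated in `T`, so the new edge closes no cycle.
    have hnr : ¬ T.Reachable i g := by
      rintro ⟨w⟩
      cases w with
      | nil => exact hig rfl
      | cons h' _ => exact hi (hT _ _ h')
    refine ⟨T ⊔ SimpleGraph.edge i g, ?_, ?_, ?_, ?_⟩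
    · intro a b hab
      rw [SimpleGraph.sup_adj, SimpleGraph.edge_adj] at hab
      rcases hab with hab | ⟨⟨rfl, rfl⟩ | ⟨rfl, rfl⟩, _⟩
      · exact List.mem_cons_of_mem _ (hT _ _ hab)
      · exact List.mem_cons_self
      · exact List.mem_cons_of_mem _ hg
    · exact hac.sup_edge_of_not_reachable hnr
    · intro a ha
      rcases List.mem_cons.1 ha with rfl | ha
      · exact hadj.reachable.trans ((hr g hg).mono le_sup_left)
      · exact (hr a ha).mono le_sup_left
    · have key : ∀ x : V, ∀ b : {i | x ∈ e i}, b.1 ∈ l → ∀ hxi : x ∈ e i,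
          ((T ⊔ SimpleGraph.edge i g).induce {i | x ∈ e i}).Reachable ⟨i, hxi⟩ b := by
        intro x b hb hxi
        have hxg : x ∈ e g := h b.1 hb ⟨hxi, b.2⟩
        have h1 : ((T ⊔ SimpleGraph.edge i g).induce {i | x ∈ e i}).Adj ⟨i, hxi⟩ ⟨g, hxg⟩ := hadj
        exact h1.reachable.trans ((hx x ⟨g, hxg⟩ b hg hb).mono
          (SimpleGraph.comap_monotone _ le_sup_left))
      rintro x ⟨a, ha⟩ ⟨b, hb⟩ ha' hb'
      rcases List.mem_cons.1 ha' with h1 | h1 <;> rcases List.mem_cons.1 hb' with h2 | h2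
      · simp only at h1 h2
        subst h1 h2
        rfl
      · simp only at h1
        subst h1
        exact key x ⟨b, hb⟩ h2 ha
      · simp only at h2
        subst h2
        exact (key x ⟨a, ha⟩ h1 hb).symm
      · exact (hx x ⟨a, ha⟩ ⟨b, hb⟩ h1 h2).mono (SimpleGraph.comap_monotone _ le_sup_left)

theorem RunningIntersection.hasJoinTree {r : ι} {l : List ι} (h : RunningIntersection e r l)
    (hl : ∀ i, i ∈ l) : HasJoinTree e := by
  obtain ⟨T, -, hac, hr, hx⟩ := h.exists_graph
  have : Nonempty ι := ⟨r⟩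
  exact ⟨T, ⟨⟨fun a b => (hr a (hl a)).trans (hr b (hl b)).symm⟩, hac⟩,
    fun x a b => hx x a b (hl _) (hl _)⟩

/-- A witness of cyclicity: a set `M` of at least two vertices and a connected set `C` of vertices
such that `M` and each `C ∪ (M \ {m})`, with `C` contracted to a vertex, are contained in
hyperedges, but `C ∪ M` is not. -/
structure CyclePattern (e : ι → Set V) (M : Finset V) (C : Set V) : Prop where
  two_le : 2 ≤ M.card
  disjoint : ∀ v ∈ M, v ∉ C
  cover : ∃ g, ∀ m ∈ M, m ∈ e g
  cover_erase : ∀ m ∈ M, ∃ f, (∃ c ∈ C, c ∈ e f) ∧ ∀ m' ∈ M, m' ≠ m → m' ∈ e f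
  not_cover : ∀ f, ∀ c ∈ C, c ∈ e f → ∃ m ∈ M, m ∉ e f
  connected : ∀ φ : V → ℕ, (∀ i, ∀ v ∈ C, ∀ v' ∈ C, v ∈ e i → v' ∈ e i → φ v = φ v') →
    ∀ v ∈ C, ∀ v' ∈ C, φ v = φ v'

/-- Adjacency of vertices outside of `U`. -/
def OutAdj (e : ι → Set V) (U : Set V) (a b : V) : Prop :=
  a ∉ U ∧ b ∉ U ∧ ∃ i, a ∈ e i ∧ b ∈ e i

theorem OutAdj.symm {U : Set V} {a b : V} (h : OutAdj e U a b) : OutAdj e U b a :=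
  let ⟨h1, h2, i, h3, h4⟩ := h
  ⟨h2, h1, i, h4, h3⟩

theorem OutAdj.mono {U U' : Set V} (hU : U ⊆ U') {a b : V} (h : OutAdj e U' a b) :
    OutAdj e U a b :=
  let ⟨h1, h2, h3⟩ := h
  ⟨fun h => h1 (hU h), fun h => h2 (hU h), h3⟩

open Relation

theorem not_mem_of_reflTransGen_outAdj {U : Set V} {a b : V} (ha : a ∉ U)
    (h : ReflTransGen (OutAdj e U) a b) : b ∉ U := by
  cases h with
  | refl => exact ha
  | tail _ h => exact h.2.1

/-- If no hyperedge that meets a component outside of `U` covers all its neighbors in `U`, and these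
lie in one hyperedge, then there is a cycle pattern. -/
theorem exists_cyclePattern_of_component [Finite V] {U : Set V} {c : V} (hc : c ∉ U) (f₀ : ι)
    (hf₀ : c ∈ e f₀) (g : ι)
    (hg : ∀ f y, ReflTransGen (OutAdj e U) c y → y ∈ e f → ∀ x ∈ e f, x ∈ U → x ∈ e g)
    (hno : ¬ ∃ i, (∃ y, ReflTransGen (OutAdj e U) c y ∧ y ∈ e i) ∧
      ∀ f y, ReflTransGen (OutAdj e U) c y → y ∈ e f → ∀ x ∈ e f, x ∈ U → x ∈ e i) :
    ∃ M, CyclePattern e M {y | ReflTransGen (OutAdj e U) c y} := by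
  classical
  have := Fintype.ofFinite V
  set C : Set V := {y | ReflTransGen (OutAdj e U) c y} with hC
  let N : Finset V := Finset.univ.filter fun x => x ∈ U ∧ ∃ f, ∃ y ∈ C, y ∈ e f ∧ x ∈ e f
  -- The sets of neighbours of `C` that no hyperedge meeting `C` covers. By `hno` all neighbours
  -- together are such a set; minimality of `M` will give `cover_erase`.
  let P : Finset V → Prop := fun M => M ⊆ N ∧ ∀ f, (∃ y ∈ C, y ∈ e f) → ∃ m ∈ M, m ∉ e f
  have hPN : P N := by
    refine ⟨subset_rfl, fun f hf => ?_⟩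
    by_contra hcon
    push Not at hcon
    refine hno ⟨f, hf, fun f' y hy hyf x hx hxU => hcon x ?_⟩
    simp only [N, Finset.mem_filter, Finset.mem_univ, true_and]
    exact ⟨hxU, f', y, hy, hyf, hx⟩
  obtain ⟨M, -, hM⟩ := exists_minimal_le_of_wellFoundedLT P N hPN
  have hcC : c ∈ C := ReflTransGen.refl
  have hMN : ∀ m ∈ M, m ∈ U ∧ ∃ f, ∃ y ∈ C, y ∈ e f ∧ m ∈ e f := fun m hm => by
    simpa [N] using hM.prop.1 hm
  have herase : ∀ m ∈ M, ∃ f, (∃ c ∈ C, c ∈ e f) ∧ ∀ m' ∈ M, m' ≠ m → m' ∈ e f := by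
    intro m hm
    by_contra hcon
    have h1 : P (M.erase m) := by
      refine ⟨(Finset.erase_subset _ _).trans hM.prop.1, fun f hf => ?_⟩
      by_contra hcon'
      push Not at hcon'
      exact hcon ⟨f, hf, fun m' hm' hne => hcon' m' (Finset.mem_erase.2 ⟨hne, hm'⟩)⟩
    exact absurd (hM.le_of_le h1 (Finset.erase_subset _ _) hm) (Finset.notMem_erase _ _)
  refine ⟨M, ?_, ?_, ⟨g, ?_⟩, herase, ?_, ?_⟩
  -- Some `m` exists because `f₀` meets `C`. As a neighbour, `m` lies in a hyperedge `f` meeting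
  -- `C`, and `f` in turn misses a second element of `M`.
  · obtain ⟨m, hm, -⟩ := hM.prop.2 f₀ ⟨c, hcC, hf₀⟩
    obtain ⟨-, f, y, hy, hyf, hmf⟩ := hMN m hm
    obtain ⟨m', hm', hmf'⟩ := hM.prop.2 f ⟨y, hy, hyf⟩
    exact Finset.one_lt_card.2 ⟨m, hm, m', hm', fun h => hmf' (h ▸ hmf)⟩
  · exact fun v hv hvC => not_mem_of_reflTransGen_outAdj hc hvC (hMN v hv).1
  · intro m hm
    obtain ⟨hmU, f, y, hy, hyf, hmf⟩ := hMN m hm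
    exact hg f y hy hyf m hmf hmU
  · exact fun f y hy hyf => hM.prop.2 f ⟨y, hy, hyf⟩
  · intro φ hφ
    have h1 : ∀ v, ReflTransGen (OutAdj e U) c v → φ v = φ c := by
      intro v hv
      induction hv with
      | refl => rfl
      | tail h1 h2 ih =>
        obtain ⟨i, hi, hi'⟩ := h2.2.2
        rw [← ih]
        exact (hφ i _ h1 _ (h1.tail h2) hi hi').symm
    exact fun v hv v' hv' => (h1 v hv).trans (h1 v' hv').symm

/-- A hypergraph has a join tree or a cycle pattern, whose connected part can be chosen disjoint
from any given hyperedge. -/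
theorem exists_cyclePattern [Finite ι] [Finite V] (h : ¬ HasJoinTree e) (r : ι) :
    ∃ M C, CyclePattern e M C ∧ ∀ v ∈ C, v ∉ e r := by
  classical
  have := Fintype.ofFinite ι
  by_contra hno
  have hsymm : ∀ U : Set V, Std.Symm (ReflTransGen (OutAdj e U)) := fun U =>
    have : Std.Symm (OutAdj e U) := ⟨fun _ _ h => h.symm⟩
    inferInstance
  let U : List ι → Set V := fun l => {x | ∃ i ∈ l, x ∈ e i}
  -- Besides running intersection: every hyperedge inside the covered set `U l` is contained in a
  -- member of `l`, and the neighbours in `U l` of each component outside lie in a single member of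
  -- `l`. These two conditions supply the parent of the next hyperedge.
  let Inv : List ι → Prop := fun l => RunningIntersection e r l ∧
    (∀ f, e f ⊆ U l → ∃ g ∈ l, e f ⊆ e g) ∧
    ∀ c, c ∉ U l → ∃ g ∈ l, ∀ f y, ReflTransGen (OutAdj e (U l)) c y → y ∈ e f →
      ∀ x ∈ e f, x ∈ U l → x ∈ e g
  have step : ∀ l, Inv l → ∃ i, Inv (i :: l) := by
    rintro l ⟨hl, h1, h2⟩
    have hUmono : ∀ i, U l ⊆ U (i :: l) := fun i x ⟨j, hj, hx⟩ => ⟨j, List.mem_cons_of_mem _ hj, hx⟩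
    by_cases hall : ∀ f, e f ⊆ U l
    · obtain ⟨i, hi⟩ : ∃ i, i ∉ l := by
        by_contra hcon
        push Not at hcon
        exact h (hl.hasJoinTree hcon)
      obtain ⟨g, hg, hig⟩ := h1 i (hall i)
      have hU : U (i :: l) = U l := by
        refine Set.Subset.antisymm ?_ (hUmono i)
        rintro x ⟨j, hj, hx⟩
        rcases List.mem_cons.1 hj with rfl | hj
        · exact hall _ hx
        · exact ⟨j, hj, hx⟩
      refine ⟨i, hl.cons hi hg fun j _ x hx => hig hx.1, ?_, ?_⟩
      · rw [hU]
        exact fun f hf => let ⟨g, hg, h⟩ := h1 f hf; ⟨g, List.mem_cons_of_mem _ hg, h⟩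
      · rw [hU]
        exact fun c hc => let ⟨g, hg, h⟩ := h2 c hc; ⟨g, List.mem_cons_of_mem _ hg, h⟩
    · push Not at hall
      obtain ⟨f₀, hf₀⟩ := hall
      obtain ⟨c, hcf, hc⟩ := Set.not_subset.1 hf₀
      obtain ⟨g, hg, hgN⟩ := h2 c hc
      obtain ⟨i, ⟨y₀, hy₀, hy₀i⟩, hi⟩ : ∃ i, (∃ y, ReflTransGen (OutAdj e (U l)) c y ∧ y ∈ e i) ∧
          ∀ f y, ReflTransGen (OutAdj e (U l)) c y → y ∈ e f → ∀ x ∈ e f, x ∈ U l → x ∈ e i := by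
        by_contra hcon
        obtain ⟨M, hM⟩ := exists_cyclePattern_of_component hc f₀ hcf g hgN hcon
        -- The component lies outside `U l`, and the root `r` is a member of `l`; hence the
        -- component avoids `e r`.
        exact hno ⟨M, _, hM, fun v hv hvr =>
          not_mem_of_reflTransGen_outAdj hc hv ⟨r, hl.root_mem, hvr⟩⟩
      have hU : ∀ x, x ∈ U (i :: l) ↔ x ∈ e i ∨ x ∈ U l := by
        intro x
        simp only [U, List.mem_cons, Set.mem_ofPred_eq, exists_eq_or_imp]
      have hside : ∀ f y, ReflTransGen (OutAdj e (U l)) c y → y ∈ e f → ∀ x ∈ e f,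
          x ∈ U (i :: l) → x ∈ e i := fun f y hy hyf x hx hxU =>
        ((hU x).1 hxU).elim id fun hxU => hi f y hy hyf x hx hxU
      refine ⟨i, hl.cons ?_ hg ?_, ?_, ?_⟩
      · exact fun hil => not_mem_of_reflTransGen_outAdj hc hy₀ ⟨i, hil, hy₀i⟩
      · exact fun j hj x hx => hgN i y₀ hy₀ hy₀i x hx.1 ⟨j, hj, hx.2⟩
      · intro f hf
        by_cases hfU : e f ⊆ U l
        · exact let ⟨g, hg, h⟩ := h1 f hfU; ⟨g, List.mem_cons_of_mem _ hg, h⟩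
        · obtain ⟨y, hyf, hyU⟩ := Set.not_subset.1 hfU
          have hyi : y ∈ e i := ((hU y).1 (hf hyf)).resolve_right hyU
          have hy : ReflTransGen (OutAdj e (U l)) c y :=
            hy₀.tail ⟨not_mem_of_reflTransGen_outAdj hc hy₀, hyU, i, hy₀i, hyi⟩
          exact ⟨i, List.mem_cons_self, fun x hx => hside f y hy hyf x hx (hf hx)⟩
      · intro c' hc'
        have hmono : ∀ y, ReflTransGen (OutAdj e (U (i :: l))) c' y →
            ReflTransGen (OutAdj e (U l)) c' y := fun y hy =>
          ReflTransGen.mono (fun a b hab => OutAdj.mono (hUmono i) hab) _ _ hy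
        -- A new component inside the old component of `c` has all its covered neighbours in `e i`.
        -- Any other component is not adjacent to the newly covered vertices, which belong to the
        -- component of `c`, so its old member `g'` still works.
        by_cases hcc : ReflTransGen (OutAdj e (U l)) c c'
        · exact ⟨i, List.mem_cons_self, fun f y hy hyf x hx hxU =>
            hside f y (hcc.trans (hmono y hy)) hyf x hx hxU⟩
        · have hc'U : c' ∉ U l := fun h => hc' (hUmono i h)
          obtain ⟨g', hg', hgN'⟩ := h2 c' hc'U
          refine ⟨g', List.mem_cons_of_mem _ hg', fun f y hy hyf x hx hxU => ?_⟩
          refine hgN' f y (hmono y hy) hyf x hx ?_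
          by_contra hxl
          have hxi : x ∈ e i := ((hU x).1 hxU).resolve_right hxl
          have hcx : ReflTransGen (OutAdj e (U l)) c x :=
            hy₀.tail ⟨not_mem_of_reflTransGen_outAdj hc hy₀, hxl, i, hy₀i, hxi⟩
          have hc'x : ReflTransGen (OutAdj e (U l)) c' x := (hmono y hy).tail
            ⟨not_mem_of_reflTransGen_outAdj hc'U (hmono y hy), hxl, f, hyf, hx⟩
          exact hcc (hcx.trans (symm hc'x))
  -- The step never gets stuck, since a list of all indices would already give a join tree.
  -- Duplicate-free lists of every length contradict finiteness.
  have hlong : ∀ N : ℕ, ∃ l, Inv l ∧ l.length = N + 1 := by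
    intro N
    induction N with
    | zero =>
      have hU : U [r] = e r := by ext x; simp [U]
      refine ⟨[r], ⟨.root, ?_, ?_⟩, rfl⟩
      · rw [hU]
        exact fun f hf => ⟨r, by simp, hf⟩
      · rw [hU]
        exact fun c _ => ⟨r, by simp, fun f y _ _ x _ hx => hx⟩
    | succ N ih =>
      obtain ⟨l, hl, hN⟩ := ih
      obtain ⟨i, hi⟩ := step l hl
      exact ⟨i :: l, hi, by simp [hN]⟩
  obtain ⟨l, hl, hN⟩ := hlong (Fintype.card ι)
  have := hl.1.nodup.length_le_card
  omega

end JoinTree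

end CQ

/-! ## Reasoning about programs -/

namespace RAM

@[simp] theorem State.setReg_reg (s : State) (d v : ℕ) :
    (s.setReg d v).reg = Function.update s.reg d v := rfl

@[simp] theorem State.setReg_mem (s : State) (d v : ℕ) : (s.setReg d v).mem = s.mem := rfl

@[simp] theorem State.setMem_mem (s : State) (p v : ℕ) :
    (s.setMem p v).mem = Function.update s.mem p v := rfl

@[simp] theorem State.setMem_reg (s : State) (p v : ℕ) : (s.setMem p v).reg = s.reg := rfl

theorem Trace.outputs_append (t u : Trace) :
    Trace.outputs (t ++ u) = Trace.outputs t ++ Trace.outputs u :=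
  List.filterMap_append

theorem Trace.outputs_none_cons (t : Trace) : Trace.outputs (none :: t) = Trace.outputs t := rfl

theorem Trace.outputs_some_cons (v : List ℕ) (t : Trace) :
    Trace.outputs (some v :: t) = v :: Trace.outputs t := rfl

/-- The prefix `u` accumulates the silent steps since the last output. Each output pays for itself
and for at most `c` silent steps. -/
theorem Trace.DelayLE.length_le_aux {c : ℕ} (t : Trace) : ∀ u : Trace, u.outputs = [] →
    Trace.DelayLE (u ++ t) c → (u ++ t).length ≤ c + (c + 1) * t.outputs.length := by
  induction t with
  | nil =>
    intro u hu h
    have := h u (by simp) hu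
    simpa [Trace.outputs] using this
  | cons a t ih =>
    intro u hu h
    cases a with
    | none =>
      have := ih (u ++ [none]) (by rw [Trace.outputs_append, hu]; rfl) (by simpa using h)
      simpa [Trace.outputs_none_cons] using this
    | some v =>
      have h1 := h u ⟨[], some v :: t, by simp⟩ hu
      have h2 := ih [] rfl (fun w hw => h w (hw.trans ⟨u ++ [some v], [], by simp⟩))
      rw [Trace.outputs_some_cons]
      simp only [List.length_append, List.length_cons, List.nil_append] at h2 ⊢
      rw [Nat.mul_succ]
      omega

theorem Trace.DelayLE.length_le {c : ℕ} {t : Trace} (h : t.DelayLE c) :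
    t.length ≤ c + (c + 1) * t.outputs.length := by
  simpa using Trace.DelayLE.length_le_aux t [] rfl (by simpa using h)

/-- Total correctness: `P` halts from `s` within `T` steps, outputs `o`, and ends in a state
satisfying `Q`. -/
def Terminates (W : ℕ) (P : Prog) (s : State) (T : ℕ) (o : List (List ℕ)) (Q : State → Prop) :
    Prop :=
  ∃ t f, Exec W P s t f ∧ t.length ≤ T ∧ Trace.outputs t = o ∧ Q f

namespace Terminates

variable {W T T₁ T₂ : ℕ} {P P₁ P₂ : Prog} {s : State} {o o₁ o₂ : List (List ℕ)}
  {Q Q' : State → Prop}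

theorem mono (h : Terminates W P s T₁ o Q) (hT : T₁ ≤ T₂) (hQ : ∀ f, Q f → Q' f) :
    Terminates W P s T₂ o Q' :=
  let ⟨t, f, h1, h2, h3, h4⟩ := h
  ⟨t, f, h1, h2.trans hT, h3, hQ f h4⟩

theorem seq (h : Terminates W P₁ s T₁ o₁ fun s' => Terminates W P₂ s' T₂ o₂ Q) :
    Terminates W (.seq P₁ P₂) s (T₁ + T₂) (o₁ ++ o₂) Q := by
  obtain ⟨t, f, h1, h2, h3, t', f', h1', h2', h3', h4⟩ := h
  exact ⟨t ++ t', f', .seq h1 h1', by simp; omega, by rw [Trace.outputs_append, h3, h3'], h4⟩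

theorem seq_silent (h : Terminates W P₁ s T₁ [] fun s' => Terminates W P₂ s' T₂ o₂ Q) :
    Terminates W (.seq P₁ P₂) s (T₁ + T₂) o₂ Q :=
  seq h

theorem skip (h : Q s) : Terminates W .skip s 1 [] Q :=
  ⟨_, _, .skip s, le_rfl, rfl, h⟩

theorem const {d v : ℕ} (hv : v ≤ W) (h : Q (s.setReg d v)) :
    Terminates W (.const d v) s 1 [] Q :=
  ⟨_, _, .const s d v hv, le_rfl, rfl, h⟩

theorem arith {op : Op} {d a b : ℕ} (hv : op.eval (s.reg a) (s.reg b) ≤ W)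
    (h : Q (s.setReg d (op.eval (s.reg a) (s.reg b)))) :
    Terminates W (.arith op d a b) s 1 [] Q :=
  ⟨_, _, .arith s op d a b hv, le_rfl, rfl, h⟩

theorem load {d a : ℕ} (h : Q (s.setReg d (s.mem (s.reg a)))) :
    Terminates W (.load d a) s 1 [] Q :=
  ⟨_, _, .load s d a, le_rfl, rfl, h⟩

theorem store {a b : ℕ} (h : Q (s.setMem (s.reg a) (s.reg b))) :
    Terminates W (.store a b) s 1 [] Q :=
  ⟨_, _, .store s a b, le_rfl, rfl, h⟩

theorem output {rs : List ℕ} (h : Q s) : Terminates W (.output rs) s 1 [rs.map s.reg] Q :=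
  ⟨_, _, .output s rs, le_rfl, rfl, h⟩

theorem const_seq {d v : ℕ} (hv : v ≤ W) (h : Terminates W P (s.setReg d v) T o Q) :
    Terminates W (.seq (.const d v) P) s (1 + T) o Q :=
  seq_silent (const hv h)

theorem arith_seq {op : Op} {d a b : ℕ} (hv : op.eval (s.reg a) (s.reg b) ≤ W)
    (h : Terminates W P (s.setReg d (op.eval (s.reg a) (s.reg b))) T o Q) :
    Terminates W (.seq (.arith op d a b) P) s (1 + T) o Q :=
  seq_silent (arith hv h)

theorem load_seq {d a : ℕ} (h : Terminates W P (s.setReg d (s.mem (s.reg a))) T o Q) :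
    Terminates W (.seq (.load d a) P) s (1 + T) o Q :=
  seq_silent (load h)

theorem store_seq {a b : ℕ} (h : Terminates W P (s.setMem (s.reg a) (s.reg b)) T o Q) :
    Terminates W (.seq (.store a b) P) s (1 + T) o Q :=
  seq_silent (store h)

theorem ite {a : ℕ} (h₁ : s.reg a ≠ 0 → Terminates W P₁ s T o Q)
    (h₂ : s.reg a = 0 → Terminates W P₂ s T o Q) : Terminates W (.ite a P₁ P₂) s (1 + T) o Q := by
  by_cases ha : s.reg a = 0
  · obtain ⟨t, f, h1, h2, h3, h4⟩ := h₂ ha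
    exact ⟨_, f, .iteFalse ha h1, by simp; omega, h3, h4⟩
  · obtain ⟨t, f, h1, h2, h3, h4⟩ := h₁ ha
    exact ⟨_, f, .iteTrue ha h1, by simp; omega, h3, h4⟩

end Terminates

/-- The list `n, n - 1, …, 1`. -/
def down : ℕ → List ℕ
  | 0 => []
  | n + 1 => (n + 1) :: down n

theorem mem_down {n a : ℕ} : a ∈ down n ↔ 1 ≤ a ∧ a ≤ n := by
  induction n with
  | zero => simp [down]; omega
  | succ n ih => simp only [down, List.mem_cons, ih]; omega

theorem nodup_down (n : ℕ) : (down n).Nodup := by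
  induction n with
  | zero => simp [down]
  | succ n ih => exact List.nodup_cons.2 ⟨by rw [mem_down]; omega, ih⟩

theorem length_down (n : ℕ) : (down n).length = n := by
  induction n with
  | zero => rfl
  | succ n ih => simp [down, ih]

/-- Run `P` while counting register `c` down to `0`, register `0` being `1`. -/
def countdown (c : ℕ) (P : Prog) : Prog :=
  .loop c (.seq P (.arith .sub c c 0))

/-- The invariant is indexed by the counter value and is required after the decrement. The decrement
subtracts register `0`, so the body must leave it at `1`. The summand `2` per round is for the loop
test and the decrement, the final `1` for the failing test. -/
theorem Terminates.countdown {W Tb c : ℕ} {P : Prog} {o : ℕ → List (List ℕ)}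
    {I : ℕ → State → Prop}
    (hI : ∀ a s, I (a + 1) s → s.reg c = a + 1 → Terminates W P s Tb (o (a + 1)) fun s' =>
      s'.reg c = a + 1 ∧ s'.reg 0 = 1 ∧ I a (s'.setReg c a)) (a : ℕ) :
    ∀ s, I a s → s.reg c = a → a ≤ W →
      Terminates W (countdown c P) s (a * (Tb + 2) + 1) ((down a).flatMap o)
        fun s' => s'.reg c = 0 ∧ I 0 s' := by
  induction a with
  | zero => exact fun s hs hc _ => ⟨_, s, .loopFalse hc, by simp, rfl, hc, hs⟩
  | succ a ih =>
    intro s hs hc hW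
    obtain ⟨t, f, h1, h2, h3, h4, h5, h6⟩ := hI a s hs hc
    have hv : Op.sub.eval (f.reg c) (f.reg 0) = a := by simp [Op.eval, h4, h5]
    have hvW : Op.sub.eval (f.reg c) (f.reg 0) ≤ W := by rw [hv]; omega
    obtain ⟨t', f', h1', h2', h3', h4'⟩ := ih (f.setReg c a) h6 (by simp) (by omega)
    refine ⟨_, f', .loopTrue (by omega) (.seq h1 (.arith f .sub c c 0 hvW))
      (by rw [hv]; exact h1'), ?_, ?_, h4'⟩
    · simp only [List.length_cons, List.length_append, List.length_nil, Nat.succ_mul]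
      omega
    · simp only [Trace.outputs_none_cons, Trace.outputs_append, h3, h3', down, List.flatMap_cons]
      simp [Trace.outputs]

/-- `countdown` for loops without outputs. -/
theorem Terminates.countdown_silent {W Tb c : ℕ} {P : Prog} {I : ℕ → State → Prop}
    (hI : ∀ a s, I (a + 1) s → s.reg c = a + 1 → Terminates W P s Tb [] fun s' =>
      s'.reg c = a + 1 ∧ s'.reg 0 = 1 ∧ I a (s'.setReg c a)) (a : ℕ) (s : State) (hs : I a s)
    (hc : s.reg c = a) (hW : a ≤ W) :
      Terminates W (RAM.countdown c P) s (a * (Tb + 2) + 1) []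
        fun s' => s'.reg c = 0 ∧ I 0 s' := by
  have h := Terminates.countdown (o := fun _ => []) hI a s hs hc hW
  rwa [List.flatMap_eq_nil_iff.2 (fun _ _ => rfl)] at h

/-! ## Simulation with relocated memory -/

/-- Simulation of a program: register `r` becomes `2 * r + 20`, memory cell `p` becomes `B + p` with
`B` in register `5`, and output of a pair `(a, b)` becomes setting the entry `(a, b)` of a table,
whose address is in register `4` and whose number of columns is in register `3`. -/
def Prog.tabulate : Prog → Prog
  | .skip => .skip
  | .const d v => .const (2 * d + 20) v
  | .arith o d a b => .arith o (2 * d + 20) (2 * a + 20) (2 * b + 20)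
  | .load d a => .seq (.arith .add 8 (2 * a + 20) 5) (.load (2 * d + 20) 8)
  | .store a b => .seq (.arith .add 8 (2 * a + 20) 5) (.store 8 (2 * b + 20))
  | .output rs =>
    .seq (.arith .mul 8 (2 * rs.getD 0 0 + 20) 3) (.seq (.arith .add 8 8 (2 * rs.getD 1 0 + 20))
      (.seq (.arith .add 8 8 4) (.store 8 0)))
  | .seq P Q => .seq P.tabulate Q.tabulate
  | .ite a P Q => .ite (2 * a + 20) P.tabulate Q.tabulate
  | .loop a P => .loop (2 * a + 20) P.tabulate

/-- State `s'` simulates state `s`, and its table contains the pairs in `L`. -/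
structure Simulates (n d TB B : ℕ) (s : State) (L : List (List ℕ)) (s' : State) : Prop where
  one : s'.reg 0 = 1
  num : s'.reg 1 = n
  numSucc : s'.reg 2 = n + 1
  dom : s'.reg 3 = d
  table : s'.reg 4 = TB
  base : s'.reg 5 = B
  zero : s'.reg 12 = 0
  reg : ∀ r, s'.reg (2 * r + 20) = s.reg r
  mem : ∀ p, s'.mem (B + p) = s.mem p
  entry : ∀ a < d, ∀ b < d, s'.mem (TB + (a * d + b)) = if [a, b] ∈ L then 1 else 0

theorem Simulates.setReg {n d TB B : ℕ} {s s' : State} {L : List (List ℕ)}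
    (h : Simulates n d TB B s L s') (r v : ℕ) :
    Simulates n d TB B (s.setReg r v) L (s'.setReg (2 * r + 20) v) := by
  obtain ⟨h0, h1, h2, h3, h4, h5, h12, hr, hm, he⟩ := h
  refine ⟨?_, ?_, ?_, ?_, ?_, ?_, ?_, ?_, hm, he⟩
  iterate 7
    simp (disch := omega) only [State.setReg_reg, Function.update_of_ne]; assumption
  · intro r'
    by_cases hrr : r' = r
    · subst hrr; simp
    · simp (disch := omega) only [State.setReg_reg, Function.update_of_ne, hr]

theorem Simulates.scratch {n d TB B : ℕ} {s s' : State} {L : List (List ℕ)}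
    (h : Simulates n d TB B s L s') (v : ℕ) : Simulates n d TB B s L (s'.setReg 8 v) := by
  obtain ⟨h0, h1, h2, h3, h4, h5, h12, hr, hm, he⟩ := h
  refine ⟨?_, ?_, ?_, ?_, ?_, ?_, ?_, ?_, hm, he⟩ <;> intros <;>
    simp (disch := omega) only [State.setReg_reg, Function.update_of_ne] <;> solve_by_elim

theorem table_index_lt {d a b : ℕ} (ha : a < d) (hb : b < d) : a * d + b < d * d := by
  have : (a + 1) * d ≤ d * d := Nat.mul_le_mul_right _ ha
  rw [Nat.succ_mul] at this
  omega

theorem table_index_inj {d a b a' b' : ℕ} (hb : b < d) (hb' : b' < d)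
    (h : a * d + b = a' * d + b') : a = a' ∧ b = b' := by
  have h1 : (b + a * d) / d = (b' + a' * d) / d := by rw [add_comm b, add_comm b', h]
  rw [Nat.add_mul_div_right _ _ (by omega), Nat.add_mul_div_right _ _ (by omega),
    Nat.div_eq_of_lt hb, Nat.div_eq_of_lt hb', zero_add, zero_add] at h1
  subst h1
  omega

/-- The hypothesis `hB` places the table entirely below the simulated memory, so neither can
overwrite the other. -/
theorem Simulates.setMem {n d TB B : ℕ} {s s' : State} {L : List (List ℕ)}
    (hB : TB + d * d ≤ B) (h : Simulates n d TB B s L s') (p v : ℕ) :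
    Simulates n d TB B (s.setMem p v) L (s'.setMem (B + p) v) := by
  obtain ⟨h0, h1, h2, h3, h4, h5, h12, hr, hm, he⟩ := h
  refine ⟨h0, h1, h2, h3, h4, h5, h12, hr, ?_, ?_⟩
  · intro p'
    by_cases hpp : p' = p
    · subst hpp; simp
    · simp (disch := omega) only [State.setMem_mem, Function.update_of_ne, hm]
  · intro a ha b hb
    have := table_index_lt ha hb
    simp (disch := omega) only [State.setMem_mem, Function.update_of_ne]
    exact he a ha b hb

theorem Simulates.record {n d TB B : ℕ} {s s' : State} {L : List (List ℕ)}
    (hB : TB + d * d ≤ B) (h : Simulates n d TB B s L s') {a b : ℕ} (ha : a < d) (hb : b < d) :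
    Simulates n d TB B s (L ++ [[a, b]]) (s'.setMem (TB + (a * d + b)) 1) := by
  obtain ⟨h0, h1, h2, h3, h4, h5, h12, hr, hm, he⟩ := h
  have := table_index_lt ha hb
  refine ⟨h0, h1, h2, h3, h4, h5, h12, hr, ?_, ?_⟩
  · intro p'
    simp (disch := omega) only [State.setMem_mem, Function.update_of_ne, hm]
  · intro a' ha' b' hb'
    by_cases hab : a' = a ∧ b' = b
    · obtain ⟨rfl, rfl⟩ := hab
      simp
    · have hne : TB + (a' * d + b') ≠ TB + (a * d + b) := fun h =>
        hab (table_index_inj hb' hb (by omega))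
      rw [State.setMem_mem, Function.update_of_ne hne, he a' ha' b' hb']
      have : ([a', b'] : List ℕ) ≠ [a, b] := by simpa using hab
      simp [this]

/-- All numbers stored in a state are at most `V`. -/
structure State.BoundedBy (s : State) (V : ℕ) : Prop where
  reg : ∀ r, s.reg r ≤ V
  mem : ∀ p, s.mem p ≤ V

/-- Loads and stores are not checked against `W`, but they only move numbers that are already
present. The bound is needed because the simulation computes `B + p` for every address `p` that is
used, including addresses read from the input. -/
theorem Exec.boundedBy {W V : ℕ} (hWV : W ≤ V) {P : Prog} {s f : State} {t : Trace}
    (h : Exec W P s t f) (hs : s.BoundedBy V) : f.BoundedBy V := by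
  have hreg : ∀ (s : State) (d v : ℕ), s.BoundedBy V → v ≤ V → (s.setReg d v).BoundedBy V := by
    refine fun s d v hs hv => ⟨fun r => ?_, hs.mem⟩
    rw [State.setReg_reg, Function.update_apply]
    split_ifs
    exacts [hv, hs.reg r]
  induction h with
  | skip => exact hs
  | const s d v h => exact hreg _ _ _ hs (h.trans hWV)
  | arith s o d a b h => exact hreg _ _ _ hs (h.trans hWV)
  | load s d a => exact hreg _ _ _ hs (hs.mem _)
  | store s a b =>
    refine ⟨hs.reg, fun p => ?_⟩
    rw [State.setMem_mem, Function.update_apply]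
    split_ifs
    exacts [hs.reg _, hs.mem p]
  | output => exact hs
  | seq _ _ ih₁ ih₂ => exact ih₂ (ih₁ hs)
  | iteTrue _ _ ih => exact ih hs
  | iteFalse _ _ ih => exact ih hs
  | loopTrue _ _ _ ih₁ ih₂ => exact ih₂ (ih₁ hs)
  | loopFalse => exact hs

/-- Every step is simulated by at most four steps; the worst case is an output, which needs a
multiplication, two additions and a store. The simulation is silent, so answers arriving in
arbitrary order become a table with random access. Simulated registers are the even ones from `20`
on, leaving the small ones for parameters and scratch and the odd ones from `21` on for loop
variables. -/
theorem Exec.tabulate {W V W' n d TB B : ℕ} (hWV : W ≤ V) (hW' : V + B ≤ W')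
    (hB : TB + d * d ≤ B) {P : Prog} {s f : State} {t : Trace} (h : Exec W P s t f)
    (hs : s.BoundedBy V) (ho : ∀ v ∈ Trace.outputs t, ∃ a < d, ∃ b < d, v = [a, b]) :
    ∀ {L : List (List ℕ)} {s' : State}, Simulates n d TB B s L s' →
      Terminates W' P.tabulate s' (4 * t.length) []
        (Simulates n d TB B f (L ++ Trace.outputs t)) := by
  induction h with
  | skip s =>
    intro L s' h
    exact (Terminates.skip (by simpa [Trace.outputs] using h)).mono (by simp) fun _ => id
  | const s r v hv =>
    intro L s' h
    exact (Terminates.const (by omega) (by simpa [Trace.outputs] using h.setReg r v)).mono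
      (by simp) fun _ => id
  | arith s o r a b hv =>
    intro L s' h
    refine (Terminates.arith ?_ ?_).mono (by simp : 1 ≤ _) fun _ => id
    · rw [h.reg, h.reg]; omega
    · rw [h.reg, h.reg]
      simpa [Trace.outputs] using h.setReg r _
  | load s r a =>
    intro L s' h
    refine (Terminates.arith_seq ?_ (Terminates.load ?_)).mono (by simp : 1 + 1 ≤ _) fun _ => id
    · rw [h.reg, h.base]
      have := hs.reg a
      simp only [Op.eval]
      omega
    · have h1 := (h.scratch (s.reg a + B)).setReg r (s.mem (s.reg a))
      simp only [Op.eval, h.reg, h.base, State.setReg_reg, Function.update_self, State.setReg_mem,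
        add_comm (s.reg a) B, h.mem]
      simpa [Trace.outputs, add_comm B] using h1
  | store s a b =>
    intro L s' h
    refine (Terminates.arith_seq ?_ (Terminates.store ?_)).mono (by simp : 1 + 1 ≤ _) fun _ => id
    · rw [h.reg, h.base]
      have := hs.reg a
      simp only [Op.eval]
      omega
    · have h1 := (h.scratch (B + s.reg a)).setMem hB (s.reg a) (s.reg b)
      simp (disch := omega) only [Op.eval, h.reg, h.base, State.setReg_reg, Function.update_self,
        Function.update_of_ne, add_comm (s.reg a) B]
      simpa [Trace.outputs] using h1
  | output s rs =>
    intro L s' h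
    obtain ⟨a, ha, b, hb, hab⟩ := ho (rs.map s.reg) (by simp [Trace.outputs])
    obtain ⟨x, y, rfl⟩ : ∃ x y, rs = [x, y] := by
      have := congrArg List.length hab
      rw [List.length_map] at this
      exact List.length_eq_two.1 this
    simp only [List.map_cons, List.map_nil, List.cons.injEq, and_true] at hab
    obtain ⟨rfl, rfl⟩ := hab
    have hlt := table_index_lt ha hb
    have h1 : s.reg x * d ≤ s.reg x * d + s.reg y := Nat.le_add_right _ _
    refine (Terminates.arith_seq ?_ (Terminates.arith_seq ?_ (Terminates.arith_seq ?_
      (Terminates.store ?_)))).mono (by simp : 1 + (1 + (1 + 1)) ≤ _) fun _ => id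
    all_goals
      simp (disch := omega) only [Op.eval, List.getD_cons_zero, List.getD_cons_succ, h.reg, h.dom,
        h.table, h.one, State.setReg_reg, Function.update_self, Function.update_of_ne]
    · omega
    · omega
    · omega
    · have h2 := (((h.scratch (s.reg x * d)).scratch (s.reg x * d + s.reg y)).scratch
        (s.reg x * d + s.reg y + TB)).record hB ha hb
      simpa [Trace.outputs, add_comm TB] using h2
  | seq h₁ h₂ ih₁ ih₂ =>
    intro L s' h
    rw [Trace.outputs_append] at ho ⊢
    refine (Terminates.seq_silent ((ih₁ hs (fun v hv => ho v (by simp [hv])) h).mono le_rfl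
      fun s'' h'' => ih₂ (h₁.boundedBy hWV hs) (fun v hv => ho v (by simp [hv])) h'')).mono
        (by simp; omega) fun f' hf' => ?_
    simpa using hf'
  | @iteTrue a P Q s f t ha h₁ ih =>
    intro L s' h
    exact (Terminates.ite (fun _ => ih hs ho h) fun h0 => absurd (h.reg a ▸ h0) ha).mono
      (by simp; omega) fun _ => id
  | @iteFalse a P Q s f t ha h₁ ih =>
    intro L s' h
    exact (Terminates.ite (fun h0 => absurd ha (h.reg a ▸ h0)) fun _ => ih hs ho h).mono
      (by simp; omega) fun _ => id
  | @loopTrue a P s₁ s₂ s₃ t₁ t₂ ha h₁ h₂ ih₁ ih₂ =>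
    intro L s' h
    rw [Trace.outputs_none_cons, Trace.outputs_append] at ho ⊢
    obtain ⟨t, f, e1, e2, e3, e4⟩ := ih₁ hs (fun v hv => ho v (by simp [hv])) h
    obtain ⟨t', f', e1', e2', e3', e4'⟩ :=
      ih₂ (h₁.boundedBy hWV hs) (fun v hv => ho v (by simp [hv])) e4
    refine ⟨_, f', .loopTrue (by rwa [h.reg]) e1 e1', ?_, ?_, by simpa using e4'⟩
    · simp only [List.length_cons, List.length_append]
      omega
    · rw [Trace.outputs_none_cons, Trace.outputs_append, e3, e3']; rfl
  | @loopFalse a P s ha =>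
    intro L s' h
    exact ⟨_, s', .loopFalse (by rwa [h.reg]), by simp, rfl, by simpa [Trace.outputs] using h⟩

end RAM

/-! ## A program that writes a database -/

namespace RAM

/-- The assignments of the numbers `1, …, n` to the entries of `cs` that coincide with `u`
elsewhere. -/
def assignments (n : ℕ) : List ℕ → (ℕ → ℕ) → List (ℕ → ℕ)
  | [], u => [u]
  | c :: cs, u => (down n).flatMap fun a => assignments n cs (Function.update u c a)

theorem mem_assignments {n : ℕ} {cs : List ℕ} (hcs : cs.Nodup) {u u' : ℕ → ℕ} :
    u' ∈ assignments n cs u ↔ (∀ c ∈ cs, 1 ≤ u' c ∧ u' c ≤ n) ∧ ∀ c, c ∉ cs → u' c = u c := by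
  induction cs generalizing u with
  | nil => simp [assignments, funext_iff]
  | cons c cs ih =>
    obtain ⟨hc, hcs⟩ := List.nodup_cons.1 hcs
    simp only [assignments, List.mem_flatMap, mem_down, ih hcs]
    constructor
    · rintro ⟨a, ha, h1, h2⟩
      have hca : u' c = a := by simpa using h2 c hc
      refine ⟨?_, fun c' hc' => ?_⟩
      · intro c' hc'
        rcases List.mem_cons.1 hc' with rfl | hc'
        · rwa [hca]
        · exact h1 c' hc'
      · rw [List.mem_cons, not_or] at hc'
        rw [h2 c' hc'.2, Function.update_of_ne hc'.1]
    · rintro ⟨h1, h2⟩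
      refine ⟨u' c, h1 c List.mem_cons_self, fun c' hc' => h1 c' (List.mem_cons_of_mem _ hc'),
        fun c' hc' => ?_⟩
      by_cases hcc : c' = c
      · subst hcc; simp
      · rw [Function.update_of_ne hcc]
        exact h2 c' (by simp [hcc, hc'])

theorem nodup_assignments {n : ℕ} {cs : List ℕ} (hcs : cs.Nodup) (u : ℕ → ℕ) :
    (assignments n cs u).Nodup := by
  induction cs generalizing u with
  | nil => simp [assignments]
  | cons c cs ih =>
    obtain ⟨hc, hcs⟩ := List.nodup_cons.1 hcs
    refine List.nodup_flatMap.2 ⟨fun a _ => ih hcs _, (nodup_down n).imp fun {a b} hab => ?_⟩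
    intro u' h1 h2
    have h1 := ((mem_assignments hcs).1 h1).2 c hc
    have h2 := ((mem_assignments hcs).1 h2).2 c hc
    simp only [Function.update_self] at h1 h2
    exact hab (h1.symm.trans h2)

theorem length_assignments (n : ℕ) (cs : List ℕ) (u : ℕ → ℕ) :
    (assignments n cs u).length = n ^ cs.length := by
  induction cs generalizing u with
  | nil => rfl
  | cons c cs ih =>
    simp [assignments, List.length_flatMap, ih, length_down, pow_succ, mul_comm]

/-- The number whose digits in base `n` are the numbers `u c - 1`, preceded by those of `a`. -/
def encodeFrom (n : ℕ) (u : ℕ → ℕ) (a : ℕ) (cs : List ℕ) : ℕ :=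
  cs.foldl (fun a c => a * n + (u c - 1)) a

theorem encodeFrom_lt {n : ℕ} {u : ℕ → ℕ} {cs : List ℕ} (hu : ∀ c ∈ cs, 1 ≤ u c ∧ u c ≤ n)
    {a j : ℕ} (ha : a < n ^ j) : encodeFrom n u a cs < n ^ (j + cs.length) := by
  induction cs generalizing a j with
  | nil => exact ha
  | cons c cs ih =>
    have hc := hu c List.mem_cons_self
    have h1 : (a + 1) * n ≤ n ^ j * n := Nat.mul_le_mul_right _ ha
    rw [← pow_succ, Nat.succ_mul] at h1
    have := ih (fun c hc => hu c (List.mem_cons_of_mem _ hc))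
      (a := a * n + (u c - 1)) (j := j + 1) (by omega)
    rw [List.length_cons, add_comm cs.length, ← add_assoc]
    exact this

/-- A state of the program that writes a database: `m` is the original memory, `ws` are the words
written so far from address `B + 2` on, and `u` are the values of the loop variables. -/
structure Building (m : ℕ → ℕ) (n d TB B E : ℕ) (ws : List ℕ) (k : ℕ) (u : ℕ → ℕ) (s : State) :
    Prop where
  one : s.reg 0 = 1
  num : s.reg 1 = n
  numSucc : s.reg 2 = n + 1
  dom : s.reg 3 = d
  table : s.reg 4 = TB
  base : s.reg 5 = B
  pos : s.reg 6 = B + 2 + ws.length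
  count : s.reg 7 = k
  pow : s.reg 11 = E
  zero : s.reg 12 = 0
  vars : ∀ c, s.reg (2 * c + 21) = u c
  sim : ∀ r, s.reg (2 * r + 20) = 0
  mem : ∀ p, s.mem p = if p < B + 2 then m p else ws.getD (p - (B + 2)) 0

section Building

variable {m : ℕ → ℕ} {n d TB B E : ℕ} {ws : List ℕ} {k : ℕ} {u : ℕ → ℕ} {s : State} {W : ℕ}

theorem Building.scratch (h : Building m n d TB B E ws k u s) (r v : ℕ) (hr : r = 8 ∨ r = 9) :
    Building m n d TB B E ws k u (s.setReg r v) := by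
  obtain ⟨h0, h1, h2, h3, h4, h5, h6, h7, h11, h12, hv, hs, hm⟩ := h
  refine ⟨?_, ?_, ?_, ?_, ?_, ?_, ?_, ?_, ?_, ?_, ?_, ?_, hm⟩ <;> intros <;>
    simp (disch := omega) only [State.setReg_reg, Function.update_of_ne] <;> solve_by_elim

theorem Building.setVar (h : Building m n d TB B E ws k u s) (c v : ℕ) :
    Building m n d TB B E ws k (Function.update u c v) (s.setReg (2 * c + 21) v) := by
  obtain ⟨h0, h1, h2, h3, h4, h5, h6, h7, h11, h12, hv, hs, hm⟩ := h
  refine ⟨?_, ?_, ?_, ?_, ?_, ?_, ?_, ?_, ?_, ?_, fun c' => ?_, ?_, hm⟩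
  iterate 10
    · simp (disch := omega) only [State.setReg_reg, Function.update_of_ne]; assumption
  · by_cases hc : c' = c
    · subst hc; simp
    · simp (disch := omega) only [State.setReg_reg, Function.update_of_ne, hv]
  · intros; simp (disch := omega) only [State.setReg_reg, Function.update_of_ne]; solve_by_elim

theorem Building.incr (h : Building m n d TB B E ws k u s) :
    Building m n d TB B E ws (k + 1) u (s.setReg 7 (k + 1)) := by
  obtain ⟨h0, h1, h2, h3, h4, h5, h6, h7, h11, h12, hv, hs, hm⟩ := h
  refine ⟨?_, ?_, ?_, ?_, ?_, ?_, ?_, by simp, ?_, ?_, ?_, ?_, hm⟩ <;> intros <;>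
    simp (disch := omega) only [State.setReg_reg, Function.update_of_ne] <;> solve_by_elim

theorem Building.push (h : Building m n d TB B E ws k u s) (x : ℕ) :
    Building m n d TB B E (ws ++ [x]) k u
      ((s.setMem (B + 2 + ws.length) x).setReg 6 (B + 2 + ws.length + 1)) := by
  obtain ⟨h0, h1, h2, h3, h4, h5, h6, h7, h11, h12, hv, hs, hm⟩ := h
  refine ⟨?_, ?_, ?_, ?_, ?_, ?_, by simp [add_assoc], ?_, ?_, ?_, ?_, ?_, fun p => ?_⟩
  iterate 11
    · intros; simp (disch := omega) only [State.setReg_reg, State.setMem_reg,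
        Function.update_of_ne]; solve_by_elim
  · rw [State.setReg_mem, State.setMem_mem]
    by_cases hp : p = B + 2 + ws.length
    · subst hp
      simp
    · rw [Function.update_of_ne hp, hm]
      split_ifs with hlt
      · rfl
      · rcases Nat.lt_or_ge (p - (B + 2)) ws.length with h | h
        · rw [List.getD_append _ _ _ _ h]
        · rw [List.getD_eq_default _ _ h, List.getD_eq_default]
          simp only [List.length_append, List.length_singleton]
          omega

/-- Append the number `v` to the words written. -/
def pushConst (v : ℕ) : Prog :=
  .seq (.const 8 v) (.seq (.store 6 8) (.arith .add 6 6 0))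

/-- Append the number `v * (n + 1) + u c` to the words written. -/
def pushCode (v c : ℕ) : Prog :=
  .seq (.const 8 v) (.seq (.arith .mul 8 8 2) (.seq (.arith .add 8 8 (2 * c + 21))
    (.seq (.store 6 8) (.arith .add 6 6 0))))

theorem Building.pushConst (h : Building m n d TB B E ws k u s) {v : ℕ} (hv : v ≤ W)
    (hW : B + 2 + ws.length + 1 ≤ W) :
    Terminates W (pushConst v) s 3 [] (Building m n d TB B E (ws ++ [v]) k u) := by
  have h1 := h.scratch 8 v (.inl rfl)
  refine Terminates.const_seq hv (Terminates.store_seq (Terminates.arith ?_ ?_))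
  · simpa [Op.eval, h.pos, h.one] using hW
  · simpa [Op.eval, h.pos, h.one] using h1.push v

theorem Building.pushCode (h : Building m n d TB B E ws k u s) {v c : ℕ}
    (hv : v * (n + 1) + u c ≤ W) (hW : B + 2 + ws.length + 1 ≤ W) :
    Terminates W (pushCode v c) s 5 []
      (Building m n d TB B E (ws ++ [v * (n + 1) + u c]) k u) := by
  have h1 := ((h.scratch 8 v (.inl rfl)).scratch 8 (v * (n + 1)) (.inl rfl)).scratch 8
    (v * (n + 1) + u c) (.inl rfl)
  have hv1 : v ≤ v * (n + 1) := Nat.le_mul_of_pos_right _ (by omega)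
  refine Terminates.const_seq (by omega) (Terminates.arith_seq ?_ (Terminates.arith_seq ?_
    (Terminates.store_seq (Terminates.arith ?_ ?_))))
  all_goals simp (disch := omega) only [Op.eval, h.pos, h.one, h.numSucc, h.vars, State.setReg_reg,
    State.setMem_reg, Function.update_self, Function.update_of_ne]
  · omega
  · omega
  · omega
  · exact h1.push _

/-- Append the numbers `v * (n + 1) + u c` for the pairs `(v, c)` of a list. -/
def pushCodes : List (ℕ × ℕ) → Prog
  | [] => .skip
  | x :: l => .seq (pushCode x.1 x.2) (pushCodes l)

theorem Building.pushCodes {l : List (ℕ × ℕ)} :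
    ∀ {ws : List ℕ} {s : State}, Building m n d TB B E ws k u s →
    (∀ x ∈ l, x.1 * (n + 1) + u x.2 ≤ W) → B + 2 + ws.length + l.length ≤ W →
    Terminates W (pushCodes l) s (5 * l.length + 1) []
      (Building m n d TB B E (ws ++ l.map fun x => x.1 * (n + 1) + u x.2) k u) := by
  induction l with
  | nil => exact fun h _ _ => Terminates.skip (by simpa using h)
  | cons x l ih =>
    intro ws s h hx hW
    simp only [List.length_cons] at hW
    refine (Terminates.seq_silent ((h.pushCode (hx x List.mem_cons_self) (by omega)).mono le_rfl
      fun s' h' => ih h' (fun y hy => hx y (List.mem_cons_of_mem _ hy)) ?_)).mono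
      (by simp; omega) fun s' h' => ?_
    · simp; omega
    · simpa using h'

/-- Compute in register `8` the number with digits `u c - 1`. -/
def computeIndex : List ℕ → Prog
  | [] => .skip
  | c :: cs => .seq (.arith .mul 8 8 1) (.seq (.arith .sub 9 (2 * c + 21) 0)
      (.seq (.arith .add 8 8 9) (computeIndex cs)))

/-- Horner's scheme. The exponent `j` counts the digits already contained in `a`, which keeps all
intermediate values below the final power of `n`. -/
theorem Building.computeIndex {cs : List ℕ} (hu : ∀ c ∈ cs, 1 ≤ u c ∧ u c ≤ n) :
    ∀ {a j : ℕ} {s : State}, Building m n d TB B E ws k u s → s.reg 8 = a → a < n ^ j →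
    n ^ (j + cs.length) ≤ W →
    Terminates W (computeIndex cs) s (3 * cs.length + 1) [] fun s' =>
      Building m n d TB B E ws k u s' ∧ s'.reg 8 = encodeFrom n u a cs := by
  induction cs with
  | nil => exact fun h ha _ _ => Terminates.skip ⟨h, ha⟩
  | cons c cs ih =>
    intro a j s h ha haj hW
    have hc := hu c List.mem_cons_self
    have h1 : (a + 1) * n ≤ n ^ j * n := Nat.mul_le_mul_right _ haj
    rw [← pow_succ, Nat.succ_mul] at h1
    have h2 : n ^ (j + 1) ≤ n ^ (j + (c :: cs).length) :=
      Nat.pow_le_pow_right (by omega) (by simp)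
    have h3 := ((h.scratch 8 (a * n) (.inl rfl)).scratch 9 (u c - 1) (.inr rfl)).scratch 8
      (a * n + (u c - 1)) (.inl rfl)
    refine Terminates.mono (T₁ := 1 + (1 + (1 + (3 * cs.length + 1))))
      (Terminates.arith_seq ?_ (Terminates.arith_seq ?_ (Terminates.arith_seq ?_
      ?_))) (by simp; omega) fun _ => id
    all_goals simp (disch := omega) only [Op.eval, ha, h.one, h.num, h.vars, State.setReg_reg,
      Function.update_self, Function.update_of_ne]
    · omega
    · omega
    · omega
    · refine ih (a := a * n + (u c - 1)) (fun c hc => hu c (List.mem_cons_of_mem _ hc)) h3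
        (by simp) (j := j + 1) (by omega) ?_
      rwa [add_assoc, add_comm 1, ← List.length_cons (a := c)]

/-- A family of facts with relation symbol `sym`, indexed by the assignments to the loop variables
`vars`. The entries are given by pairs `(v, c)`, which represent `v * (n + 1) + u c`. If
`test = some b`, then only those assignments are used for which the entry of the `b`-th table of the
input at the position given by the assignment is nonzero. -/
structure Template where
  sym : ℕ
  entries : List (ℕ × ℕ)
  vars : List ℕ
  test : Option ℕ

/-- The assignment passes the test. -/
def Template.Passes (τ : Template) (m : ℕ → ℕ) (n E : ℕ) (u : ℕ → ℕ) : Prop :=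
  ∀ b ∈ τ.test, m (encodeFrom n u 0 τ.vars + b * E + 1) ≠ 0

/-- The encoded fact given by an assignment. -/
def Template.fact (τ : Template) (n : ℕ) (u : ℕ → ℕ) : List ℕ :=
  τ.sym :: τ.entries.map fun x => x.1 * (n + 1) + u x.2

open Classical in
/-- The encoded facts given by an assignment. -/
noncomputable def Template.emit (τ : Template) (m : ℕ → ℕ) (n E : ℕ) (u : ℕ → ℕ) :
    List (List ℕ) :=
  if τ.Passes m n E u then [τ.fact n u] else []

/-- Test an assignment, with the result in register `9`. -/
def Template.testProg (τ : Template) : Prog :=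
  match τ.test with
  | none => .const 9 1
  | some b => .seq (.const 8 0) (.seq (computeIndex τ.vars) (.seq (.const 9 b)
      (.seq (.arith .mul 9 9 11) (.seq (.arith .add 8 8 9) (.seq (.arith .add 8 8 0)
        (.load 9 8))))))

/-- Write the fact given by an assignment if it passes the test. -/
def Template.body (τ : Template) : Prog :=
  .seq τ.testProg (.ite 9
    (.seq (pushConst τ.sym) (.seq (pushCodes τ.entries) (.arith .add 7 7 0))) .skip)

/-- Bounds under which the facts of a template can be written. -/
structure Template.Fits (τ : Template) (n B E W : ℕ) : Prop where
  sym : τ.sym ≤ W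
  entries : ∀ x ∈ τ.entries, x.1 * (n + 1) + n ≤ W
  vars : ∀ b ∈ τ.test, n ^ τ.vars.length ≤ E
  test : ∀ b ∈ τ.test, b ≤ 1
  pow : 2 * E ≤ B

theorem Building.testProg {τ : Template} (hτ : τ.Fits n B E W)
    (hu : ∀ c ∈ τ.vars, 1 ≤ u c ∧ u c ≤ n) (hB : B + 2 ≤ W)
    (h : Building m n d TB B E ws k u s) :
    Terminates W τ.testProg s (3 * τ.vars.length + 7) [] fun s' =>
      Building m n d TB B E ws k u s' ∧ (s'.reg 9 ≠ 0 ↔ τ.Passes m n E u) := by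
  obtain ⟨sym, entries, vars, test⟩ := τ
  simp only [Template.testProg, Template.Passes] at *
  cases test with
  | none =>
    exact (Terminates.const (by omega) ⟨h.scratch 9 1 (.inr rfl), by simp⟩).mono (by omega)
      fun _ => id
  | some b =>
    have hb := hτ.test b rfl
    have hvars := hτ.vars b rfl
    have hpow := hτ.pow
    simp only at hvars
    have hbE : b * E ≤ E := (Nat.mul_le_mul_right E hb).trans (by omega)
    have henc := encodeFrom_lt hu (a := 0) (j := 0) (by simp)
    rw [zero_add] at henc
    have h1 := Building.computeIndex hu (h.scratch 8 0 (.inl rfl)) (W := W) (a := 0) (j := 0)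
      (by simp) (by simp) (by rw [zero_add]; omega)
    refine Terminates.mono (T₁ := 1 + ((3 * vars.length + 1) + (1 + (1 + (1 + (1 + 1))))))
      (Terminates.const_seq (by omega) (Terminates.seq_silent (h1.mono le_rfl ?_)))
      (by omega) fun _ => id
    rintro s' ⟨h', h8⟩
    have h2 := ((((h'.scratch 9 b (.inr rfl)).scratch 9 (b * E) (.inr rfl)).scratch 8
      (encodeFrom n u 0 vars + b * E) (.inl rfl)).scratch 8
      (encodeFrom n u 0 vars + b * E + 1) (.inl rfl))
    refine Terminates.const_seq (by omega) (Terminates.arith_seq ?_ (Terminates.arith_seq ?_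
      (Terminates.arith_seq ?_ (Terminates.load ⟨?_, ?_⟩))))
    all_goals simp (disch := omega) only [Op.eval, h8, h'.one, h'.pow, State.setReg_reg,
      State.setReg_mem, Function.update_self, Function.update_of_ne]
    · omega
    · omega
    · omega
    · exact h2.scratch 9 _ (.inr rfl)
    -- The index is below `E` and `b ≤ 1`, so with `2 * E ≤ B` the address lies in the part of
    -- memory that still holds the original input. The `+ 1` in the address skips the word `n` at
    -- address `0`.
    · rw [h'.mem, if_pos (by omega)]
      simp

theorem Building.body {τ : Template} (hτ : τ.Fits n B E W)
    (hu : ∀ c, u c ≤ n) (hu1 : ∀ c ∈ τ.vars, 1 ≤ u c) {F : List (List ℕ)}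
    (hB : B + 2 + (F ++ τ.emit m n E u).flatten.length + (F ++ τ.emit m n E u).length ≤ W)
    (h : Building m n d TB B E F.flatten F.length u s) :
    Terminates W τ.body s (3 * τ.vars.length + 5 * τ.entries.length + 13) []
      (Building m n d TB B E (F ++ τ.emit m n E u).flatten (F ++ τ.emit m n E u).length u) := by
  classical
  have hB2 : B + 2 ≤ W := by omega
  have h1 := h.testProg (W := W) hτ (fun c hc => ⟨hu1 c hc, hu c⟩) hB2
  refine Terminates.mono (T₁ := (3 * τ.vars.length + 7) + (1 + (5 * τ.entries.length + 5)))
    (Terminates.seq_silent (h1.mono le_rfl ?_)) (by omega) fun _ => id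
  rintro s' ⟨h', h9⟩
  refine Terminates.ite (fun hr => ?_) fun hr => ?_
  · have he : τ.emit m n E u = [τ.fact n u] := if_pos (h9.1 hr)
    rw [he] at hB ⊢
    simp only [List.flatten_append, List.flatten_cons, List.flatten_nil, List.append_nil,
      List.length_append, Template.fact, List.length_cons,
      List.length_map] at hB ⊢
    refine Terminates.mono (T₁ := 3 + ((5 * τ.entries.length + 1) + 1)) (Terminates.seq_silent
      ((h'.pushConst hτ.sym (by omega)).mono le_rfl fun s₁ e₁ => Terminates.seq_silent
      ((e₁.pushCodes (l := τ.entries) (fun x hx => (Nat.add_le_add_left (hu _) _).trans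
        (hτ.entries x hx)) ?_).mono le_rfl fun s₂ e₂ => Terminates.arith ?_ ?_))) (by omega)
        fun _ => id
    · simp only [List.length_append, List.length_cons, List.length_nil]; omega
    · simp only [Op.eval, e₂.count, e₂.one]; omega
    · simp only [Op.eval, e₂.count, e₂.one]
      simpa using e₂.incr
  · have he : τ.emit m n E u = [] := if_neg fun hp => h9.2 hp hr
    rw [he]
    exact (Terminates.skip (by simpa using h')).mono (by omega) fun _ => id

/-- Nested loops: run `P` for all assignments of the numbers `1, …, n` to the loop variables. -/
def nest (P : Prog) : List ℕ → Prog
  | [] => P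
  | c :: cs => .seq (.arith .add (2 * c + 21) 1 12) (countdown (2 * c + 21) (nest P cs))

theorem Building.nest {P : Prog} {K : ℕ} {em : (ℕ → ℕ) → List (List ℕ)} {V : (ℕ → ℕ) → Prop}
    (hP : ∀ (u : ℕ → ℕ) (F : List (List ℕ)) (s : State), V u →
      B + 2 + (F ++ em u).flatten.length + (F ++ em u).length ≤ W →
      Building m n d TB B E F.flatten F.length u s →
      Terminates W P s K []
        (Building m n d TB B E (F ++ em u).flatten (F ++ em u).length u)) (hn : n ≤ W)
    {cs : List ℕ} (hcs : cs.Nodup) : ∀ {u : ℕ → ℕ} {F : List (List ℕ)} {s : State},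
      (∀ c ∈ cs, u c = 0) → (∀ u' ∈ assignments n cs u, V u') →
      B + 2 + (F ++ (assignments n cs u).flatMap em).flatten.length +
        (F ++ (assignments n cs u).flatMap em).length ≤ W →
      Building m n d TB B E F.flatten F.length u s →
      Terminates W (nest P cs) s ((K + 2 * cs.length) * (n + 1) ^ cs.length) []
        (Building m n d TB B E (F ++ (assignments n cs u).flatMap em).flatten
          (F ++ (assignments n cs u).flatMap em).length u) := by
  induction cs with
  | nil =>
    intro u F s hu hV hW h
    simp only [assignments, List.mem_singleton, forall_eq, List.flatMap_cons, List.flatMap_nil,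
      List.append_nil] at hV hW ⊢
    exact (hP u F s hV hW h).mono (by simp) fun _ => id
  | cons c cs ih =>
    intro u F s hu hV hW h
    obtain ⟨hc, hcs⟩ := List.nodup_cons.1 hcs
    set H : ℕ → List (List ℕ) := fun a =>
      (assignments n cs (Function.update u c a)).flatMap em with hH
    set G : ℕ → List (List ℕ) := fun a => (down a).flatMap H with hG
    have hGn : (assignments n (c :: cs) u).flatMap em = G n := by
      simp only [assignments, hG, hH, List.flatMap_assoc]
    have hGs : ∀ a, G (a + 1) = H (a + 1) ++ G a := fun a => by simp [hG, down]
    rw [hGn] at hW ⊢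
    -- The facts written so far, followed by those that the remaining rounds will write, always form
    -- the same final list.
    let I : ℕ → State → Prop := fun a s => a ≤ n ∧ ∃ F', F' ++ G a = F ++ G n ∧
      Building m n d TB B E F'.flatten F'.length (Function.update u c a) s
    set Tb := (K + 2 * cs.length) * (n + 1) ^ cs.length with hTb
    have hI : ∀ a s, I (a + 1) s → s.reg (2 * c + 21) = a + 1 →
        Terminates W (RAM.nest P cs) s Tb [] fun s' => s'.reg (2 * c + 21) = a + 1 ∧
          s'.reg 0 = 1 ∧ I a (s'.setReg (2 * c + 21) a) := by
      rintro a s ⟨han, F', hF', h⟩ hr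
      rw [hGs, ← List.append_assoc] at hF'
      refine (ih hcs (u := Function.update u c (a + 1)) (F := F') ?_ ?_ ?_ h).mono le_rfl
        fun s' h' => ⟨by rw [h'.vars]; simp, h'.one, by omega, F' ++ H (a + 1), hF', ?_⟩
      · intro c' hc'
        rw [Function.update_of_ne (ne_of_mem_of_not_mem hc' hc)]
        exact hu c' (List.mem_cons_of_mem _ hc')
      · exact fun u' hu' => hV u' (List.mem_flatMap.2 ⟨a + 1, mem_down.2 ⟨by omega, han⟩, hu'⟩)
      · rw [← hF'] at hW
        simp only [List.flatten_append, List.length_append, hH] at hW ⊢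
        omega
      · have h'' := h'.setVar c a
        rwa [Function.update_idem] at h''
    have hloop := Terminates.countdown_silent (W := W) (c := 2 * c + 21) hI n
      (s.setReg (2 * c + 21) n) ⟨le_rfl, F, rfl, h.setVar c n⟩ (by simp) hn
    have hend : Terminates W (RAM.countdown (2 * c + 21) (RAM.nest P cs))
        (s.setReg (2 * c + 21) n) (n * (Tb + 2) + 1) []
        (Building m n d TB B E (F ++ G n).flatten (F ++ G n).length u) := by
      refine hloop.mono le_rfl ?_
      rintro f ⟨-, -, F', hF', h'⟩
      -- The loop leaves its counter at `0`, which was its value before. Hence the valuation is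
      -- unchanged and the next template can reuse the register.
      have hu0 : Function.update u c 0 = u :=
        Function.update_eq_self_iff.2 (hu c List.mem_cons_self).symm
      simp only [hG, down, List.flatMap_nil, List.append_nil] at hF'
      rw [hu0, hF'] at h'
      exact h'
    refine Terminates.mono (T₁ := 1 + (n * (Tb + 2) + 1)) (Terminates.arith_seq ?_ ?_) ?_
      fun _ => id
    · simpa [Op.eval, h.num, h.zero] using hn
    · simpa [Op.eval, h.num, h.zero] using hend
    · have h1 : 1 ≤ (n + 1) ^ cs.length := Nat.one_le_pow _ _ (by omega)
      have h2 : (K + 2 * (c :: cs).length) * (n + 1) ^ (c :: cs).length =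
          n * Tb + Tb + 2 * ((n + 1) * (n + 1) ^ cs.length) := by
        rw [hTb, List.length_cons, pow_succ]; ring
      have h3 : n + 1 ≤ (n + 1) * (n + 1) ^ cs.length := Nat.le_mul_of_pos_right _ h1
      rw [h2, Nat.mul_add]
      omega

end Building

end RAM

/-! ### Initialization, and the complete program that writes the database -/

namespace RAM

/-- Multiply register `r` by the `e`-th power of register `a`. -/
def mulPow (r a : ℕ) : ℕ → Prog
  | 0 => .skip
  | e + 1 => .seq (.arith .mul r r a) (mulPow r a e)

/-- The bound uses `x + 1` because for `x = 0` the intermediate values exceed the final one, whereas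
powers of `x + 1` are monotone in the exponent. -/
theorem Terminates.mulPow {W r a x : ℕ} (har : a ≠ r) {e : ℕ} : ∀ {v : ℕ} {s : State},
    s.reg r = v → s.reg a = x → v * (x + 1) ^ e ≤ W →
    Terminates W (mulPow r a e) s (e + 1) [] (· = s.setReg r (v * x ^ e)) := by
  induction e with
  | zero =>
    intro v s hr ha hW
    refine Terminates.skip ?_
    simp [State.setReg, ← hr]
  | succ e ih =>
    intro v s hr ha hW
    have h1 : v * x * (x + 1) ^ e ≤ W := by
      refine le_trans ?_ hW
      rw [pow_succ, mul_comm ((x + 1) ^ e), ← mul_assoc]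
      exact Nat.mul_le_mul_right _ (Nat.mul_le_mul_left _ (by omega))
    have h2 : v * x ≤ v * x * (x + 1) ^ e :=
      Nat.le_mul_of_pos_right _ (Nat.pow_pos (by omega))
    refine Terminates.mono (T₁ := 1 + (e + 1)) (Terminates.arith_seq ?_
      (ih (v := v * x) ?_ ?_ h1)) (by omega) ?_
    · simp only [Op.eval, hr, ha]; omega
    · simp [Op.eval, hr, ha]
    · simp [har, ha]
    · rintro f rfl
      simp [State.setReg, pow_succ, mul_assoc, mul_comm x]

/-- Initialization: the input starts with the number `n`. -/
def initProg (nv e : ℕ) : Prog :=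
  .seq (.load 1 12) <| .seq (.const 0 1) <| .seq (.arith .add 2 1 0) <| .seq (.const 3 nv) <|
  .seq (.arith .mul 3 3 2) <| .seq (.const 11 1) <| .seq (mulPow 11 1 e) <| .seq (.const 4 2) <|
  .seq (mulPow 4 2 e) <| .seq (.arith .add 4 4 0) <| .seq (.arith .mul 5 3 3) <|
  .seq (.arith .add 5 5 4) <| .seq (.const 8 2) <| .arith .add 6 5 8

/-- The address of the table of answers. -/
def tableAddr (n e : ℕ) : ℕ := 2 * (n + 1) ^ e + 1

/-- The address of the memory of the simulated program, `d` being the number of columns of the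
table. -/
def baseAddr (n e d : ℕ) : ℕ := tableAddr n e + d * d

/-- By `hw` the input ends below the table, so the table and everything from `B` on are still zero.
The table address leaves room for the word `n` and two blocks of `n ^ e` entries. -/
theorem Building.init {w : List ℕ} {n nv e d W : ℕ} (hn : w.getD 0 0 = n)
    (hw : w.length ≤ tableAddr n e) (hW : 2 * (n + 2) ^ e ≤ W) (hnv : nv ≤ W) (hn1 : n + 1 ≤ W)
    (hnd : nv * (n + 1) = d) (hd : d ≤ W)
    (hB : baseAddr n e d + 2 ≤ W) :
    Terminates W (initProg nv e) (State.init w) (2 * e + 14) []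
      (Building (fun p => w.getD p 0) n d (tableAddr n e) (baseAddr n e d) (n ^ e) [] 0 fun _ => 0) := by
  unfold baseAddr tableAddr at *
  have hpow : (n + 1) ^ e ≤ (n + 2) ^ e := Nat.pow_le_pow_left (by omega) e
  have hdd : d * d ≤ W := by omega
  have hreg : ∀ r, (State.init w).reg r = 0 := fun _ => rfl
  have hmem : (State.init w).mem 0 = n := hn
  refine Terminates.mono (T₁ := 1 + (1 + (1 + (1 + (1 + (1 + ((e + 1) + (1 + ((e + 1) + (1 +
    (1 + (1 + (1 + 1)))))))))))))
    (Terminates.load_seq (Terminates.const_seq (by omega) (Terminates.arith_seq ?_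
    (Terminates.const_seq hnv (Terminates.arith_seq ?_ (Terminates.const_seq (by omega)
    (Terminates.seq_silent ((Terminates.mulPow (v := 1) (x := n) (by omega) ?_ ?_ ?_).mono le_rfl ?_
    )))))))) (by omega) fun _ => id
  all_goals try simp (disch := omega) only [Op.eval, hreg, hmem, hnd, State.setReg_reg,
      Function.update_self, Function.update_of_ne]
  · omega
  · exact hd
  · omega
  rintro _ rfl
  refine Terminates.const_seq (by omega) (Terminates.seq_silent ((Terminates.mulPow (v := 2)
    (x := n + 1) (by omega) ?_ ?_ hW).mono le_rfl ?_))
  all_goals try simp (disch := omega) only [State.setReg_reg,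
      Function.update_self, Function.update_of_ne]
  rintro _ rfl
  refine Terminates.arith_seq ?_ (Terminates.arith_seq ?_ (Terminates.arith_seq ?_
    (Terminates.const_seq (by omega) (Terminates.arith ?_ ?_))))
  all_goals try simp (disch := omega) only [Op.eval, State.setReg_reg,
      Function.update_self, Function.update_of_ne]
  · omega
  · exact hdd
  · omega
  · omega
  · refine ⟨?_, ?_, ?_, ?_, ?_, ?_, ?_, ?_, ?_, ?_, fun c => ?_, fun c => ?_, fun p => ?_⟩
    all_goals try simp (disch := omega) only [hreg, State.setReg_reg, State.setReg_mem,
      Function.update_self, Function.update_of_ne, one_mul, List.length_nil]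
    · omega
    · omega
    · simp only [List.getD_nil]
      split_ifs with hp
      · rfl
      · exact List.getD_eq_default _ _ (by omega)

/-- Write the facts of a list of templates. -/
def templatesProg : List Template → Prog
  | [] => .skip
  | τ :: l => .seq (nest τ.body τ.vars) (templatesProg l)

/-- The encoded facts of a template. -/
noncomputable def Template.facts (τ : Template) (m : ℕ → ℕ) (n E : ℕ) : List (List ℕ) :=
  (assignments n τ.vars fun _ => 0).flatMap (τ.emit m n E)

/-- The number of steps per fact of a template. -/
def Template.cost (τ : Template) : ℕ := 5 * τ.vars.length + 5 * τ.entries.length + 13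

theorem Building.templates {m : ℕ → ℕ} {n d TB B E e W : ℕ} (hn : n ≤ W) {l : List Template}
    (hl : ∀ τ ∈ l, τ.Fits n B E W ∧ τ.vars.Nodup ∧ τ.vars.length ≤ e) :
    ∀ {F : List (List ℕ)} {s : State},
    B + 2 + (F ++ l.flatMap fun τ => τ.facts m n E).flatten.length +
      (F ++ l.flatMap fun τ => τ.facts m n E).length ≤ W →
    Building m n d TB B E F.flatten F.length (fun _ => 0) s →
    Terminates W (templatesProg l) s ((l.map Template.cost).sum * (n + 1) ^ e + 1) []
      (Building m n d TB B E (F ++ l.flatMap fun τ => τ.facts m n E).flatten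
        (F ++ l.flatMap fun τ => τ.facts m n E).length fun _ => 0) := by
  induction l with
  | nil => exact fun _ h => (Terminates.skip (by simpa using h)).mono (by simp) fun _ => id
  | cons τ l ih =>
    intro F s hW h
    obtain ⟨hτ, hnd, hle⟩ := hl τ List.mem_cons_self
    rw [List.flatMap_cons, ← List.append_assoc] at hW ⊢
    have h1 := Building.nest (W := W) (n := n) (P := τ.body) (em := τ.emit m n E)
      (K := 3 * τ.vars.length + 5 * τ.entries.length + 13)
      (V := fun u => (∀ c, u c ≤ n) ∧ ∀ c ∈ τ.vars, 1 ≤ u c) (u := fun _ => 0) (F := F) (s := s)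
      (fun u F s hV hB h => Building.body hτ hV.1 hV.2 hB h) hn hnd (fun _ _ => rfl) ?_ ?_ h
    · refine Terminates.mono (T₁ := _ + _) (Terminates.seq_silent (h1.mono le_rfl fun s' h' =>
        ih (fun τ hτ => hl τ (List.mem_cons_of_mem _ hτ)) hW h')) ?_ fun _ => id
      have h2 : (n + 1) ^ τ.vars.length ≤ (n + 1) ^ e := Nat.pow_le_pow_right (by omega) hle
      have h3 := Nat.mul_le_mul_left τ.cost h2
      have h4 : 3 * τ.vars.length + 5 * τ.entries.length + 13 + 2 * τ.vars.length = τ.cost := by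
        unfold Template.cost; omega
      rw [h4, List.map_cons, List.sum_cons, Nat.add_mul]
      omega
    · intro u' hu'
      rw [mem_assignments hnd] at hu'
      refine ⟨fun c => ?_, fun c hc => (hu'.1 c hc).1⟩
      by_cases hc : c ∈ τ.vars
      · exact (hu'.1 c hc).2
      · rw [hu'.2 c hc]; omega
    · simp only [List.flatten_append, List.length_append, Template.facts] at hW ⊢
      omega

/-- Write the encoding of a database. -/
def buildProg (nv e : ℕ) (l : List Template) : Prog :=
  .seq (initProg nv e) <| .seq (templatesProg l) <| .seq (.store 5 3) <|
    .seq (.arith .add 8 5 0) (.store 8 7)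

theorem Terminates.buildProg {w : List ℕ} {n nv e d W : ℕ} (hn : w.getD 0 0 = n)
    (hw : w.length ≤ tableAddr n e) (hW : 2 * (n + 2) ^ e ≤ W) (hnv : nv ≤ W) (hn1 : n + 1 ≤ W)
    (hnd : nv * (n + 1) = d) (hd : d ≤ W) {l : List Template}
    (hl : ∀ τ ∈ l, τ.Fits n (baseAddr n e d) (n ^ e) W ∧ τ.vars.Nodup ∧
      τ.vars.length ≤ e) {F : List (List ℕ)}
    (hF : F = l.flatMap fun τ => τ.facts (fun p => w.getD p 0) n (n ^ e))
    (hFW : baseAddr n e d + 2 + F.flatten.length + F.length ≤ W) :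
    Terminates W (buildProg nv e l) (State.init w)
      (((l.map Template.cost).sum + 2 * e + 18) * (n + 1) ^ e) []
      (Simulates n d (tableAddr n e) (baseAddr n e d)
        (State.init (d :: F.length :: F.flatten)) []) := by
  subst hF
  generalize hF : l.flatMap (fun τ => τ.facts (fun p => w.getD p 0) n (n ^ e)) = F at hFW ⊢
  refine Terminates.mono (T₁ := (2 * e + 14) + (((l.map Template.cost).sum * (n + 1) ^ e + 1) +
    (1 + (1 + 1)))) (Terminates.seq_silent ((Building.init hn hw hW hnv hn1 hnd hd (by omega)).mono
    le_rfl fun s h => Terminates.seq_silent ((Building.templates (F := []) (by omega) hl (by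
      rw [List.nil_append, hF]; exact hFW) (by simpa using h)).mono le_rfl fun s' h' => ?_))) ?_ fun _ => id
  · rw [List.nil_append, hF] at h'
    -- The two header words at `B` and `B + 1` are written last, when the number of facts is known.
    refine Terminates.store_seq (Terminates.arith_seq ?_ (Terminates.store ?_))
    · simp only [Op.eval, State.setMem_reg, h'.base, h'.one]; omega
    · simp (disch := omega) only [Op.eval, State.setMem_reg, State.setReg_reg, h'.base, h'.one,
        h'.dom, h'.count, Function.update_self, Function.update_of_ne]
      refine ⟨?_, ?_, ?_, ?_, ?_, ?_, ?_, fun r => ?_, fun p => ?_,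
        fun a ha b hb => ?_⟩
      all_goals try simp (disch := omega) only [State.setMem_reg, State.setReg_reg, h'.base, h'.one,
        h'.num, h'.numSucc, h'.table, h'.zero, h'.sim, h'.dom,
        Function.update_of_ne]
      · rfl
      · simp only [State.setMem_mem, State.setReg_mem]
        match p with
        | 0 => simp [State.init]
        | 1 => simp [State.init]
        | p + 2 =>
          rw [Function.update_of_ne (by omega), Function.update_of_ne (by omega), h'.mem,
            if_neg (by omega)]
          simp only [State.init, List.getD_cons_succ]
          congr 1
          omega
      -- The table lies between the end of the input and `B`, where nothing has been written.
      · have hlt := table_index_lt ha hb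
        have hBB : baseAddr n e d = tableAddr n e + d * d := rfl
        simp only [State.setMem_mem, State.setReg_mem]
        rw [Function.update_of_ne (by omega), Function.update_of_ne (by omega), h'.mem,
          if_pos (by omega), List.getD_eq_default _ _ (by omega)]
        simp
  · have : 1 ≤ (n + 1) ^ e := Nat.pow_pos (by omega)
    have h2 := Nat.mul_le_mul_left (2 * e + 18) this
    rw [add_assoc _ (2 * e), Nat.add_mul]
    omega

end RAM

/-! ## Tagged databases -/

namespace CQ

open RAM

variable {σ : Schema}

theorem Atom.map_eq_map_iff {V W : Type} {A : Atom σ V} {f g : V → W} :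
    A.map f = A.map g ↔ ∀ v ∈ A.vars, f v = g v := by
  constructor
  · rintro h _ ⟨i, rfl⟩
    exact congrFun (eq_of_heq (Sigma.mk.inj h).2) i
  · intro h
    exact congrArg (Sigma.mk A.1) (funext fun i => h _ ⟨i, rfl⟩)

theorem Atom.map_map {V W X : Type} (A : Atom σ V) (f : V → W) (g : W → X) :
    (A.map f).map g = A.map (g ∘ f) := rfl

theorem Atom.map_injective {V W : Type} {f : V → W} (hf : Function.Injective f) :
    Function.Injective (Atom.map (σ := σ) f) := by
  rintro ⟨R, a⟩ ⟨S, b⟩ h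
  obtain ⟨h1, h2⟩ := Sigma.mk.inj h
  subst h1
  have h2 := eq_of_heq h2
  exact congrArg (Sigma.mk R) (funext fun i => hf (congrFun h2 i))

namespace Query

variable {r : ℕ} (q : Query σ r)

/-- An assignment of the colors below `k` (and dummy colors) to the variables of a query, such that each
color class is connected; for each atom a list of its proper colors and possibly a test. -/
structure Coloring (k e : ℕ) (col : Fin q.numVars → ℕ) (vars : Atom σ (Fin q.numVars) → List ℕ)
    (test : Atom σ (Fin q.numVars) → Option ℕ) : Prop where
  nodup : ∀ A ∈ q.atoms, (vars A).Nodup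
  mem_vars : ∀ A ∈ q.atoms, ∀ c, c ∈ vars A ↔ c < k ∧ ∃ v ∈ A.vars, col v = c
  length_le : ∀ A ∈ q.atoms, (vars A).length ≤ e
  test_le : ∀ A ∈ q.atoms, ∀ b ∈ test A, b ≤ 1
  test_length : ∀ A ∈ q.atoms, ∀ b ∈ test A, (vars A).length = e
  connected : ∀ φ : Fin q.numVars → ℕ, (∀ A ∈ q.atoms, ∀ v ∈ A.vars, ∀ v' ∈ A.vars,
    col v = col v' → col v < k → φ v = φ v') → ∀ v v', col v = col v' → col v < k → φ v = φ v'
  surj : ∀ c < k, ∃ v, col v = c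

variable (col : Fin q.numVars → ℕ) (vars : Atom σ (Fin q.numVars) → List ℕ)
  (test : Atom σ (Fin q.numVars) → Option ℕ)

/-- The template for the facts that represent an atom. -/
def template (A : Atom σ (Fin q.numVars)) : Template where
  sym := A.1
  entries := List.ofFn fun i => ((A.2 i : ℕ), col (A.2 i))
  vars := vars A
  test := test A

/-- The domain element that represents the value of a variable, tagged with the variable. -/
def code (n : ℕ) (u : ℕ → ℕ) (v : Fin q.numVars) : Fin (q.numVars * (n + 1)) :=
  ⟨v * (n + 1) + min (u (col v)) n, by
    have h1 : (v + 1 : ℕ) * (n + 1) ≤ q.numVars * (n + 1) := Nat.mul_le_mul_right _ v.2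
    rw [Nat.succ_mul] at h1
    have h2 := min_le_right (u (col v)) n
    omega⟩

/-- The tag of a domain element. -/
def tag (n : ℕ) (p : Fin (q.numVars * (n + 1))) : Fin q.numVars :=
  ⟨p / (n + 1), Nat.div_lt_of_lt_mul (lt_of_lt_of_eq p.2 (Nat.mul_comm _ _))⟩

theorem tag_code (n : ℕ) (u : ℕ → ℕ) (v : Fin q.numVars) : q.tag n (q.code col n u v) = v := by
  apply Fin.ext
  have h2 := min_le_right (u (col v)) n
  simp only [tag, code]
  rw [mul_comm, Nat.mul_add_div (by omega), Nat.div_eq_of_lt (by omega), add_zero]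

theorem code_mod (n : ℕ) (u : ℕ → ℕ) (v : Fin q.numVars) (h : u (col v) ≤ n) :
    (q.code col n u v : ℕ) % (n + 1) = u (col v) := by
  simp only [code, min_eq_left h]
  rw [mul_comm, Nat.mul_add_mod, Nat.mod_eq_of_lt (by omega)]

open Classical in
/-- The facts of the database in which all atoms of `q` are represented by tagged facts. -/
noncomputable def taggedFacts (m : ℕ → ℕ) (n E : ℕ) : List (Atom σ (Fin (q.numVars * (n + 1)))) :=
  q.atoms.toList.flatMap fun A =>
    ((assignments n (vars A) fun _ => 0).filter fun u =>
      (q.template col vars test A).Passes m n E u).map fun u => A.map (q.code col n u)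

open Classical in
/-- The database in which all atoms of `q` are represented by tagged facts. -/
noncomputable def taggedDatabase (m : ℕ → ℕ) (n E : ℕ) : Database σ where
  dom := q.numVars * (n + 1)
  facts := (q.taggedFacts col vars test m n E).toFinset

variable {q col vars test} {k e n E : ℕ} {m : ℕ → ℕ}

theorem mem_taggedFacts {F : Atom σ (Fin (q.numVars * (n + 1)))} :
    F ∈ q.taggedFacts col vars test m n E ↔ ∃ A ∈ q.atoms, ∃ u ∈ assignments n (vars A) fun _ => 0,
      (q.template col vars test A).Passes m n E u ∧ A.map (q.code col n u) = F := by
  simp only [taggedFacts, List.mem_flatMap, Finset.mem_toList, List.mem_map, List.mem_filter,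
    decide_eq_true_eq, and_assoc]

theorem Coloring.le_of_mem (hc : q.Coloring k e col vars test) {A : Atom σ (Fin q.numVars)}
    (hA : A ∈ q.atoms) {u : ℕ → ℕ} (hu : u ∈ assignments n (vars A) fun _ => 0) (c : ℕ) :
    u c ≤ n := by
  rw [mem_assignments (hc.nodup A hA)] at hu
  by_cases h : c ∈ vars A
  · exact (hu.1 c h).2
  · rw [hu.2 c h]; omega

/-- A fact determines its atom through the tags, and the assignment through the residues modulo `n +
1`, because assignments vanish outside `vars A`. An encoding must be free of repetitions, so this
saves the program from removing duplicates. -/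
theorem Coloring.nodup_taggedFacts (hc : q.Coloring k e col vars test) :
    (q.taggedFacts col vars test m n E).Nodup := by
  classical
  refine List.nodup_flatMap.2 ⟨fun A hA => ?_, ?_⟩
  · rw [Finset.mem_toList] at hA
    refine List.Nodup.map_on ?_ ((nodup_assignments (hc.nodup A hA) _).filter _)
    intro u hu u' hu' h
    have hu := (List.mem_filter.1 hu).1
    have hu' := (List.mem_filter.1 hu').1
    have hle := hc.le_of_mem hA hu
    have hle' := hc.le_of_mem hA hu'
    rw [mem_assignments (hc.nodup A hA)] at hu hu'
    rw [Atom.map_eq_map_iff] at h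
    funext c
    by_cases hcA : c ∈ vars A
    · obtain ⟨-, v, hv, rfl⟩ := (hc.mem_vars A hA c).1 hcA
      rw [← q.code_mod col n u v (hle _), ← q.code_mod col n u' v (hle' _), h v hv]
    · rw [hu.2 c hcA, hu'.2 c hcA]
  · refine (Finset.nodup_toList _).imp fun {A B} hAB => ?_
    intro F h1 h2
    simp only [List.mem_map, List.mem_filter] at h1 h2
    obtain ⟨u, -, h1⟩ := h1
    obtain ⟨u', -, h2⟩ := h2
    have h := congrArg (Atom.map (q.tag n)) (h1.trans h2.symm)
    rw [Atom.map_map, Atom.map_map] at h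
    have ht : ∀ u, q.tag n ∘ q.code col n u = fun v => v := fun u => funext (q.tag_code col n u)
    rw [ht, ht] at h
    exact hAB h

theorem Coloring.map_taggedFacts (hc : q.Coloring k e col vars test) :
    (q.taggedFacts col vars test m n E).map
        (fun A => (A.1 : ℕ) :: List.ofFn fun i => (A.2 i : ℕ)) =
      (q.atoms.toList.map (q.template col vars test)).flatMap fun τ => τ.facts m n E := by
  classical
  rw [taggedFacts, List.map_flatMap, List.flatMap_map]
  refine List.flatMap_congr fun A hA => ?_
  rw [Finset.mem_toList] at hA
  have key : ∀ l : List (ℕ → ℕ), (∀ u ∈ l, ∀ c, u c ≤ n) →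
      ((l.filter fun u => (q.template col vars test A).Passes m n E u).map fun u =>
        A.map (q.code col n u)).map (fun A => (A.1 : ℕ) :: List.ofFn fun i => (A.2 i : ℕ)) =
      l.flatMap ((q.template col vars test A).emit m n E) := by
    intro l hl
    induction l with
    | nil => rfl
    | cons u l ih =>
      have ih := ih fun u hu => hl u (List.mem_cons_of_mem _ hu)
      have hu := hl u List.mem_cons_self
      rw [List.flatMap_cons, ← ih, List.filter_cons, Template.emit]
      by_cases hp : (q.template col vars test A).Passes m n E u
      · have hf : ((A.map (q.code col n u)).1 : ℕ) ::
            List.ofFn (fun i => ((A.map (q.code col n u)).2 i : ℕ)) =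
            (q.template col vars test A).fact n u := by
          simp [Template.fact, template, Atom.map, code, hu, List.map_ofFn, Function.comp_def]
        rw [if_pos (decide_eq_true hp), if_pos hp, List.map_cons, List.map_cons, hf,
          List.singleton_append]
      · rw [if_neg (by simpa using hp), if_neg hp, List.nil_append]
  exact key _ fun u hu => hc.le_of_mem hA hu

theorem Coloring.encodes (hc : q.Coloring k e col vars test) {F : List (List ℕ)}
    (hF : F = (q.atoms.toList.map (q.template col vars test)).flatMap fun τ => τ.facts m n E) :
    (q.taggedDatabase col vars test m n E).Encodes
      (q.numVars * (n + 1) :: F.length :: F.flatten) := by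
  classical
  refine ⟨q.taggedFacts col vars test m n E, hc.nodup_taggedFacts, fun A => ?_, ?_⟩
  · exact List.mem_toFinset.symm
  · rw [hF, ← hc.map_taggedFacts, List.length_map]
    rfl

theorem _root_.RAM.encodeFrom_congr {n : ℕ} {u u' : ℕ → ℕ} {cs : List ℕ}
    (h : ∀ c ∈ cs, u c = u' c) (a : ℕ) : encodeFrom n u a cs = encodeFrom n u' a cs := by
  induction cs generalizing a with
  | nil => rfl
  | cons c cs ih =>
    simp only [encodeFrom, List.foldl_cons] at ih ⊢
    rw [h c List.mem_cons_self]
    exact ih (fun c hc => h c (List.mem_cons_of_mem _ hc)) _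

theorem _root_.RAM.Template.Passes.congr {τ : Template} {u u' : ℕ → ℕ}
    (h : ∀ c ∈ τ.vars, u c = u' c) (hu : τ.Passes m n E u) : τ.Passes m n E u' := by
  intro b hb
  rw [← encodeFrom_congr h]
  exact hu b hb

/-- An assignment that passes the tests of all atoms. -/
structure Valid (q : Query σ r) (col : Fin q.numVars → ℕ)
    (vars : Atom σ (Fin q.numVars) → List ℕ) (test : Atom σ (Fin q.numVars) → Option ℕ)
    (k n E : ℕ) (m : ℕ → ℕ) (u : ℕ → ℕ) : Prop where
  range : ∀ c < k, 1 ≤ u c ∧ u c ≤ n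
  zero : ∀ c, k ≤ c → u c = 0
  passes : ∀ A ∈ q.atoms, (q.template col vars test A).Passes m n E u

theorem Valid.le {u : ℕ → ℕ} (hu : q.Valid col vars test k n E m u) (c : ℕ) : u c ≤ n := by
  rcases lt_or_ge c k with h | h
  · exact (hu.range c h).2
  · rw [hu.zero c h]; omega

theorem Coloring.map_code_mem (hc : q.Coloring k e col vars test) {u : ℕ → ℕ}
    (hu : q.Valid col vars test k n E m u) {A : Atom σ (Fin q.numVars)} (hA : A ∈ q.atoms) :
    A.map (q.code col n u) ∈ q.taggedFacts col vars test m n E := by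
  rw [mem_taggedFacts]
  -- The assignments that index the facts of `A` are zero outside the colors of `A`; this cut-off
  -- does not affect the fact, since dummy colors have value `0` anyway.
  let u' : ℕ → ℕ := fun c => if c ∈ vars A then u c else 0
  have huu : ∀ c ∈ vars A, u c = u' c := fun c h => (if_pos h).symm
  refine ⟨A, hA, u', ?_, (hu.passes A hA).congr huu, ?_⟩
  · rw [mem_assignments (hc.nodup A hA)]
    refine ⟨fun c h => ?_, fun c h => if_neg h⟩
    rw [← huu c h]
    exact hu.range c ((hc.mem_vars A hA c).1 h).1
  · refine Atom.map_eq_map_iff.2 fun v hv => Fin.ext ?_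
    have : u' (col v) = u (col v) := by
      rcases lt_or_ge (col v) k with h | h
      · exact (huu _ ((hc.mem_vars A hA _).2 ⟨h, v, hv, rfl⟩)).symm
      · have hn : col v ∉ vars A := fun h' => by
          have := ((hc.mem_vars A hA _).1 h').1
          omega
        rw [hu.zero _ h]
        exact if_neg hn
    simp only [code, this]

/-- A homomorphism to the tagged database that respects the tags of the free variables gives a valid
assignment, by minimality of the query. -/
theorem Coloring.exists_valid (hc : q.Coloring k e col vars test) (hmin : q.IsMinimal)
    {μ : Fin q.numVars → Fin (q.numVars * (n + 1))}
    (hμ : ∀ A ∈ q.atoms, A.map μ ∈ q.taggedFacts col vars test m n E)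
    (hfree : ∀ i, q.tag n (μ (q.free i)) = q.free i) :
    ∃ u, q.Valid col vars test k n E m u ∧
      ∀ i, u (col (q.free i)) = (μ (q.free i) : ℕ) % (n + 1) := by
  classical
  -- The tag part of `μ`. A fact arising from an atom `A'` has the entries of `A'` as tags, so `ν`
  -- is an endomorphism.
  let ν : Fin q.numVars → Fin q.numVars := fun v => q.tag n (μ v)
  have hν : ∀ A ∈ q.atoms, A.map ν ∈ q.atoms ∧ ∃ u ∈ assignments n (vars (A.map ν)) fun _ => 0,
      (q.template col vars test (A.map ν)).Passes m n E u ∧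
      ∀ v ∈ A.vars, μ v = q.code col n u (ν v) := by
    intro A hA
    obtain ⟨A', hA', u, hu, hp, h⟩ := mem_taggedFacts.1 (hμ A hA)
    have h1 := congrArg (Atom.map (q.tag n)) h
    rw [Atom.map_map, Atom.map_map,
      show q.tag n ∘ q.code col n u = fun v => v from funext (q.tag_code col n u)] at h1
    have h2 : A' = A.map ν := h1
    subst h2
    exact ⟨hA', u, hu, hp, Atom.map_eq_map_iff.1 h.symm⟩
  have hinj : Function.Injective ν := hmin ν (fun A hA => (hν A hA).1) hfree
  -- An injective endomorphism permutes the finite set of atoms, so the test of every atom is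
  -- enforced by some fact in the image of `μ`.
  have hsurj : ∀ A ∈ q.atoms, ∃ B ∈ q.atoms, B.map ν = A := by
    have := Finset.surjOn_of_injOn_of_card_le (s := q.atoms) (t := q.atoms) (Atom.map ν)
      (fun A hA => (hν A hA).1) (Atom.map_injective hinj).injOn le_rfl
    exact fun A hA => this hA
  obtain ⟨ρ, hρ, -⟩ := Function.bijective_iff_has_inverse.1 (Finite.injective_iff_bijective.1 hinj)
  -- The value of the variable that `ν` sends to `v`: the values of `μ` after undoing the
  -- permutation.
  let g : Fin q.numVars → ℕ := fun v => (μ (ρ v) : ℕ) % (n + 1)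
  have hg : ∀ A ∈ q.atoms, ∃ u ∈ assignments n (vars A) fun _ => 0,
      (q.template col vars test A).Passes m n E u ∧ ∀ v ∈ A.vars, g v = u (col v) := by
    intro A hA
    obtain ⟨B, hB, rfl⟩ := hsurj A hA
    obtain ⟨-, u, hu, hp, h⟩ := hν B hB
    refine ⟨u, hu, hp, ?_⟩
    rintro _ ⟨i, rfl⟩
    have h1 := h (B.2 i) ⟨i, rfl⟩
    change (μ (ρ (ν (B.2 i))) : ℕ) % (n + 1) = u (col (ν (B.2 i)))
    rw [hρ, h1, code_mod _ _ _ _ _ (hc.le_of_mem hA hu _)]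
  -- Within an atom, variables of equal color get equal values by construction of the facts.
  -- Connectedness of the color classes spreads this to the whole class, so `g` descends to the
  -- proper colors.
  have hconn : ∀ v v', col v = col v' → col v < k → g v = g v' := by
    refine hc.connected g fun A hA v hv v' hv' hvv _ => ?_
    obtain ⟨u, -, -, hu⟩ := hg A hA
    rw [hu v hv, hu v' hv', hvv]
  choose w hw using hc.surj
  let u : ℕ → ℕ := fun c => if h : c < k then g (w c h) else 0
  have hu : ∀ v, u (col v) = g v := by
    intro v
    by_cases h : col v < k
    · simp only [u, dif_pos h]
      exact hconn _ _ (hw _ h) (by rwa [hw _ h])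
    · obtain ⟨A, hA, hvA⟩ := q.occurs v
      obtain ⟨u', hu', -, h'⟩ := hg A hA
      rw [mem_assignments (hc.nodup A hA)] at hu'
      rw [h' v hvA, hu'.2 (col v) fun hmem => h ((hc.mem_vars A hA _).1 hmem).1]
      exact dif_neg h
  have huA : ∀ A ∈ q.atoms, ∃ u' ∈ assignments n (vars A) fun _ => 0,
      (q.template col vars test A).Passes m n E u' ∧ ∀ c ∈ vars A, u' c = u c := by
    intro A hA
    obtain ⟨u', hu', hp, h'⟩ := hg A hA
    refine ⟨u', hu', hp, fun c h => ?_⟩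
    obtain ⟨-, v, hv, rfl⟩ := (hc.mem_vars A hA c).1 h
    rw [hu, h' v hv]
  refine ⟨u, ⟨fun c h => ?_, fun c h => dif_neg (by omega), fun A hA => ?_⟩, fun i => ?_⟩
  · obtain ⟨A, hA, hvA⟩ := q.occurs (w c h)
    obtain ⟨u', hu', -, h'⟩ := huA A hA
    have hcA : c ∈ vars A := (hc.mem_vars A hA c).2 ⟨h, w c h, hvA, hw c h⟩
    rw [mem_assignments (hc.nodup A hA)] at hu'
    rw [← h' c hcA]
    exact hu'.1 c hcA
  · obtain ⟨u', -, hp, h'⟩ := huA A hA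
    exact hp.congr h'
  · rw [hu]
    have : ρ (q.free i) = q.free i := by
      conv_lhs => rw [← hfree i]
      exact hρ _
    simp only [g, this]

/-- Only answers in which each free variable carries its own tag are considered. There may be
others, but they lie in other blocks of the table and are never read. -/
theorem Coloring.answers_iff (hc : q.Coloring k e col vars test) (hmin : q.IsMinimal)
    (a : Fin r → ℕ) (ha : ∀ i, a i ≤ n) :
    (∃ f ∈ q.answers (q.taggedDatabase col vars test m n E),
      ∀ i, (f i : ℕ) = q.free i * (n + 1) + a i) ↔
    ∃ u, q.Valid col vars test k n E m u ∧ ∀ i, u (col (q.free i)) = a i := by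
  classical
  constructor
  · rintro ⟨f, ⟨μ, hμ, hf⟩, hfa⟩
    have hμ' : ∀ i, (μ (q.free i) : ℕ) = q.free i * (n + 1) + a i := fun i => by
      rw [← hfa, ← hf]
    obtain ⟨u, hu, h⟩ := hc.exists_valid hmin (μ := μ) (m := m) (E := E)
      (fun A hA => List.mem_toFinset.1 (hμ A hA)) fun i => by
        have := ha i
        apply Fin.ext
        simp only [tag, hμ']
        rw [mul_comm, Nat.mul_add_div (by omega), Nat.div_eq_of_lt (by omega), add_zero]
    refine ⟨u, hu, fun i => ?_⟩
    have := ha i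
    rw [h, hμ', mul_comm, Nat.mul_add_mod, Nat.mod_eq_of_lt (by omega)]
  · rintro ⟨u, hu, h⟩
    refine ⟨fun i => q.code col n u (q.free i), ⟨q.code col n u, fun A hA =>
      List.mem_toFinset.2 (hc.map_code_mem hu hA), fun i => rfl⟩, fun i => ?_⟩
    simp only [code, h, min_eq_left (ha i)]

end Query

end CQ

/-! ### Size bounds and the computation of the table of solutions -/

namespace CQ

open RAM

variable {σ : Schema}

/-- The encoding of a fact. -/
def Atom.word {N : ℕ} (A : Atom σ (Fin N)) : List ℕ :=
  (A.1 : ℕ) :: List.ofFn fun i => (A.2 i : ℕ)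

theorem Atom.word_le {N : ℕ} (A : Atom σ (Fin N)) {x : ℕ} (hx : x ∈ A.word) :
    x ≤ σ.numSymbols + N := by
  rcases List.mem_cons.1 hx with rfl | hx
  · exact A.1.2.le.trans (Nat.le_add_right _ _)
  · obtain ⟨i, rfl⟩ := (List.mem_ofFn' _ _).1 hx
    exact (A.2 i).2.le.trans (Nat.le_add_left _ _)

/-- An upper bound on the length of encoded facts. -/
def Schema.maxLength (σ : Schema) : ℕ := 1 + ∑ R, σ.arity R

theorem Atom.length_word_le {N : ℕ} (A : Atom σ (Fin N)) : A.word.length ≤ σ.maxLength := by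
  have := Finset.single_le_sum (f := σ.arity) (fun _ _ => Nat.zero_le _) (Finset.mem_univ A.1)
  simp only [Atom.word, List.length_cons, List.length_ofFn, Schema.maxLength]
  omega

theorem _root_.List.length_flatMap_le_mul {α β : Type} (l : List α) (f : α → List β) {N : ℕ}
    (h : ∀ a ∈ l, (f a).length ≤ N) : (l.flatMap f).length ≤ l.length * N := by
  rw [List.length_flatMap]
  have := List.sum_le_card_nsmul (l.map fun a => (f a).length) N (by simpa using h)
  simpa using this

theorem _root_.RAM.State.boundedBy_init {w : List ℕ} {V : ℕ} (h : ∀ x ∈ w, x ≤ V) :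
    (State.init w).BoundedBy V := by
  refine ⟨fun _ => Nat.zero_le _, fun p => ?_⟩
  change w.getD p 0 ≤ V
  rcases Nat.lt_or_ge p w.length with hp | hp
  · rw [List.getD_eq_getElem _ _ hp]
    exact h _ (List.getElem_mem hp)
  · rw [List.getD_eq_default _ _ hp]
    omega

/-- Since `K < 2 ^ K ≤ N ^ K`, constant factors can be absorbed into the exponent of the bound on
numbers. -/
theorem pow_bound (K N a : ℕ) (hN : 2 ≤ N) : K * N ^ a ≤ N ^ (a + K) := by
  rw [pow_add, mul_comm]
  exact Nat.mul_le_mul_left _ (Nat.lt_two_pow_self.le.trans (Nat.pow_le_pow_left hN K))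

namespace Query

variable {r : ℕ} {q : Query σ r} {col : Fin q.numVars → ℕ}
  {vars : Atom σ (Fin q.numVars) → List ℕ} {test : Atom σ (Fin q.numVars) → Option ℕ}
  {k e n E : ℕ} {m : ℕ → ℕ}

theorem Coloring.length_taggedFacts_le (hc : q.Coloring k e col vars test) :
    (q.taggedFacts col vars test m n E).length ≤ q.atoms.card * (n + 1) ^ e := by
  classical
  rw [taggedFacts, ← Finset.length_toList]
  refine List.length_flatMap_le_mul _ _ fun A hA => ?_
  rw [Finset.mem_toList] at hA
  rw [List.length_map]
  refine (List.length_filter_le _ _).trans ?_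
  rw [length_assignments]
  exact (Nat.pow_le_pow_left (by omega) _).trans
    (Nat.pow_le_pow_right (by omega) (hc.length_le A hA))

theorem Coloring.size_taggedDatabase (hc : q.Coloring k e col vars test) :
    (q.taggedDatabase col vars test m n E).size =
      q.numVars * (n + 1) + (q.taggedFacts col vars test m n E).length := by
  classical
  change _ + (List.toFinset _).card = _
  exact congrArg _ (List.toFinset_card_of_nodup hc.nodup_taggedFacts)

/-- With constant delay this bounds the duration of the enumeration phase; it is quadratic in `d`
because the answers are pairs. -/
theorem length_outputs_le {d : ℕ} {o : List (List ℕ)} (ho : o.Nodup)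
    (h : ∀ v ∈ o, ∃ a < d, ∃ b < d, v = [a, b]) : o.length ≤ d * d := by
  classical
  have h1 : o.toFinset ⊆ (Finset.range d ×ˢ Finset.range d).image fun p => [p.1, p.2] := by
    intro v hv
    obtain ⟨a, ha, b, hb, rfl⟩ := h v (List.mem_toFinset.1 hv)
    exact Finset.mem_image.2 ⟨(a, b), by simp [ha, hb], rfl⟩
  have h2 := (Finset.card_le_card h1).trans Finset.card_image_le
  rwa [List.toFinset_card_of_nodup ho, Finset.card_product, Finset.card_range] at h2

theorem Coloring.fits (hc : q.Coloring k e col vars test) {W : ℕ}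
    (hE : 2 * n ^ e ≤ baseAddr n e (q.numVars * (n + 1)))
    (hσ : σ.numSymbols ≤ W) (hd : q.numVars * (n + 1) ≤ W) :
    ∀ τ ∈ q.atoms.toList.map (q.template col vars test),
      τ.Fits n (baseAddr n e (q.numVars * (n + 1))) (n ^ e) W ∧ τ.vars.Nodup ∧
        τ.vars.length ≤ e := by
  intro τ hτ
  obtain ⟨A, hA, rfl⟩ := List.mem_map.1 hτ
  rw [Finset.mem_toList] at hA
  refine ⟨⟨A.1.2.le.trans hσ, fun x hx => ?_, fun b hb => ?_, hc.test_le A hA, hE⟩,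
    hc.nodup A hA, hc.length_le A hA⟩
  · obtain ⟨i, rfl⟩ := (List.mem_ofFn' _ _).1 hx
    have h1 : ((A.2 i : ℕ) + 1) * (n + 1) ≤ q.numVars * (n + 1) :=
      Nat.mul_le_mul_right _ (A.2 i).2
    rw [Nat.succ_mul] at h1
    simp only
    omega
  · exact (congrArg _ (hc.test_length A hA b hb)).le

/-- If the solutions of a binary query can be enumerated with constant delay after linear
preprocessing, then the table of solutions over tagged databases can be computed in time
`O((n + 1) ^ e)`. -/
theorem Coloring.exists_table {q : Query σ 2} {col : Fin q.numVars → ℕ}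
    {vars : Atom σ (Fin q.numVars) → List ℕ} {test : Atom σ (Fin q.numVars) → Option ℕ}
    (hc : q.Coloring k e col vars test) (he : 2 ≤ e) (hmin : q.IsMinimal)
    (hq : q.HasLinearPreprocessingConstantDelay) :
    ∃ (P : Prog) (K : ℕ), ∀ (n W : ℕ) (w : List ℕ), w.getD 0 0 = n →
      w.length ≤ tableAddr n e → (n + 2) ^ K ≤ W →
      Terminates W P (State.init w) (K * (n + 1) ^ e) [] fun s => ∃ s₀ L,
        Simulates n (q.numVars * (n + 1)) (tableAddr n e)
          (baseAddr n e (q.numVars * (n + 1))) s₀ L s ∧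
        ∀ a b, a ≤ n → b ≤ n →
          ([q.free 0 * (n + 1) + a, q.free 1 * (n + 1) + b] ∈ L ↔
          ∃ u, q.Valid col vars test k n (n ^ e) (fun p => w.getD p 0) u ∧
            u (col (q.free 0)) = a ∧ u (col (q.free 1)) = b) := by
  obtain ⟨pre, enum, c, h⟩ := hq
  set l := q.atoms.toList.map (q.template col vars test) with hl
  -- The tagged database has `q.numVars * (n + 1)` elements and at most `q.atoms.card * (n + 1) ^ e`
  -- facts, so its size plus `2` is at most `K₁ * (n + 1) ^ e`.
  set K₁ := q.numVars + q.atoms.card + 2 with hK₁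
  set C := 1 + (K₁ * K₁ + K₁ * (σ.maxLength + 10) + σ.numSymbols + 10) with hC
  refine ⟨.seq (buildProg q.numVars e l) (.seq pre.tabulate enum.tabulate),
    ((e + K₁) * c + 2 * e + C) + ((l.map Template.cost).sum + 2 * e + 18 +
      (4 * (c * K₁) + 4 * (c + (c + 1) * (q.numVars * q.numVars)))), ?_⟩
  intro n W w hn hw hW
  set m : ℕ → ℕ := fun p => w.getD p 0 with hm
  obtain ⟨d, hd⟩ : ∃ d, d = q.numVars * (n + 1) := ⟨_, rfl⟩
  set D := q.taggedDatabase col vars test m n (n ^ e) with hD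
  set F := l.flatMap fun τ => τ.facts m n (n ^ e) with hF
  have hFmap : F = (q.taggedFacts col vars test m n (n ^ e)).map Atom.word := by
    rw [hF, hl, ← hc.map_taggedFacts]
    rfl
  -- size bounds
  set Y := (n + 1) ^ e with hY
  have hFlen : F.length = (q.taggedFacts col vars test m n (n ^ e)).length := by
    rw [hFmap, List.length_map]
  have hFY : F.length ≤ q.atoms.card * Y := hFlen.le.trans hc.length_taggedFacts_le
  have hFfl : F.flatten.length ≤ F.length * σ.maxLength := by
    rw [hFlen, hFmap, ← List.flatMap_def]
    exact List.length_flatMap_le_mul _ _ fun A _ => A.length_word_le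
  have hsize : D.size = d + F.length := by rw [hD, hc.size_taggedDatabase, hd, hFlen]
  have hY1 : 1 ≤ Y := Nat.pow_pos (by omega)
  have hnY : n + 1 ≤ Y := Nat.le_self_pow (by omega) _
  have hnY2 : (n + 1) * (n + 1) ≤ Y := by
    rw [← sq]
    exact Nat.pow_le_pow_right (by omega) he
  have hdY : d ≤ q.numVars * Y := hd ▸ Nat.mul_le_mul_left _ hnY
  have hddY : d * d ≤ q.numVars * q.numVars * Y := by
    calc d * d = q.numVars * q.numVars * ((n + 1) * (n + 1)) := by rw [hd]; ring
      _ ≤ _ := Nat.mul_le_mul_left _ hnY2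
  have hSY : D.size + 2 ≤ K₁ * Y := by
    rw [hsize, hK₁, Nat.add_mul, Nat.add_mul]
    omega
  obtain ⟨X, hX⟩ : ∃ X, X = (n + 2) ^ e := ⟨_, rfl⟩
  have hYX : Y ≤ X := hX ▸ Nat.pow_le_pow_left (by omega) _
  have hXX : X ≤ X * X := Nat.le_mul_of_pos_left _ (by omega)
  have hSc : (D.size + 2) ^ c ≤ (n + 2) ^ ((e + K₁) * c) := by
    rw [pow_mul]
    refine Nat.pow_le_pow_left (hSY.trans ((Nat.mul_le_mul_left _ hYX).trans ?_)) _
    rw [hX]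
    exact pow_bound _ _ _ (by omega)
  -- One power that dominates both the numbers in the simulated run and the table size up to
  -- constants. All remaining estimates become linear in `Z`, with total coefficient `C`.
  obtain ⟨Z, hZ⟩ : ∃ Z, Z = (n + 2) ^ ((e + K₁) * c + 2 * e) := ⟨_, rfl⟩
  have hZX : X * X ≤ Z := by
    rw [hZ, hX, ← pow_add, ← two_mul]
    exact Nat.pow_le_pow_right (by omega) (by omega)
  have hZS : (D.size + 2) ^ c ≤ Z :=
    hSc.trans (hZ ▸ Nat.pow_le_pow_right (by omega) (by omega))
  have hCZ : C * Z ≤ W := by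
    refine le_trans ?_ hW
    rw [hZ]
    exact (pow_bound _ _ _ (by omega)).trans (Nat.pow_le_pow_right (by omega) (by omega))
  have hddZ : d * d ≤ K₁ * K₁ * Z := hddY.trans (Nat.mul_le_mul
    (Nat.mul_le_mul (by omega) (by omega)) (by omega))
  have hYZ : Y ≤ Z := by omega
  have hSZ : D.size + 2 ≤ K₁ * Z := hSY.trans (Nat.mul_le_mul_left _ hYZ)
  have hflZ : F.flatten.length ≤ K₁ * Z * σ.maxLength :=
    hFfl.trans (Nat.mul_le_mul_right _ (by omega))
  have hKZ : K₁ ≤ K₁ * Z := Nat.le_mul_of_pos_right _ (by omega)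
  have hσZ : σ.numSymbols ≤ σ.numSymbols * Z := Nat.le_mul_of_pos_right _ (by omega)
  have hCexp : C * Z = Z + (K₁ * K₁ * Z + (K₁ * Z * σ.maxLength + 10 * (K₁ * Z)) +
      σ.numSymbols * Z + 10 * Z) := by
    rw [hC]; ring
  have hB : baseAddr n e d = 2 * Y + 1 + d * d := rfl
  have hXe : 2 * (n + 2) ^ e ≤ 2 * Z := by rw [← hX]; omega
  have hne : n ^ e ≤ Y := Nat.pow_le_pow_left (by omega) _
  -- the run of the enumeration algorithm
  obtain ⟨t₁, t₂, s, f, h1, h2, h3, h4, h5, h6, h7⟩ :=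
    h D (q.numVars * (n + 1) :: F.length :: F.flatten) (hc.encodes rfl)
  have ho : ∀ v ∈ Trace.outputs t₂, ∃ a < d, ∃ b < d, v = [a, b] := by
    intro v hv
    obtain ⟨a, -, rfl⟩ := (h7 v).1 hv
    rw [hd]
    exact ⟨a 0, (a 0).2, a 1, (a 1).2, by simp [List.ofFn_succ]⟩
  have ht₂ : t₂.length ≤ c + (c + 1) * (q.numVars * q.numVars * Y) :=
    h5.length_le.trans (Nat.add_le_add_left (Nat.mul_le_mul_left _
      ((length_outputs_le h6 ho).trans hddY)) _)
  -- The first summand bounds the numbers computed by the algorithm, the others the domain elements,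
  -- counts and relation symbols in its input word, which need not obey that bound.
  set V := (D.size + 2) ^ c + D.size + σ.numSymbols with hV
  have hbd : (State.init (q.numVars * (n + 1) :: F.length :: F.flatten)).BoundedBy V := by
    refine State.boundedBy_init fun x hx => ?_
    rw [← hd] at hx
    rcases List.mem_cons.1 hx with rfl | hx
    · omega
    rcases List.mem_cons.1 hx with rfl | hx
    · omega
    obtain ⟨v, hv, hx⟩ := List.mem_flatten.1 hx
    rw [hFmap] at hv
    obtain ⟨A, -, rfl⟩ := List.mem_map.1 hv
    have := A.word_le hx
    rw [← hd] at this
    omega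
  have hVW : V + baseAddr n e d ≤ W := by omega
  have hbuild := Terminates.buildProg (W := W) (w := w) (l := l) (e := e) (F := F) hn hw (by omega)
    (by omega) (by omega) hd.symm (by omega)
    (hd ▸ hc.fits (by rw [← hd]; omega) (by omega)
      (by rw [← hd]; omega)) hF (by omega)
  rw [← hd] at h1 hbd ⊢
  refine Terminates.mono (T₁ := _ + (4 * t₁.length + 4 * t₂.length)) (Terminates.seq_silent
    (hbuild.mono le_rfl fun s' hs' => Terminates.seq_silent ((h1.tabulate (by omega) hVW le_rfl hbd
      (by rw [h3]; simp) hs').mono le_rfl fun s'' hs'' => (h4.tabulate (by omega) hVW le_rfl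
      (h1.boundedBy (by omega) hbd) ho hs'').mono le_rfl fun f' hf' =>
      ⟨f, _, hf', fun a b ha hb => ?_⟩))) ?_ fun _ => id
  · have e1 : c * (D.size + 1) ≤ c * K₁ * Y := by
      rw [mul_assoc]; exact Nat.mul_le_mul_left _ (by omega)
    have e2 : c ≤ c * Y := Nat.le_mul_of_pos_right _ (by omega)
    have e3 : ((e + K₁) * c + 2 * e + C + ((l.map Template.cost).sum + 2 * e + 18 +
        (4 * (c * K₁) + 4 * (c + (c + 1) * (q.numVars * q.numVars))))) * Y =
        ((e + K₁) * c + 2 * e + C) * Y + (((l.map Template.cost).sum + 2 * e + 18) * Y +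
        (4 * (c * K₁ * Y) + 4 * (c * Y + (c + 1) * (q.numVars * q.numVars * Y)))) := by ring
    rw [e3, ← hY]
    omega
  · rw [h3, List.nil_append, List.nil_append, h7]
    have := hc.answers_iff (n := n) (m := m) (E := n ^ e) hmin ![a, b]
      (by simp [Fin.forall_fin_two, ha, hb])
    simp only [Fin.forall_fin_two, Matrix.cons_val_zero, Matrix.cons_val_one] at this
    rw [← this]
    simp only [List.ofFn_succ, List.ofFn_zero, List.cons.injEq, and_true]
    refine exists_congr fun f => and_congr_right fun _ => ?_
    exact and_congr eq_comm eq_comm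

end Query

end CQ

/-! ## Evaluating the table of solutions -/

namespace RAM

/-- The state contains a table of truth values `T a b` for `a, b ≤ n`, stored in rows
`x * (n + 1) + a` and columns `y * (n + 1) + b` of a matrix with `d` columns. -/
structure HasTable (n d TB x y : ℕ) (T : ℕ → ℕ → Prop) [∀ a b, Decidable (T a b)] (s : State) :
    Prop where
  one : s.reg 0 = 1
  num : s.reg 1 = n
  numSucc : s.reg 2 = n + 1
  dom : s.reg 3 = d
  table : s.reg 4 = TB
  zero : s.reg 12 = 0
  entry : ∀ a ≤ n, ∀ b ≤ n,
    s.mem (TB + ((x * (n + 1) + a) * d + (y * (n + 1) + b))) = if T a b then 1 else 0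

section Table

variable {n d TB x y W : ℕ} {T : ℕ → ℕ → Prop} [∀ a b, Decidable (T a b)] {s : State}

theorem HasTable.setReg (h : HasTable n d TB x y T s) (r v : ℕ)
    (hr : r ∉ [0, 1, 2, 3, 4, 12]) : HasTable n d TB x y T (s.setReg r v) := by
  obtain ⟨h0, h1, h2, h3, h4, h12, he⟩ := h
  simp only [List.mem_cons, List.not_mem_nil, or_false, not_or] at hr
  refine ⟨?_, ?_, ?_, ?_, ?_, ?_, he⟩ <;>
    simp (disch := omega) only [State.setReg_reg, Function.update_of_ne] <;> assumption

/-- Read the entry of the table at position `(n + 1 - reg 21, n + 1 - reg 23)`. -/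
def lookup (x y : ℕ) : Prog :=
  .seq (.const 8 x) <| .seq (.arith .mul 8 8 2) <| .seq (.arith .sub 9 2 21) <|
  .seq (.arith .add 8 8 9) <| .seq (.arith .mul 8 8 3) <| .seq (.const 9 y) <|
  .seq (.arith .mul 9 9 2) <| .seq (.arith .add 8 8 9) <| .seq (.arith .sub 9 2 23) <|
  .seq (.arith .add 8 8 9) <| .seq (.arith .add 8 8 4) (.load 8 8)

/-- Subtracting the counters from `n + 1` turns loops that run down into indices that run up, as
required by the order of the output. -/
theorem HasTable.lookup (h : HasTable n d TB x y T s) {a b : ℕ} (ha : s.reg 21 = n + 1 - a)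
    (hb : s.reg 23 = n + 1 - b) (han : a ≤ n) (hbn : b ≤ n) (hx : (x + 1) * (n + 1) ≤ d)
    (hy : (y + 1) * (n + 1) ≤ d) (hW : TB + d * d + d + x + y ≤ W) :
    Terminates W (lookup x y) s 12 [] fun s' => HasTable n d TB x y T s' ∧
      s'.reg 8 = (if T a b then 1 else 0) ∧ ∀ r, r ≠ 8 → r ≠ 9 → s'.reg r = s.reg r := by
  have ha' : n + 1 - s.reg 21 = a := by omega
  have hb' : n + 1 - s.reg 23 = b := by omega
  have hxa : x * (n + 1) + a < d := by rw [Nat.succ_mul] at hx; omega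
  have hyb : y * (n + 1) + b < d := by rw [Nat.succ_mul] at hy; omega
  have hlt := table_index_lt hxa hyb
  refine Terminates.mono (T₁ := 1 + (1 + (1 + (1 + (1 + (1 + (1 + (1 + (1 + (1 + (1 + 1)))))))))))
    (Terminates.const_seq (by omega) (Terminates.arith_seq ?_ (Terminates.arith_seq ?_
    (Terminates.arith_seq ?_ (Terminates.arith_seq ?_ (Terminates.const_seq (by omega)
    (Terminates.arith_seq ?_ (Terminates.arith_seq ?_ (Terminates.arith_seq ?_
    (Terminates.arith_seq ?_ (Terminates.arith_seq ?_ (Terminates.load ⟨?_, ?_, ?_⟩)))))))))))) le_rfl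
    fun _ => id
  all_goals try simp (disch := omega) only [Op.eval, State.setReg_reg, State.setReg_mem,
    Function.update_self, Function.update_of_ne, h.numSucc, h.dom, h.table, ha', hb']
  · omega
  · omega
  · omega
  · omega
  · omega
  · omega
  · omega
  · omega
  · omega
  · iterate 12 refine HasTable.setReg ?_ _ _ (by simp)
    exact h
  · rw [← h.entry a han b hbn]
    congr 1
    omega
  · intro r h8 h9
    simp only [Function.update_of_ne h8, Function.update_of_ne h9]

/-- Run `P` for all pairs of values of the registers `21` and `23` between `reg c` and `1`. -/
def scan (c : ℕ) (P : Prog) : Prog :=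
  .seq (.arith .add 21 c 12) (countdown 21 (.seq (.arith .add 23 c 12) (countdown 23 P)))

theorem getElem_down (n i : ℕ) (h : i < (down n).length) : (down n)[i] = n - i := by
  induction n generalizing i with
  | zero => simp [down] at h
  | succ n ih =>
    cases i with
    | zero => simp [down]
    | succ i =>
      simp only [down, List.getElem_cons_succ]
      rw [ih]
      omega

theorem down_eq_map (n : ℕ) : down n = (List.finRange n).map fun i : Fin n => n - (i : ℕ) := by
  refine List.ext_getElem (by simp [length_down]) fun i h1 h2 => ?_
  rw [getElem_down]
  simp

/-- Output the part of the table with positive indices. -/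
def printProg (x y : ℕ) : Prog :=
  scan 1 (.seq (lookup x y) (.output [8]))

/-- Scanning from register `1`, which holds `n`, visits the indices `1, …, n`. The shift by one
matches matrix indices starting at `0`, color values starting at `1`. -/
theorem HasTable.print (h : HasTable n d TB x y T s) (hx : (x + 1) * (n + 1) ≤ d)
    (hy : (y + 1) * (n + 1) ≤ d) (hW : TB + d * d + d + x + y ≤ W) :
    Terminates W (printProg x y) s (20 * (n + 1) ^ 2)
      ((List.finRange n).flatMap fun i : Fin n => (List.finRange n).map fun j =>
        [if T (i.1 + 1) (j.1 + 1) then 1 else 0]) fun _ => True := by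
  have hnW : n ≤ W := by rw [Nat.succ_mul] at hx; omega
  have inner : ∀ a s, HasTable n d TB x y T s → 1 ≤ a → a ≤ n → s.reg 21 = n + 1 - a →
      Terminates W (.seq (.arith .add 23 1 12)
        (countdown 23 (.seq (RAM.lookup x y) (.output [8])))) s (1 + (n * (13 + 2) + 1))
        ((List.finRange n).map fun j : Fin n => [if T a (j.1 + 1) then 1 else 0])
        fun s' => HasTable n d TB x y T s' ∧ s'.reg 21 = n + 1 - a := by
    intro a s h ha1 han ha
    have hloop := Terminates.countdown (W := W) (c := 23) (Tb := 12 + 1)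
      (P := .seq (RAM.lookup x y) (.output [8]))
      (o := fun r => [[if T a (n + 1 - r) then 1 else 0]])
      (I := fun r s => r ≤ n ∧ HasTable n d TB x y T s ∧ s.reg 21 = n + 1 - a) (by
        rintro r s ⟨hr, h, ha⟩ hs
        refine Terminates.seq (o₁ := []) ((h.lookup (a := a) (b := n - r) ha (by omega) han (by omega)
          hx hy hW).mono le_rfl ?_)
        rintro s' ⟨h1, h2, h3⟩
        have e : n + 1 - (r + 1) = n - r := by omega
        obtain ⟨t, f, e1, e2, e3, rfl⟩ :=
          Terminates.output (W := W) (rs := [8]) (s := s') (Q := (· = s')) rfl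
        refine ⟨t, f, e1, e2, ?_, ?_, h1.one, by omega, h1.setReg _ _ (by simp), ?_⟩
        · rw [e3, e, List.map_singleton, h2]
        · rw [h3 23 (by omega) (by omega), hs]
        · simp (disch := omega) only [State.setReg_reg, Function.update_of_ne, h3 21, ha]) n
        (s.setReg 23 n) ⟨le_rfl, h.setReg _ _ (by simp), by
          simp (disch := omega) only [State.setReg_reg, Function.update_of_ne, ha]⟩ (by simp) hnW
    have e : (down n).flatMap (fun r => [[if T a (n + 1 - r) then 1 else 0]]) =
        (List.finRange n).map fun j : Fin n => [if T a (j.1 + 1) then 1 else 0] := by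
      rw [down_eq_map, List.flatMap_map, List.map_eq_flatMap]
      refine List.flatMap_congr fun j _ => ?_
      have : n + 1 - (n - (j : ℕ)) = j + 1 := by have := j.2; omega
      rw [this]
    rw [e] at hloop
    refine Terminates.arith_seq (by simpa [Op.eval, h.num, h.zero] using hnW) ?_
    have e' : Op.add.eval (s.reg 1) (s.reg 12) = n := by simp [Op.eval, h.num, h.zero]
    rw [e']
    exact hloop.mono le_rfl fun f hf => hf.2.2
  have hloop := Terminates.countdown (W := W) (c := 21) (Tb := 1 + (n * (13 + 2) + 1))
    (P := .seq (.arith .add 23 1 12) (countdown 23 (.seq (RAM.lookup x y) (.output [8]))))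
    (o := fun r => (List.finRange n).map fun j : Fin n => [if T (n + 1 - r) (j.1 + 1) then 1 else 0])
    (I := fun r s => r ≤ n ∧ HasTable n d TB x y T s) (by
      rintro r s ⟨hr, h⟩ hs
      have e : n + 1 - (r + 1) = n - r := by omega
      rw [e]
      refine (inner (n - r) s h (by omega) (by omega) (by omega)).mono le_rfl ?_
      rintro s' ⟨h1, h2⟩
      exact ⟨by omega, h1.one, by omega, h1.setReg _ _ (by simp)⟩) n
      (s.setReg 21 n) ⟨le_rfl, h.setReg _ _ (by simp)⟩ (by simp) hnW
  have e : (down n).flatMap (fun r => (List.finRange n).map fun j : Fin n =>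
      [if T (n + 1 - r) (j.1 + 1) then 1 else 0]) = (List.finRange n).flatMap fun i : Fin n =>
        (List.finRange n).map fun j : Fin n => [if T (i.1 + 1) (j.1 + 1) then 1 else 0] := by
    rw [down_eq_map, List.flatMap_map]
    refine List.flatMap_congr fun j _ => ?_
    have : n + 1 - (n - (j : ℕ)) = j + 1 := by have := j.2; omega
    rw [this]
  rw [e] at hloop
  have e' : Op.add.eval (s.reg 1) (s.reg 12) = n := by simp [Op.eval, h.num, h.zero]
  refine Terminates.mono (T₁ := 1 + (n * (1 + (n * (13 + 2) + 1) + 2) + 1))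
    (Terminates.arith_seq (by rw [e']; exact hnW) (by rw [e']; exact hloop)) ?_ fun _ _ => trivial
  nlinarith

/-- Output whether the table has a nonzero entry. -/
def anyProg (x y : ℕ) : Prog :=
  .seq (.const 10 0) (.seq (scan 2 (.seq (lookup x y) (.ite 8 (.const 10 1) .skip))) (.output [10]))

theorem HasTable.any (h : HasTable n d TB x y T s) (hx : (x + 1) * (n + 1) ≤ d)
    (hy : (y + 1) * (n + 1) ≤ d) (hW : TB + d * d + d + x + y + 1 ≤ W) (p : Prop) [Decidable p]
    (hp : p ↔ ∃ a ≤ n, ∃ b ≤ n, T a b) :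
    Terminates W (anyProg x y) s (30 * (n + 1) ^ 2) [[if p then 1 else 0]] fun _ => True := by
  have hnW : n + 1 ≤ W := by rw [Nat.succ_mul] at hx; omega
  -- All positions before `(i, j)` in lexicographic order have been searched: register `10` is `1`
  -- if one of them holds, and it is `1` only if `p` is true. The scan starts from `n + 1`, so index
  -- `0` is included: a free variable with a dummy color has value `0`.
  let J : ℕ → ℕ → State → Prop := fun i j s =>
    HasTable n d TB x y T s ∧ (s.reg 10 = 0 ∨ s.reg 10 = 1 ∧ p) ∧
      ∀ a b, a ≤ n → b ≤ n → (a < i ∨ a = i ∧ b < j) → T a b → s.reg 10 = 1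
  have hJset : ∀ i j s r v, J i j s → r ∉ [0, 1, 2, 3, 4, 10, 12] → J i j (s.setReg r v) := by
    rintro i j s r v ⟨h1, h2, h3⟩ hr
    simp only [List.mem_cons, List.not_mem_nil, or_false, not_or] at hr
    have : (s.setReg r v).reg 10 = s.reg 10 := by
      simp (disch := omega) only [State.setReg_reg, Function.update_of_ne]
    refine ⟨h1.setReg _ _ (by simp; omega), ?_, ?_⟩
    · rwa [this]
    · rwa [this]
  have inner : ∀ a s, J a 0 s → a ≤ n → s.reg 21 = n + 1 - a →
      Terminates W (.seq (.arith .add 23 2 12)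
        (countdown 23 (.seq (RAM.lookup x y) (.ite 8 (.const 10 1) .skip)))) s
        (1 + ((n + 1) * (14 + 2) + 1)) []
        fun s' => J (a + 1) 0 s' ∧ s'.reg 21 = n + 1 - a := by
    intro a s h han ha
    have hloop := Terminates.countdown_silent (W := W) (c := 23) (Tb := 12 + (1 + 1))
      (P := .seq (RAM.lookup x y) (.ite 8 (.const 10 1) .skip))
      (I := fun r s => r ≤ n + 1 ∧ J a (n + 1 - r) s ∧ s.reg 21 = n + 1 - a) (by
        rintro r s ⟨hr, ⟨h, h', h''⟩, ha⟩ hs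
        refine Terminates.seq_silent ((h.lookup (a := a) (b := n - r) ha (by omega) han (by omega)
          hx hy (by omega)).mono le_rfl ?_)
        rintro s' ⟨h1, h2, h3⟩
        have e : n + 1 - (r + 1) = n - r := by omega
        rw [e] at h''
        have h21 := (h3 21 (by omega) (by omega)).trans ha
        have h23 := (h3 23 (by omega) (by omega)).trans hs
        have h10 := h3 10 (by omega) (by omega)
        refine Terminates.ite (fun h8 => Terminates.const (by omega) ⟨?_, ?_, by omega, ?_, ?_⟩)
          fun h8 => Terminates.skip ⟨h23, h1.one, by omega, ?_, ?_⟩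
        · simp (disch := omega) only [State.setReg_reg, Function.update_of_ne, h23]
        · simp (disch := omega) only [State.setReg_reg, Function.update_of_ne, h1.one]
        · refine hJset _ _ _ _ _ ⟨h1.setReg _ _ (by simp), .inr ⟨by simp, ?_⟩, by simp⟩ (by simp)
          rw [h2] at h8
          by_cases hT : T a (n - r)
          · exact hp.2 ⟨a, han, n - r, by omega, hT⟩
          · simp [hT] at h8
        · simp (disch := omega) only [State.setReg_reg, Function.update_of_ne, h21]
        · refine hJset _ _ _ _ _ ⟨h1, by rwa [h10], fun a' b' ha' hb' hab hT => ?_⟩ (by simp)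
          rw [h10]
          by_cases hab' : a' = a ∧ b' = n - r
          · obtain ⟨rfl, rfl⟩ := hab'
            simp [hT] at h2
            omega
          · exact h'' a' b' ha' hb' (by omega) hT
        · simp (disch := omega) only [State.setReg_reg, Function.update_of_ne, h21]) (n + 1)
        (s.setReg 23 (n + 1)) ⟨le_rfl, by
          rw [Nat.sub_self]
          exact hJset _ _ _ _ _ h (by simp), by
          simp (disch := omega) only [State.setReg_reg, Function.update_of_ne, ha]⟩ (by simp) hnW
    have e' : Op.add.eval (s.reg 2) (s.reg 12) = n + 1 := by
      simp [Op.eval, h.1.numSucc, h.1.zero]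
    refine Terminates.arith_seq (by rw [e']; exact hnW) ?_
    rw [e']
    refine hloop.mono le_rfl ?_
    rintro f ⟨-, -, ⟨h1, h2, h3⟩, h4⟩
    exact ⟨⟨h1, h2, fun a' b' ha' hb' hab => h3 a' b' ha' hb' (by omega)⟩, h4⟩
  have hloop := Terminates.countdown_silent (W := W) (c := 21)
    (Tb := 1 + ((n + 1) * (14 + 2) + 1))
    (P := .seq (.arith .add 23 2 12)
      (countdown 23 (.seq (RAM.lookup x y) (.ite 8 (.const 10 1) .skip))))
    (I := fun r s => r ≤ n + 1 ∧ J (n + 1 - r) 0 s) (by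
      rintro r s ⟨hr, h⟩ hs
      have e : n + 1 - (r + 1) = n - r := by omega
      have e' : n + 1 - r = n - r + 1 := by omega
      rw [e] at h
      refine (inner (n - r) s h (by omega) (by omega)).mono le_rfl ?_
      rintro s' ⟨h1, h2⟩
      rw [e']
      exact ⟨by omega, h1.1.one, by omega, hJset _ _ _ _ _ h1 (by simp)⟩) (n + 1)
      ((s.setReg 10 0).setReg 21 (n + 1)) ⟨le_rfl, by
        rw [Nat.sub_self]
        exact hJset _ _ _ _ _ ⟨h.setReg _ _ (by simp), .inl (by simp), by omega⟩ (by simp)⟩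
      (by simp) hnW
  have e' : Op.add.eval ((s.setReg 10 0).reg 2) ((s.setReg 10 0).reg 12) = n + 1 := by
    simp [Op.eval, h.numSucc, h.zero]
  have hscan : Terminates W (scan 2 (.seq (RAM.lookup x y) (.ite 8 (.const 10 1) .skip)))
      (s.setReg 10 0) (1 + ((n + 1) * (1 + ((n + 1) * (14 + 2) + 1) + 2) + 1)) []
      fun s' => s'.reg 10 = if p then 1 else 0 := by
    refine Terminates.arith_seq (by rw [e']; exact hnW) ?_
    rw [e']
    refine hloop.mono le_rfl ?_
    rintro f ⟨-, -, h1, h2, h3⟩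
    by_cases hpp : p
    · obtain ⟨a, ha, b, hb, hT⟩ := hp.1 hpp
      rw [if_pos hpp]
      exact h3 a b ha hb (by omega) hT
    · rw [if_neg hpp]
      exact h2.resolve_right fun h => hpp h.2
  refine Terminates.mono (T₁ := 1 + ((1 + ((n + 1) * (1 + ((n + 1) * (14 + 2) + 1) + 2) + 1)) + 1))
    (Terminates.const_seq (by omega) (Terminates.seq_silent (hscan.mono le_rfl fun s' hs' => ?_)))
    (by nlinarith) fun _ => id
  rw [← hs']
  exact Terminates.output trivial

end Table

end RAM

/-! ### From the table to programs for the conjectured hard problems -/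

namespace CQ.Query

open RAM

variable {σ : Schema} {q : Query σ 2} {col : Fin q.numVars → ℕ}
  {vars : Atom σ (Fin q.numVars) → List ℕ} {test : Atom σ (Fin q.numVars) → Option ℕ}
  {k e : ℕ}

/-- Converts the time bound to the form used in the conjectures; the summand `1` takes care of `n =
0`. -/
theorem succ_pow_le (n e : ℕ) : (n + 1) ^ e ≤ 2 ^ e * (n ^ e + 1) := by
  rcases Nat.eq_zero_or_pos n with rfl | hn
  · rw [zero_add, one_pow]
    exact Nat.mul_pos (Nat.pow_pos (by omega)) (Nat.succ_pos _)
  · calc (n + 1) ^ e ≤ (2 * n) ^ e := Nat.pow_le_pow_left (by omega) e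
      _ = 2 ^ e * n ^ e := mul_pow _ _ _
      _ ≤ _ := Nat.mul_le_mul_left _ (by omega)

-- The part common to both reductions. They differ only in the coloring, the input word, and the
-- program `R` that evaluates the block of the table belonging to the two free variables.
open Classical in
theorem Coloring.exists_program (hc : q.Coloring k e col vars test) (he : 2 ≤ e)
    (hmin : q.IsMinimal) (hq : q.HasLinearPreprocessingConstantDelay) (R : ℕ → ℕ → Prog)
    (out : ℕ → (ℕ → ℕ → Prop) → List (List ℕ))
    (hR : ∀ (n d TB x y W : ℕ) (T : ℕ → ℕ → Prop) (s : State), HasTable n d TB x y T s →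
      (x + 1) * (n + 1) ≤ d → (y + 1) * (n + 1) ≤ d → TB + d * d + d + x + y + 1 ≤ W →
      (∀ a b, T a b → a ≤ n ∧ b ≤ n) →
      Terminates W (R x y) s (30 * (n + 1) ^ 2) (out n T) fun _ => True) :
    ∃ (P : Prog) (c : ℕ), ∀ (n : ℕ) (w : List ℕ), w.getD 0 0 = n → w.length ≤ tableAddr n e →
      Computes ((n + 2) ^ c) P w (c * (n ^ e + 1)) (out n fun a b =>
        ∃ u, q.Valid col vars test k n (n ^ e) (fun p => w.getD p 0) u ∧
          u (col (q.free 0)) = a ∧ u (col (q.free 1)) = b) := by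
  obtain ⟨P, K, hP⟩ := hc.exists_table he hmin hq
  obtain ⟨v, hv⟩ : ∃ v, v = q.numVars := ⟨_, rfl⟩
  set C := 4 + 2 * (v * v) + 2 * v with hC
  set x : ℕ := (q.free 0).1 with hx
  set y : ℕ := (q.free 1).1 with hy
  have hxv : x < v := hv ▸ (q.free 0).2
  have hyv : y < v := hv ▸ (q.free 1).2
  refine ⟨.seq P (R x y), (K + 30) * 2 ^ e + K + e + C, fun n w hn hw => ?_⟩
  set c := (K + 30) * 2 ^ e + K + e + C with hcc
  have h1 : (n + 1) ^ 2 ≤ (n + 1) ^ e := Nat.pow_le_pow_right (by omega) he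
  have h2 : (n + 1) ^ e ≤ (n + 2) ^ e := Nat.pow_le_pow_left (by omega) e
  have h3 : (n + 2) ^ K ≤ (n + 2) ^ c := Nat.pow_le_pow_right (by omega) (by omega)
  have h4 : C * (n + 2) ^ e ≤ (n + 2) ^ c :=
    (pow_bound _ _ _ (by omega)).trans (Nat.pow_le_pow_right (by omega) (by omega))
  obtain ⟨d, hd⟩ : ∃ d, d = v * (n + 1) := ⟨_, rfl⟩
  have hdd : d * d ≤ v * v * (n + 2) ^ e := by
    calc d * d = v * v * (n + 1) ^ 2 := by rw [hd]; ring
      _ ≤ _ := Nat.mul_le_mul_left _ (h1.trans h2)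
  have hd1 : d ≤ d * d := Nat.le_mul_self d
  have hv1 : v ≤ v * (n + 2) ^ e := Nat.le_mul_of_pos_right _ (Nat.pow_pos (by omega))
  have hpos : 1 ≤ (n + 2) ^ e := Nat.pow_pos (by omega)
  have hCe : C * (n + 2) ^ e = 4 * (n + 2) ^ e + 2 * (v * v * (n + 2) ^ e) +
      2 * (v * (n + 2) ^ e) := by rw [hC]; ring
  have hTB : tableAddr n e = 2 * (n + 1) ^ e + 1 := rfl
  have hrun := hP n ((n + 2) ^ c) w hn hw h3
  rw [← hv, ← hd] at hrun
  have hmain : Terminates ((n + 2) ^ c) (.seq P (R x y)) (State.init w)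
      (K * (n + 1) ^ e + 30 * (n + 1) ^ 2) ([] ++ out n fun a b =>
        ∃ u, q.Valid col vars test k n (n ^ e) (fun p => w.getD p 0) u ∧
          u (col (q.free 0)) = a ∧ u (col (q.free 1)) = b) fun _ => True := by
    refine Terminates.seq (hrun.mono le_rfl ?_)
    rintro s ⟨s₀, L, hs, hL⟩
    refine hR n d (tableAddr n e) x y _ _ s ⟨hs.one, hs.num, hs.numSucc, hs.dom, hs.table, hs.zero,
      fun a ha b hb => ?_⟩ (hd ▸ Nat.mul_le_mul_right _ hxv) (hd ▸ Nat.mul_le_mul_right _ hyv)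
      (by omega) ?_
    · have ex : (x + 1) * (n + 1) ≤ d := hd ▸ Nat.mul_le_mul_right _ hxv
      have ey : (y + 1) * (n + 1) ≤ d := hd ▸ Nat.mul_le_mul_right _ hyv
      rw [Nat.succ_mul] at ex ey
      rw [hs.entry _ (by omega) _ (by omega)]
      simp only [hL a b ha hb]
    · rintro a b ⟨u, hu, rfl, rfl⟩
      exact ⟨hu.le _, hu.le _⟩
  obtain ⟨t, f, e1, e2, e3, -⟩ := hmain
  refine ⟨t, f, e1, e2.trans ?_, e3⟩
  calc K * (n + 1) ^ e + 30 * (n + 1) ^ 2 ≤ (K + 30) * (n + 1) ^ e := by rw [Nat.add_mul]; omega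
    _ ≤ (K + 30) * (2 ^ e * (n ^ e + 1)) := Nat.mul_le_mul_left _ (succ_pow_le n e)
    _ = (K + 30) * 2 ^ e * (n ^ e + 1) := by rw [mul_assoc]
    _ ≤ c * (n ^ e + 1) := Nat.mul_le_mul_right _ (by omega)

/-! ### Lists of entries -/

theorem getElem?_flatMap_uniform {α β : Type} {f : α → List β} {N : ℕ} (l : List α)
    (hl : ∀ a ∈ l, (f a).length = N) (i : ℕ) {j : ℕ} (hj : j < N) :
    (l.flatMap f)[i * N + j]? = l[i]?.bind fun a => (f a)[j]? := by
  induction l generalizing i with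
  | nil => simp
  | cons a l ih =>
    have ha := hl a List.mem_cons_self
    rw [List.flatMap_cons]
    cases i with
    | zero =>
      rw [zero_mul, zero_add, List.getElem?_append_left (by omega)]
      rfl
    | succ i =>
      rw [List.getElem?_append_right (by rw [ha, Nat.succ_mul]; omega), ha, Nat.succ_mul,
        add_right_comm, Nat.add_sub_cancel, ih fun a ha => hl a (List.mem_cons_of_mem _ ha)]
      rfl

theorem length_flatMap_uniform {α β : Type} {f : α → List β} {N : ℕ} (l : List α)
    (hl : ∀ a ∈ l, (f a).length = N) : (l.flatMap f).length = l.length * N := by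
  induction l with
  | nil => simp
  | cons a l ih =>
    rw [List.flatMap_cons, List.length_append, hl a List.mem_cons_self,
      ih fun a ha => hl a (List.mem_cons_of_mem _ ha), List.length_cons, Nat.succ_mul, add_comm]

open Conjectures

theorem length_entries {n : ℕ} (A : Matrix (Fin n) (Fin n) Bool) :
    (entries A).length = n * n := by
  rw [entries, length_flatMap_uniform (N := n) _ (by simp)]
  simp

theorem getElem?_entries {n : ℕ} (A : Matrix (Fin n) (Fin n) Bool) (i j : Fin n) :
    (entries A)[(i * n + j : ℕ)]? = some (A i j).toNat := by
  rw [entries, getElem?_flatMap_uniform (N := n) _ (by simp) _ j.2]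
  simp

theorem length_tuples (n m : ℕ) : (tuples n m).length = n ^ m := by
  induction m with
  | zero => rfl
  | succ m ih =>
    rw [tuples, length_flatMap_uniform (N := n ^ m) _ (by simp [ih]), List.length_finRange,
      pow_succ, mul_comm]

theorem encodeFrom_eq (n : ℕ) (u : ℕ → ℕ) (a : ℕ) (cs : List ℕ) :
    encodeFrom n u a cs = a * n ^ cs.length + encodeFrom n u 0 cs := by
  induction cs generalizing a with
  | nil => simp [encodeFrom]
  | cons c cs ih =>
    have h : ∀ a, encodeFrom n u a (c :: cs) = encodeFrom n u (a * n + (u c - 1)) cs :=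
      fun _ => rfl
    rw [h, h, ih (a * n + _), ih (0 * n + _), List.length_cons, pow_succ]
    ring

/-- The number computed by Horner's scheme is the rank of the tuple in lexicographic order, so a
test reads the intended entry of the adjacency tensor. -/
theorem getElem?_tuples {n : ℕ} {u : ℕ → ℕ} (v : ℕ → Fin n) {cs : List ℕ}
    (hu : ∀ c ∈ cs, u c = v c + 1) :
    (tuples n cs.length)[encodeFrom n u 0 cs]? = some (cs.map v) := by
  induction cs with
  | nil => rfl
  | cons c cs ih =>
    have hcs : ∀ c ∈ cs, u c = v c + 1 := fun c hc => hu c (List.mem_cons_of_mem _ hc)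
    have h : encodeFrom n u 0 (c :: cs) = v c * n ^ cs.length + encodeFrom n u 0 cs := by
      rw [← encodeFrom_eq]
      change encodeFrom n u (0 * n + (u c - 1)) cs = _
      rw [hu c List.mem_cons_self]
      congr 1
      omega
    have hlt := encodeFrom_lt (n := n) (u := u) (cs := cs) (a := 0) (j := 0)
      (fun c hc => by have := hcs c hc; have := (v c).2; omega) (by simp)
    rw [zero_add] at hlt
    rw [h, List.length_cons, tuples, getElem?_flatMap_uniform (N := n ^ cs.length) _
      (by simp [length_tuples]) _ hlt]
    simp [ih hcs]

theorem getD_adjacency {n : ℕ} {u : ℕ → ℕ} (v : ℕ → Fin n) {cs : List ℕ} {m : ℕ}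
    (hm : cs.length = m) (hu : ∀ c ∈ cs, u c = v c + 1) (E : Finset (Finset (Fin n))) :
    (adjacency m E).getD (encodeFrom n u 0 cs) 0 ≠ 0 ↔ (cs.map v).toFinset ∈ E := by
  subst hm
  rw [List.getD_eq_getElem?_getD, adjacency, List.getElem?_map, getElem?_tuples v hu]
  simp

end CQ.Query

/-! ## The reductions -/

namespace CQ.Query

open RAM Conjectures

variable {σ : Schema}

/-! ### Reduction from hyperclique detection -/

section Hyperclique

variable {r : ℕ} {q : Query σ r} {M : Finset (Fin q.numVars)} {C : Set (Fin q.numVars)}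

open Classical in
/-- Each element of `M` has its own color; the elements of `C` have color `M.card`. -/
noncomputable def cliqueColor (M : Finset (Fin q.numVars)) (C : Set (Fin q.numVars))
    (v : Fin q.numVars) : ℕ :=
  if h : v ∈ M then (M.equivFin ⟨v, h⟩ : ℕ) else if v ∈ C then M.card else M.card + 1

open Classical in
/-- The colors of an atom. -/
noncomputable def cliqueVars (M : Finset (Fin q.numVars)) (C : Set (Fin q.numVars))
    (A : Atom σ (Fin q.numVars)) : List ℕ :=
  (List.range (M.card + 1)).filter fun c => ∃ v ∈ A.vars, cliqueColor M C v = c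

/-- Atoms that have all colors but one are tested. -/
noncomputable def cliqueTest (M : Finset (Fin q.numVars)) (C : Set (Fin q.numVars))
    (A : Atom σ (Fin q.numVars)) : Option ℕ :=
  if (cliqueVars M C A).length = M.card then some 0 else none

theorem mem_cliqueVars {A : Atom σ (Fin q.numVars)} {c : ℕ} :
    c ∈ cliqueVars M C A ↔ c < M.card + 1 ∧ ∃ v ∈ A.vars, cliqueColor M C v = c := by
  simp [cliqueVars]

theorem nodup_cliqueVars (A : Atom σ (Fin q.numVars)) : (cliqueVars M C A).Nodup :=
  List.nodup_range.filter _

theorem cliqueColor_lt {v : Fin q.numVars} (h : v ∈ M) : cliqueColor M C v < M.card := by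
  rw [cliqueColor, dif_pos h]
  exact (M.equivFin ⟨v, h⟩).2

theorem cliqueColor_inj {v v' : Fin q.numVars} (h : v ∈ M) (h' : v' ∈ M)
    (hv : cliqueColor M C v = cliqueColor M C v') : v = v' := by
  rw [cliqueColor, cliqueColor, dif_pos h, dif_pos h'] at hv
  exact congrArg Subtype.val (M.equivFin.injective (Fin.ext hv))

theorem exists_cliqueColor {c : ℕ} (hc : c < M.card) : ∃ v ∈ M, cliqueColor M C v = c := by
  refine ⟨M.equivFin.symm ⟨c, hc⟩, (M.equivFin.symm ⟨c, hc⟩).2, ?_⟩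
  rw [cliqueColor, dif_pos (M.equivFin.symm ⟨c, hc⟩).2]
  simp

theorem cliqueColor_eq_card {v : Fin q.numVars} (hM : v ∉ M) (hC : v ∈ C) :
    cliqueColor M C v = M.card := by
  rw [cliqueColor, dif_neg hM, if_pos hC]

theorem mem_of_cliqueColor_eq {v : Fin q.numVars} (h : cliqueColor M C v = M.card) : v ∈ C := by
  by_cases hM : v ∈ M
  · exact absurd h (cliqueColor_lt hM).ne
  · by_contra hC
    rw [cliqueColor, dif_neg hM, if_neg hC] at h
    omega

theorem mem_of_cliqueColor_lt {v : Fin q.numVars} (h : cliqueColor M C v < M.card) : v ∈ M := by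
  by_contra hM
  rw [cliqueColor, dif_neg hM] at h
  split_ifs at h <;> omega

/-- The hypergraph of a query. -/
def edges (q : Query σ r) : q.atoms → Set (Fin q.numVars) := fun A => A.1.vars

variable (h : CyclePattern q.edges M C)

include h

/-- An atom with color `M.card` meets `C`, so by `not_cover` it misses an element of `M` and hence
its color. No atom has all colors, which keeps the database within `O((n + 1) ^ M.card)` facts. -/
theorem length_cliqueVars_le {A : Atom σ (Fin q.numVars)} (hA : A ∈ q.atoms) :
    (cliqueVars M C A).length ≤ M.card := by
  classical
  obtain ⟨c, hc, hcA⟩ : ∃ c, c < M.card + 1 ∧ c ∉ cliqueVars M C A := by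
    by_contra hcon
    push Not at hcon
    obtain ⟨-, v, hv, hvC⟩ := mem_cliqueVars.1 (hcon M.card (by omega))
    obtain ⟨m, hm, hmA⟩ := h.not_cover ⟨A, hA⟩ v (mem_of_cliqueColor_eq hvC) hv
    obtain ⟨-, v', hv', hvm⟩ :=
      mem_cliqueVars.1 (hcon (cliqueColor M C m) (by have := cliqueColor_lt (C := C) hm; omega))
    have : v' ∈ M := mem_of_cliqueColor_lt (hvm ▸ cliqueColor_lt hm)
    exact hmA (cliqueColor_inj this hm hvm ▸ hv')
  have h1 : (cliqueVars M C A).toFinset ⊆ (Finset.range (M.card + 1)).erase c := by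
    intro c' hc'
    rw [List.mem_toFinset] at hc'
    refine Finset.mem_erase.2 ⟨fun h => hcA (h ▸ hc'), ?_⟩
    exact Finset.mem_range.2 (mem_cliqueVars.1 hc').1
  have h2 := Finset.card_le_card h1
  rwa [List.toFinset_card_of_nodup (nodup_cliqueVars A),
    Finset.card_erase_of_mem (Finset.mem_range.2 hc), Finset.card_range] at h2

/-- For `c = M.card` the atom comes from `cover`, for the other colors from `cover_erase`. Thus
every set of `M.card` colors is tested by some atom. -/
theorem exists_cliqueVars {c : ℕ} (hc : c < M.card + 1) : ∃ A ∈ q.atoms,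
    (cliqueVars M C A).length = M.card ∧
      ∀ c', c' ∈ cliqueVars M C A ↔ c' < M.card + 1 ∧ c' ≠ c := by
  classical
  obtain ⟨A, hA, hAc⟩ : ∃ A ∈ q.atoms, ∀ c' < M.card + 1, c' ≠ c → c' ∈ cliqueVars M C A := by
    rcases Nat.lt_succ_iff_lt_or_eq.1 hc with hc | rfl
    · obtain ⟨m, hm, rfl⟩ := exists_cliqueColor (C := C) hc
      obtain ⟨⟨A, hA⟩, ⟨v, hv, hvA⟩, hM⟩ := h.cover_erase m hm
      refine ⟨A, hA, fun c' hc' hne => mem_cliqueVars.2 ⟨hc', ?_⟩⟩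
      rcases Nat.lt_succ_iff_lt_or_eq.1 hc' with hc' | rfl
      · obtain ⟨m', hm', rfl⟩ := exists_cliqueColor (C := C) hc'
        exact ⟨m', hM m' hm' fun h => hne (h ▸ rfl), rfl⟩
      · exact ⟨v, hvA, cliqueColor_eq_card (fun h' => h.disjoint v h' hv) hv⟩
    · obtain ⟨⟨A, hA⟩, hM⟩ := h.cover
      refine ⟨A, hA, fun c' hc' hne => mem_cliqueVars.2 ⟨hc', ?_⟩⟩
      obtain ⟨m', hm', rfl⟩ := exists_cliqueColor (C := C) (M := M) (c := c') (by omega)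
      exact ⟨m', hM m' hm', rfl⟩
  have hle := length_cliqueVars_le h hA
  have h1 : (Finset.range (M.card + 1)).erase c ⊆ (cliqueVars M C A).toFinset := by
    intro c' hc'
    rw [Finset.mem_erase, Finset.mem_range] at hc'
    exact List.mem_toFinset.2 (hAc c' hc'.2 hc'.1)
  have hcard : ((Finset.range (M.card + 1)).erase c).card = M.card := by
    rw [Finset.card_erase_of_mem (Finset.mem_range.2 hc), Finset.card_range, Nat.add_sub_cancel]
  have hlen := List.toFinset_card_of_nodup (nodup_cliqueVars (M := M) (C := C) A)
  have h2 := Finset.eq_of_subset_of_card_le h1 (by omega)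
  refine ⟨A, hA, by rw [← hlen, ← h2, hcard], fun c' => ?_⟩
  rw [← List.mem_toFinset, ← h2, Finset.mem_erase, Finset.mem_range, and_comm]

theorem coloring_clique : q.Coloring (M.card + 1) M.card (cliqueColor M C) (cliqueVars M C)
    (cliqueTest M C) where
  nodup A _ := nodup_cliqueVars A
  mem_vars A _ c := mem_cliqueVars
  length_le A hA := length_cliqueVars_le h hA
  test_le A _ b hb := by
    unfold cliqueTest at hb
    split_ifs at hb
    · cases hb; omega
    · cases hb
  test_length A _ b hb := by
    unfold cliqueTest at hb
    split_ifs at hb with h1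
    · exact h1
    · cases hb
  connected φ hφ v v' hvv hv := by
    rcases Nat.lt_succ_iff_lt_or_eq.1 hv with h1 | h1
    · have h2 : cliqueColor M C v' < M.card := hvv ▸ h1
      rw [cliqueColor_inj (mem_of_cliqueColor_lt h1) (mem_of_cliqueColor_lt h2) hvv]
    · refine h.connected φ (fun A w hw w' hw' hwA hwA' => ?_) v (mem_of_cliqueColor_eq h1) v'
        (mem_of_cliqueColor_eq (hvv ▸ h1))
      have hM : ∀ w ∈ C, w ∉ M := fun w hw hwM => h.disjoint w hwM hw
      refine hφ A.1 A.2 w hwA w' hwA' ?_ ?_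
      · rw [cliqueColor_eq_card (hM w hw) hw, cliqueColor_eq_card (hM w' hw') hw']
      · rw [cliqueColor_eq_card (hM w hw) hw]; omega
  surj c hc := by
    -- An atom that lacks only another color contains `c`; in particular `C` is nonempty.
    obtain ⟨c', hc', hne⟩ : ∃ c' < M.card + 1, c ≠ c' := by
      have := h.two_le
      by_cases h0 : c = 0
      · exact ⟨1, by omega, by omega⟩
      · exact ⟨0, by omega, by omega⟩
    obtain ⟨A, -, -, h1⟩ := exists_cliqueVars h hc'
    obtain ⟨-, v, -, hv⟩ := mem_cliqueVars.1 ((h1 c).2 ⟨hc, hne⟩)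
    exact ⟨v, hv⟩

/-- A valid assignment lists the vertices of a hyperclique by color. The offset `N` is arbitrary
because only the table with number `0` is tested. -/
theorem exists_valid_clique_iff {n : ℕ} (E : Finset (Finset (Fin n)))
    (hE : ∀ e ∈ E, e.card = M.card) (N : ℕ) :
    (∃ u, q.Valid (cliqueColor M C) (cliqueVars M C) (cliqueTest M C) (M.card + 1) n N
      (fun p => (n :: adjacency M.card E).getD p 0) u) ↔ HasHyperclique (M.card + 1) E := by
  classical
  have htwo := h.two_le
  have hpass : ∀ (u : ℕ → ℕ) (v : ℕ → Fin n), (∀ c < M.card + 1, u c = v c + 1) →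
      ∀ A : Atom σ (Fin q.numVars),
      ((q.template (cliqueColor M C) (cliqueVars M C) (cliqueTest M C) A).Passes
        (fun p => (n :: adjacency M.card E).getD p 0) n N u ↔
      ((cliqueVars M C A).length = M.card → ((cliqueVars M C A).map v).toFinset ∈ E)) := by
    intro u v huv A
    simp only [Template.Passes, template, cliqueTest]
    split_ifs with hl
    · rw [← getD_adjacency v hl (u := u) fun c hc => huv c (mem_cliqueVars.1 hc).1]
      simp [hl]
    · simp [hl]
  constructor
  · rintro ⟨u, hu⟩
    have hn : 0 < n := by
      have := hu.range 0 (by omega)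
      omega
    let v : ℕ → Fin n := fun c => ⟨(u c - 1) % n, Nat.mod_lt _ hn⟩
    have huv : ∀ c < M.card + 1, u c = v c + 1 := by
      intro c hc
      have := hu.range c hc
      simp only [v]
      rw [Nat.mod_eq_of_lt (by omega)]
      omega
    have hmem : ∀ c < M.card + 1, ∃ l : List ℕ, l.Nodup ∧
        (∀ c', c' ∈ l ↔ c' < M.card + 1 ∧ c' ≠ c) ∧ (l.map v).toFinset ∈ E ∧
        l.length = M.card := by
      intro c hc
      obtain ⟨A, hA, hl, h1⟩ := exists_cliqueVars h hc
      exact ⟨cliqueVars M C A, nodup_cliqueVars A, h1, (hpass u v huv A).1 (hu.passes A hA) hl, hl⟩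
    have hinj : Set.InjOn v (Finset.range (M.card + 1)) := by
      intro c hc c' hc' hcc
      rw [Finset.mem_coe, Finset.mem_range] at hc hc'
      by_contra hne
      -- There are at least three colors, so some tested atom contains both `c` and `c'`. Its
      -- `M.card` values form a hyperedge of size `M.card` and are therefore distinct.
      obtain ⟨c'', hc'', h1, h2⟩ : ∃ c'' < M.card + 1, c ≠ c'' ∧ c' ≠ c'' := by
        by_cases e0 : c = 0 ∨ c' = 0
        · by_cases e1 : c = 1 ∨ c' = 1
          · exact ⟨2, by omega, by omega, by omega⟩
          · exact ⟨1, by omega, by omega, by omega⟩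
        · exact ⟨0, by omega, by omega, by omega⟩
      obtain ⟨l, hl, h3, h4, h5⟩ := hmem c'' hc''
      have h6 := hE _ h4
      have h7 : (l.map v).Nodup := by
        rw [← Multiset.coe_nodup, ← Multiset.toFinset_card_eq_card_iff_nodup]
        rw [Multiset.coe_card, List.length_map, h5, ← h6]
        rfl
      exact hne (List.inj_on_of_nodup_map h7 ((h3 c).2 ⟨hc, h1⟩) ((h3 c').2 ⟨hc', h2⟩) hcc)
    have hcard : ((Finset.range (M.card + 1)).image v).card = M.card + 1 := by
      rw [Finset.card_image_of_injOn hinj, Finset.card_range]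
    refine ⟨(Finset.range (M.card + 1)).image v, hcard, fun T hT hTc => ?_⟩
    rw [Nat.add_sub_cancel] at hTc
    -- The subset `T` omits exactly one vertex; the atom that lacks the color of this vertex
    -- certifies that `T` is a hyperedge.
    obtain ⟨x, hx⟩ : ∃ x, (Finset.range (M.card + 1)).image v \ T = {x} := by
      rw [← Finset.card_eq_one, Finset.card_sdiff_of_subset hT, hcard, hTc]
      omega
    have hxS : x ∈ (Finset.range (M.card + 1)).image v \ T := hx ▸ Finset.mem_singleton_self x
    obtain ⟨hxS, hxT⟩ := Finset.mem_sdiff.1 hxS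
    obtain ⟨c, hc, rfl⟩ := Finset.mem_image.1 hxS
    obtain ⟨l, hl, h3, h4, h5⟩ := hmem c (Finset.mem_range.1 hc)
    convert h4
    refine (Finset.eq_of_subset_of_card_le (fun y hy => ?_) (by rw [hE _ h4, hTc])).symm
    rw [List.mem_toFinset, List.mem_map] at hy
    obtain ⟨c', hc', rfl⟩ := hy
    rw [h3] at hc'
    by_contra hyT
    have : v c' ∈ (Finset.range (M.card + 1)).image v \ T := Finset.mem_sdiff.2
      ⟨Finset.mem_image_of_mem _ (Finset.mem_range.2 hc'.1), hyT⟩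
    rw [hx, Finset.mem_singleton] at this
    exact hc'.2 (hinj (Finset.mem_coe.2 (Finset.mem_range.2 hc'.1)) (Finset.mem_coe.2 hc) this)
  · rintro ⟨S, hS, hSE⟩
    let f : Fin (M.card + 1) ≃ S := (S.equivFinOfCardEq hS).symm
    let v : ℕ → Fin n := fun c => f ⟨c % (M.card + 1), Nat.mod_lt _ (by omega)⟩
    let u : ℕ → ℕ := fun c => if c < M.card + 1 then v c + 1 else 0
    have huv : ∀ c < M.card + 1, u c = v c + 1 := fun c hc => if_pos hc
    have hvS : ∀ c, v c ∈ S := fun c => Subtype.coe_prop _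
    have hvinj : ∀ c < M.card + 1, ∀ c' < M.card + 1, v c = v c' → c = c' := by
      intro c hc c' hc' hcc
      have := congrArg Fin.val (f.injective (Subtype.ext hcc))
      simpa [Nat.mod_eq_of_lt hc, Nat.mod_eq_of_lt hc'] using this
    refine ⟨u, fun c hc => ?_, fun c hc => if_neg (by omega), fun A hA => ?_⟩
    · rw [huv c hc]
      have := (v c).2
      omega
    · refine (hpass u v huv A).2 fun hl => hSE _ (fun x hx => ?_) ?_
      · rw [List.mem_toFinset, List.mem_map] at hx
        obtain ⟨c, -, rfl⟩ := hx
        exact hvS c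
      · rw [List.toFinset_card_of_nodup, List.length_map, hl, Nat.add_sub_cancel]
        refine List.Nodup.map_on (fun c hc c' hc' hcc => ?_) (nodup_cliqueVars A)
        exact hvinj c (mem_cliqueVars.1 hc).1 c' (mem_cliqueVars.1 hc').1 hcc

end Hyperclique

/-- A minimal binary query whose hypergraph has a cycle pattern is hard. -/
theorem not_hasLinearPreprocessingConstantDelay_of_cyclePattern (hH : Hyperclique)
    {q : Query σ 2} (hmin : q.IsMinimal) {M : Finset (Fin q.numVars)}
    {C : Set (Fin q.numVars)} (h : CyclePattern q.edges M C) :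
    ¬ q.HasLinearPreprocessingConstantDelay := by
  classical
  intro hq
  have htwo := h.two_le
  obtain ⟨P, c, hP⟩ := (coloring_clique h).exists_program htwo hmin hq anyProg
    (fun (n : ℕ) (T : ℕ → ℕ → Prop) => [[if ∃ a ≤ n, ∃ b ≤ n, T a b then 1 else 0]])
    (fun n d TB x y W T s hs hx hy hW hT => by
      convert hs.any hx hy hW (∃ a ≤ n, ∃ b ≤ n, T a b) Iff.rfl)
  refine hH (M.card + 1) (by omega) ⟨P, c, fun n E hE => ?_⟩
  rw [Nat.add_sub_cancel] at hE ⊢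
  have h1 := hP n (n :: adjacency M.card E) rfl (by
    have : n ^ M.card ≤ (n + 1) ^ M.card := Nat.pow_le_pow_left (by omega) _
    simp only [List.length_cons, adjacency, List.length_map, length_tuples, tableAddr]
    omega)
  convert h1 using 5
  -- Only the existence of an answer matters: any valid assignment marks the table entry at its
  -- values for the two free variables.
  rw [← exists_valid_clique_iff h E hE (n ^ M.card)]
  constructor
  · rintro ⟨u, hu⟩
    exact ⟨_, hu.le _, _, hu.le _, u, hu, rfl, rfl⟩
  · rintro ⟨-, -, -, -, u, hu, -⟩
    exact ⟨u, hu⟩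

end CQ.Query

namespace CQ.Query

open RAM Conjectures

variable {σ : Schema}

/-! ### Reduction from Boolean matrix multiplication -/

section MatrixMultiplication

variable {q : Query σ 2} {C : Set (Fin q.numVars)}

open Classical in
/-- The free variables have colors `0` and `1`, the elements of `C` have color `2`. -/
noncomputable def productColor (C : Set (Fin q.numVars)) (v : Fin q.numVars) : ℕ :=
  if v = q.free 0 then 0 else if v = q.free 1 then 1 else if v ∈ C then 2 else 3

open Classical in
/-- The colors of an atom. -/
noncomputable def productVars (C : Set (Fin q.numVars)) (A : Atom σ (Fin q.numVars)) : List ℕ :=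
  [0, 2, 1].filter fun c => ∃ v ∈ A.vars, productColor C v = c

/-- Atoms with colors `0` and `2` are tested against the first matrix, atoms with colors `2` and `1`
against the second one. -/
noncomputable def productTest (C : Set (Fin q.numVars)) (A : Atom σ (Fin q.numVars)) : Option ℕ :=
  if productVars C A = [0, 2] then some 0 else if productVars C A = [2, 1] then some 1 else none

theorem mem_productVars {A : Atom σ (Fin q.numVars)} {c : ℕ} :
    c ∈ productVars C A ↔ c < 3 ∧ ∃ v ∈ A.vars, productColor C v = c := by
  classical
  have : c ∈ [0, 2, 1] ↔ c < 3 := by simp; omega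
  simp only [productVars, List.mem_filter, this, decide_eq_true_eq]

theorem productColor_eq_zero {v : Fin q.numVars} : productColor C v = 0 ↔ v = q.free 0 := by
  unfold productColor
  split_ifs with h1 h2 h3 <;> simp [h1]

theorem productColor_eq_one {v : Fin q.numVars} : productColor C v = 1 ↔ v = q.free 1 := by
  have h01 : q.free 0 ≠ q.free 1 := fun h => absurd (q.free_injective h) (by simp)
  unfold productColor
  split_ifs with h1 h2 h3
  · subst h1
    simpa using h01
  · simp [h2]
  · simp [h2]
  · simp [h2]

theorem productColor_eq_two (hC : ∀ i, q.free i ∉ C) {v : Fin q.numVars} :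
    productColor C v = 2 ↔ v ∈ C := by
  unfold productColor
  split_ifs with h1 h2 h3
  · subst h1
    simpa using hC 0
  · subst h2
    simpa using hC 1
  · simp [h3]
  · simp [h3]

variable (hC : ∀ i, q.free i ∉ C)
  (hcover : ∀ i, ∃ A ∈ q.atoms, (∃ c ∈ C, c ∈ A.vars) ∧ q.free i ∈ A.vars)
  (hnot : ∀ A ∈ q.atoms, ∀ c ∈ C, c ∈ A.vars → ∃ i, q.free i ∉ A.vars)
  (hconn : ∀ φ : Fin q.numVars → ℕ, (∀ A ∈ q.atoms, ∀ v ∈ C, ∀ v' ∈ C, v ∈ A.vars → v' ∈ A.vars →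
    φ v = φ v') → ∀ v ∈ C, ∀ v' ∈ C, φ v = φ v')

include hC hnot in
theorem exists_not_mem_productVars {A : Atom σ (Fin q.numVars)} (hA : A ∈ q.atoms)
    (h2 : 2 ∈ productVars C A) : 0 ∉ productVars C A ∨ 1 ∉ productVars C A := by
  obtain ⟨-, v, hv, hvC⟩ := mem_productVars.1 h2
  obtain ⟨i, hi⟩ := hnot A hA v ((productColor_eq_two hC).1 hvC) hv
  revert hi
  refine Fin.cases (fun hi => .inl fun h0 => ?_) (fun i hi => .inr fun h1 => ?_) i
  · obtain ⟨-, w, hw, hw0⟩ := mem_productVars.1 h0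
    exact hi (productColor_eq_zero.1 hw0 ▸ hw)
  · obtain ⟨-, w, hw, hw0⟩ := mem_productVars.1 h1
    rw [Subsingleton.elim i 0] at hi
    exact hi (productColor_eq_one.1 hw0 ▸ hw)

-- An atom that meets `C` misses a free variable, so no atom has all three colors and there are
-- `O((n + 1) ^ 2)` facts. An atom with just the two free colors is harmless: it is untested and
-- admits all pairs.
include hC hnot hcover hconn in
theorem coloring_product : q.Coloring 3 2 (productColor C) (productVars C) (productTest C) where
  nodup A _ := List.Nodup.filter _ (by simp)
  mem_vars A _ c := mem_productVars
  length_le A hA := by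
    classical
    have h : ∃ c ∈ [0, 2, 1], c ∉ productVars C A := by
      by_cases h2 : 2 ∈ productVars C A
      · rcases exists_not_mem_productVars hC hnot hA h2 with h | h
        · exact ⟨0, by simp, h⟩
        · exact ⟨1, by simp, h⟩
      · exact ⟨2, by simp, h2⟩
    obtain ⟨c, hc, hcA⟩ := h
    have : (productVars C A).length < [0, 2, 1].length := by
      refine List.length_filter_lt_length_iff_exists.2 ⟨c, hc, fun h => hcA ?_⟩
      exact List.mem_filter.2 ⟨hc, h⟩
    exact Nat.lt_succ_iff.1 this
  test_le A _ b hb := by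
    unfold productTest at hb
    split_ifs at hb <;> cases hb <;> omega
  test_length A _ b hb := by
    unfold productTest at hb
    split_ifs at hb with h1 h2
    · rw [h1]; rfl
    · rw [h2]; rfl
    · cases hb
  connected φ hφ v v' hvv hv := by
    obtain h | h | h : productColor C v = 0 ∨ productColor C v = 1 ∨ productColor C v = 2 := by
      omega
    · rw [productColor_eq_zero.1 h, productColor_eq_zero.1 (hvv.symm.trans h)]
    · rw [productColor_eq_one.1 h, productColor_eq_one.1 (hvv.symm.trans h)]
    · refine hconn φ (fun A hA w hw w' hw' hwA hwA' => ?_) v ((productColor_eq_two hC).1 h) v'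
        ((productColor_eq_two hC).1 (hvv.symm.trans h))
      have h1 := (productColor_eq_two hC).2 hw
      have h2 := (productColor_eq_two hC).2 hw'
      exact hφ A hA w hwA w' hwA' (h1.trans h2.symm) (by omega)
  surj c hc := by
    obtain rfl | rfl | rfl : c = 0 ∨ c = 1 ∨ c = 2 := by omega
    · exact ⟨_, productColor_eq_zero.2 rfl⟩
    · exact ⟨_, productColor_eq_one.2 rfl⟩
    · obtain ⟨-, -, ⟨v, hv, -⟩, -⟩ := hcover 0
      exact ⟨v, (productColor_eq_two hC).2 hv⟩

-- Each matrix is tested by some atom. The order `[0, 2, 1]` in `productVars` makes the two tested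
-- lists agree with the row-by-row layout: row and summation index for the first matrix, summation
-- index and column for the second.
include hC hnot hcover in
theorem exists_productVars_eq : (∃ A ∈ q.atoms, productVars C A = [0, 2]) ∧
    ∃ A ∈ q.atoms, productVars C A = [2, 1] := by
  classical
  constructor
  · obtain ⟨A, hA, ⟨v, hv, hvA⟩, hf⟩ := hcover 0
    have h0 : 0 ∈ productVars C A := mem_productVars.2 ⟨by omega, _, hf, productColor_eq_zero.2 rfl⟩
    have h2 : 2 ∈ productVars C A :=
      mem_productVars.2 ⟨by omega, _, hvA, (productColor_eq_two hC).2 hv⟩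
    have h1 := (exists_not_mem_productVars hC hnot hA h2).resolve_left fun h => h h0
    refine ⟨A, hA, ?_⟩
    simp only [mem_productVars, Nat.reduceLT, true_and, Nat.ofNat_pos, Nat.one_lt_ofNat] at h0 h1 h2
    simp only [productVars, List.filter_cons, List.filter_nil, h0, h1, h2]
    simp
  · obtain ⟨A, hA, ⟨v, hv, hvA⟩, hf⟩ := hcover 1
    have h1 : 1 ∈ productVars C A := mem_productVars.2 ⟨by omega, _, hf, productColor_eq_one.2 rfl⟩
    have h2 : 2 ∈ productVars C A :=
      mem_productVars.2 ⟨by omega, _, hvA, (productColor_eq_two hC).2 hv⟩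
    have h0 := (exists_not_mem_productVars hC hnot hA h2).resolve_right fun h => h h1
    refine ⟨A, hA, ?_⟩
    simp only [mem_productVars, Nat.reduceLT, true_and, Nat.ofNat_pos, Nat.one_lt_ofNat] at h0 h1 h2
    simp only [productVars, List.filter_cons, List.filter_nil, h0, h1, h2]
    simp

theorem getD_first {n : ℕ} (A B : Matrix (Fin n) (Fin n) Bool) (i j : Fin n) :
    (n :: (entries A ++ entries B)).getD (i * n + j + 1) 0 ≠ 0 ↔ A i j = true := by
  have hlt := table_index_lt i.2 j.2
  rw [List.getD_cons_succ, List.getD_append _ _ _ _ (by rw [length_entries]; exact hlt),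
    List.getD_eq_getElem?_getD, getElem?_entries]
  simp

theorem getD_second {n : ℕ} (A B : Matrix (Fin n) (Fin n) Bool) (i j : Fin n) :
    (n :: (entries A ++ entries B)).getD (i * n + j + n * n + 1) 0 ≠ 0 ↔ B i j = true := by
  rw [List.getD_cons_succ, List.getD_append_right _ _ _ _ (by rw [length_entries]; omega),
    length_entries, Nat.add_sub_cancel, List.getD_eq_getElem?_getD, getElem?_entries]
  simp

-- The value of color `2` is the summation index, the free colors are row and column. The second
-- matrix starts `n ^ 2` words after the first, which is the offset for test number `1`.
include hC hnot hcover in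
theorem exists_valid_product_iff {n : ℕ} (A B : Matrix (Fin n) (Fin n) Bool) (i j : Fin n) :
    (∃ u, q.Valid (productColor C) (productVars C) (productTest C) 3 n (n ^ 2)
      (fun p => (n :: (entries A ++ entries B)).getD p 0) u ∧
      u (productColor C (q.free 0)) = i + 1 ∧ u (productColor C (q.free 1)) = j + 1) ↔
    boolMul A B i j = true := by
  rw [productColor_eq_zero.2 rfl, productColor_eq_one.2 rfl, boolMul, decide_eq_true_eq]
  have hpass1 : ∀ (u : ℕ → ℕ) (a k : Fin n), u 0 = a + 1 → u 2 = k + 1 →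
      ((n :: (entries A ++ entries B)).getD (encodeFrom n u 0 [0, 2] + 0 * n ^ 2 + 1) 0 ≠ 0 ↔
        A a k = true) := by
    intro u a k ha hk
    rw [← getD_first A B]
    simp [encodeFrom, ha, hk]
  have hpass2 : ∀ (u : ℕ → ℕ) (b k : Fin n), u 1 = b + 1 → u 2 = k + 1 →
      ((n :: (entries A ++ entries B)).getD (encodeFrom n u 0 [2, 1] + 1 * n ^ 2 + 1) 0 ≠ 0 ↔
        B k b = true) := by
    intro u b k hb hk
    rw [← getD_second A B]
    simp [encodeFrom, hb, hk, sq]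
  constructor
  · rintro ⟨u, hu, hi, hj⟩
    obtain ⟨⟨A₁, hA₁, h1⟩, A₂, hA₂, h2⟩ := exists_productVars_eq hC hcover hnot
    have h2u := hu.range 2 (by omega)
    have hk : u 2 = (⟨u 2 - 1, by omega⟩ : Fin n) + 1 := by simp only; omega
    have e1 := hu.passes A₁ hA₁ 0 (by simp [template, productTest, h1])
    have e2 := hu.passes A₂ hA₂ 1 (by simp [template, productTest, h2])
    simp only [template, h1] at e1
    simp only [template, h2] at e2
    exact ⟨_, (hpass1 u i _ hi hk).1 e1, (hpass2 u j _ hj hk).1 e2⟩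
  · rintro ⟨k, hA, hB⟩
    let u : ℕ → ℕ := fun c =>
      if c = 0 then i + 1 else if c = 1 then j + 1 else if c = 2 then k + 1 else 0
    refine ⟨u, ⟨fun c hc => ?_, fun c hc => ?_, fun A' _ b hb => ?_⟩, rfl, rfl⟩
    · obtain rfl | rfl | rfl : c = 0 ∨ c = 1 ∨ c = 2 := by omega
      · exact ⟨Nat.succ_pos _, i.2⟩
      · exact ⟨Nat.succ_pos _, j.2⟩
      · exact ⟨Nat.succ_pos _, k.2⟩
    · simp only [u]
      rw [if_neg (by omega), if_neg (by omega), if_neg (by omega)]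
    · simp only [template, productTest] at hb ⊢
      split_ifs at hb with h1 h2
      · cases hb
        rw [h1]
        exact (hpass1 u i k rfl rfl).2 hA
      · cases hb
        rw [h2]
        exact (hpass2 u j k rfl rfl).2 hB
      · cases hb

include hC hnot hcover hconn in
/-- A minimal binary query whose free variables are connected by existential variables, but not
within one atom, is hard. -/
theorem not_hasLinearPreprocessingConstantDelay_of_product (hBMM : BMM) (hmin : q.IsMinimal) :
    ¬ q.HasLinearPreprocessingConstantDelay := by
  classical
  intro hq
  obtain ⟨P, c, hP⟩ := (coloring_product hC hcover hnot hconn).exists_program le_rfl hmin hq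
    printProg (fun (n : ℕ) (T : ℕ → ℕ → Prop) => (List.finRange n).flatMap fun i : Fin n =>
      (List.finRange n).map fun j : Fin n => [if T (i.1 + 1) (j.1 + 1) then 1 else 0])
    (fun n d TB x y W T s hs hx hy hW _ => by
      have h := (hs.print hx hy (W := W) (by omega)).mono (T₂ := 30 * (n + 1) ^ 2)
        (Nat.mul_le_mul_right _ (by norm_num)) fun _ h => h
      convert h)
  refine hBMM ⟨P, c, fun n A B => ?_⟩
  have h1 := hP n (n :: (entries A ++ entries B)) rfl (by
    have : n ^ 2 ≤ (n + 1) ^ 2 := Nat.pow_le_pow_left (by omega) _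
    simp only [List.length_cons, List.length_append, length_entries, tableAddr]
    rw [← sq]
    omega)
  convert h1 using 1
  rw [entries, List.map_flatMap]
  refine List.flatMap_congr fun i _ => ?_
  rw [List.map_map]
  refine List.map_congr_left fun j _ => ?_
  simp only [Function.comp_apply, exists_valid_product_iff hC hcover hnot A B i j]
  cases boolMul A B i j <;> simp

end MatrixMultiplication

/-- The hypergraph of a query with an additional edge for the free variables. -/
def edgesWithHead {r : ℕ} (q : Query σ r) : Option q.atoms → Set (Fin q.numVars) :=
  fun A => A.elim (Set.range q.free) fun B => B.1.vars

end CQ.Query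

/-! ### The case distinction between the two reductions -/

open CQ in
theorem mainTheorem2 (hBMM : Conjectures.BMM) (hHyperclique : Conjectures.Hyperclique)
    (σ : CQ.Schema) (q : CQ.Query σ 2) (hmin : q.IsMinimal) (hq : ¬ q.IsAcyclicFreeConnex) :
    ¬ q.HasLinearPreprocessingConstantDelay := by
  rw [Query.IsAcyclicFreeConnex, not_and_or] at hq
  rcases hq with hq | hq
  · obtain ⟨A, hA, -⟩ := q.occurs (q.free 0)
    obtain ⟨M, C, h, -⟩ := exists_cyclePattern (e := q.edges) hq ⟨A, hA⟩
    exact Query.not_hasLinearPreprocessingConstantDelay_of_cyclePattern hHyperclique hmin h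
  -- With the head edge as root, `C` contains no free variable. Hence every hyperedge that meets `C`
  -- is an atom of the query.
  · obtain ⟨M, C, h, hC⟩ := exists_cyclePattern (e := q.edgesWithHead) hq none
    have hfree : ∀ i, q.free i ∉ C := fun i hi => hC _ hi ⟨i, rfl⟩
    have hcover : ∀ m ∈ M, ∃ A ∈ q.atoms, (∃ c ∈ C, c ∈ A.vars) ∧
        ∀ m' ∈ M, m' ≠ m → m' ∈ A.vars := by
      intro m hm
      obtain ⟨f, ⟨c, hc, hcf⟩, h1⟩ := h.cover_erase m hm
      cases f with
      | none => exact absurd hcf (hC c hc)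
      | some A => exact ⟨A.1, A.2, ⟨c, hc, hcf⟩, h1⟩
    have hconn : ∀ φ : Fin q.numVars → ℕ, (∀ A ∈ q.atoms, ∀ v ∈ C, ∀ v' ∈ C, v ∈ A.vars →
        v' ∈ A.vars → φ v = φ v') → ∀ v ∈ C, ∀ v' ∈ C, φ v = φ v' := by
      refine fun φ hφ => h.connected φ fun f v hv v' hv' hvf hvf' => ?_
      cases f with
      | none => exact absurd hvf (hC v hv)
      | some A => exact hφ A.1 A.2 v hv v' hv' hvf hvf'
    obtain ⟨g, hg⟩ := h.cover
    cases g with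
    -- The head edge is not used by the pattern, which is therefore a pattern of the query itself.
    | some A =>
      refine Query.not_hasLinearPreprocessingConstantDelay_of_cyclePattern hHyperclique hmin
        (M := M) (C := C) ⟨h.two_le, h.disjoint, ⟨A, hg⟩, fun m hm => ?_,
        fun f => h.not_cover (some f), fun φ hφ => hconn φ fun A hA => hφ ⟨A, hA⟩⟩
      obtain ⟨A, hA, h1⟩ := hcover m hm
      exact ⟨⟨A, hA⟩, h1⟩
    | none =>
      -- `M` has at least two elements and lies in the head edge, which has exactly two because the
      -- query is binary.
      have hMfree : ∀ i, q.free i ∈ M := by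
        have hsub : M ⊆ Finset.univ.image q.free := fun m hm => by
          obtain ⟨i, rfl⟩ := hg m hm
          exact Finset.mem_image_of_mem _ (Finset.mem_univ _)
        have hM : M = Finset.univ.image q.free := by
          refine Finset.eq_of_subset_of_card_le hsub (Finset.card_image_le.trans ?_)
          simpa using h.two_le
        exact fun i => hM ▸ Finset.mem_image_of_mem _ (Finset.mem_univ _)
      refine Query.not_hasLinearPreprocessingConstantDelay_of_product hfree (fun i => ?_)
        (fun A hA c hc hcA => ?_) hconn hBMM hmin
      -- Erasing the other free variable from `M` gives an atom that meets `C` and contains `q.free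
      -- i`.
      · obtain ⟨i', hi'⟩ : ∃ i' : Fin 2, i ≠ i' :=
          (exists_ne i).imp fun _ h => h.symm
        obtain ⟨A, hA, h1, h2⟩ := hcover _ (hMfree i')
        exact ⟨A, hA, h1, h2 _ (hMfree i) fun h => hi' (q.free_injective h)⟩
      · obtain ⟨m, hm, hmA⟩ := h.not_cover (some ⟨A, hA⟩) c hc hcA
        obtain ⟨i, rfl⟩ := hg m hm
        exact ⟨i, hmA⟩
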